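/- **Extended stochastic sewing lemma.** Let $(\Omega,\mathcal F,\mathbb P)$ be a probability space with a filtration $(\mathcal F_t)_{t\in[0,T]}$, $T\ge 0$, let $m\in[2,\infty)$, and let $(A_{s,t})_{0\le s\le t\le T}$ be $\mathbb R^d$-valued random variables such that $A_{s,s}=0$, $A_{s,t}$ is $\mathcal F_t$-measurable and $A_{s,t}\in L_m(\mathbb P)$. Put $\delta A_{s,u,t}:=A_{s,t}-A_{s,u}-A_{u,t}$ for $s<u<t$. Let $\Gamma_1,\Gamma_2,M,\alpha,\beta_1,\beta_2\in[0,\infty)$ be such that for all $0\le t_0<t_1<t_2<t_3\le T$ $$\|\mathbb E[\delta A_{t_1,t_2,t_3}\mid\mathcal F_{t_0}]\|_{L_m}\le\Gamma_1(t_1-t_0)^{-\alpha}(t_3-t_1)^{\beta_1}\quad\text{if } M(t_3-t_1)\le t_1-t_0,$$ for all $0\le t_0<t_1<t_2\le T$ $$\|\delta A_{t_0,t_1,t_2}\|_{L_m}\le\Gamma_2(t_2-t_0)^{\beta_2},$$ and $\beta_1>1$, $\beta_2>\tfrac12$, $\beta_1-\alpha>\tfrac12$. Then there is a process $(\mathcal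 A_t)_{t\in[0,T]}$, unique up to modifications, with values in $\mathbb R^d$ and the following properties: * $\mathcal A_0=0$ almost surely, $\mathcal A_t$ is $\mathcal F_t$-measurable, and $\mathcal A_t\in L_m(\mathbb P)$ for all $t\in[0,T]$; * there are constants $C_1,C_2,C_3\ge 0$ such that for all $0\le t_0<t_1<t_2\le T$ with $M(t_2-t_1)\le t_1-t_0$ $$\|\mathbb E[\mathcal A_{t_2}-\mathcal A_{t_1}-A_{t_1,t_2}\mid\mathcal F_{t_0}]\|_{L_m}\le C_1(t_1-t_0)^{-\alpha}(t_2-t_1)^{\beta_1},$$ and for all $0\le t_1<t_2\le T$ $$\|\mathcal A_{t_2}-\mathcal A_{t_1}-A_{t_1,t_2}\|_{L_m}\le C_2(t_2-t_1)^{\beta_1-\alpha}+C_3(t_2-t_1)^{\beta_2}.$$ Moreover, these constants can be chosen such that $$C_1\le K_1\Gamma_1,\qquad C_2\le K_2\,\kappa_{m,d}\,\Gamma_1,\qquad C_3\le K_3\,\kappa_{m,d}\,\Gamma_2,$$ where $K_1$ depends only on $\beta_1$, where $K_2,K_3$ depend only on $\alpha,\beta_1,\beta_2,M$, and where $\kappa_{m,d}$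 is the best constant of the discrete Burkholder–Davis–Gundy inequality, i.e. the smallest $\kappa\ge 0$ such that $$\Big\|\sum_n X_n\Big\|_{L_m}\le\kappa\,\Big\|\sum_n|X_n|^2\Big\|_{L_{m/2}}^{1/2}$$ for all finite $\mathbb R^d$-valued sequences $(X_n)_{n=1}^N$ in $L_m$ that are adapted to some filtration $(\mathcal G_n)$ on some probability space and satisfy $\mathbb E[X_n\mid\mathcal G_{n-1}]=0$ for $n\ge 2$. Finally, for every $\tau\in[0,T]$, the sums $A^\pi_\tau:=\sum_{[s,t]\in\pi}A_{s,t}$ over partitions $\pi$ of $[0,\tau]$ converge to $\mathcal A_\tau$ in $L_m(\mathbb P)$ as the mesh $|\pi|=\max_{[s,t]\in\pi}|t-s|$ tends to $0$. -/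

import Mathlib

open MeasureTheory ProbabilityTheory Filter Topology
open scoped ENNReal

universe u

noncomputable section

/-- `δA_{s,u,t} = A_{s,t} - A_{s,u} - A_{u,t}`, as a random variable. -/
def sewDelta {Ω ι E : Type*} [AddCommGroup E] (A : ι → ι → Ω → E) (s u t : ι) : Ω → E :=
  fun ω => A s t ω - A s u ω - A u t ω

/-- `c` is an admissible constant in the discrete Burkholder-Davis-Gundy inequality for
`ℝ^d`-valued martingale differences with exponent `m`: if `X n` is `𝓖 n`-measurable for all `n`
and `E[X (n+1) | 𝓖 n] = 0` for all `n` (nothing is required of the mean of the first term `X 0`),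
then `‖∑ X_n‖_{L_m} ≤ c ‖∑ |X_n|²‖_{L_{m/2}}^{1/2}` for all finite sums. (When some `X n` is not in
`L_m` the right-hand side is infinite, so only `L_m`-sequences matter.) -/
def IsBDGConstant (m : ℝ) (d : ℕ) (c : ℝ) : Prop :=
  ∀ (Ω : Type u) (mΩ : MeasurableSpace Ω) (P : Measure Ω) (_ : IsProbabilityMeasure P)
    (𝓖 : Filtration ℕ mΩ) (X : ℕ → Ω → EuclideanSpace ℝ (Fin d)),
    (∀ n, StronglyMeasurable[𝓖 n] (X n)) →
    (∀ n, MemLp (X n) (ENNReal.ofReal m) P) →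
    (∀ n, P[X (n + 1) | 𝓖 n] =ᵐ[P] 0) →
    ∀ N : ℕ,
      eLpNorm (fun ω => ∑ n ∈ Finset.range N, X n ω) (ENNReal.ofReal m) P ≤
        ENNReal.ofReal c *
          (eLpNorm (fun ω => ∑ n ∈ Finset.range N, ‖X n ω‖ ^ 2) (ENNReal.ofReal (m / 2)) P)
            ^ (1 / 2 : ℝ)

/-- The best constant `κ_{m,d}` of the discrete Burkholder-Davis-Gundy inequality. -/
def bdgConst (m : ℝ) (d : ℕ) : ℝ :=
  sInf {c : ℝ | 0 ≤ c ∧ IsBDGConstant.{u} m d c}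

/-- A partition `0 = t_0 < t_1 < ⋯ < t_n = τ` of `[0, τ]`, where `τ ∈ [0, T]`. The values
`pt i` with `i > n` are irrelevant. For `τ = 0` the only possibility is `n = 0`. -/
structure PartitionUpTo {T : ℝ} (τ : Set.Icc (0 : ℝ) T) where
  /-- the number of subintervals -/
  n : ℕ
  /-- the partition points -/
  pt : ℕ → Set.Icc (0 : ℝ) T
  pt_lt : ∀ i < n, pt i < pt (i + 1)
  pt_zero : (pt 0 : ℝ) = 0
  pt_last : pt n = τ

/-- The mesh `|π| = max_{[s,t] ∈ π} |t - s|` (equal to `0` if there is no subinterval). -/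
def PartitionUpTo.mesh {T : ℝ} {τ : Set.Icc (0 : ℝ) T} (π : PartitionUpTo τ) : ℝ :=
  ⨆ i : Fin π.n, |(π.pt (i + 1) : ℝ) - π.pt i|

/-- The Riemann sum `A^π_τ = ∑_{[s,t] ∈ π} A_{s,t}`. -/
def PartitionUpTo.riemannSum {T : ℝ} {τ : Set.Icc (0 : ℝ) T} {Ω E : Type*} [AddCommGroup E]
    (π : PartitionUpTo τ) (A : Set.Icc (0 : ℝ) T → Set.Icc (0 : ℝ) T → Ω → E) : Ω → E :=
  fun ω => ∑ i ∈ Finset.range π.n, A (π.pt i) (π.pt (i + 1)) ω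

/-- The conditional and the unconditional bound on `𝒜_{t₂} - 𝒜_{t₁} - A_{t₁,t₂}`, with constants
`C₁` and `C₂, C₃`. The condition `t₂ - t₁ ≤ M⁻¹ (t₁ - t₀)` is written
`M (t₂ - t₁) ≤ t₁ - t₀`, which is void for `M = 0`. -/
def SewingBounds {Ω : Type*} {mΩ : MeasurableSpace Ω} (P : Measure Ω) {d : ℕ} {T : ℝ}
    (𝓕 : Filtration (Set.Icc (0 : ℝ) T) mΩ)
    (A : Set.Icc (0 : ℝ) T → Set.Icc (0 : ℝ) T → Ω → EuclideanSpace ℝ (Fin d))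
    (m M α β₁ β₂ : ℝ) (𝒜 : Set.Icc (0 : ℝ) T → Ω → EuclideanSpace ℝ (Fin d))
    (C₁ C₂ C₃ : ℝ) : Prop :=
  (∀ t₀ t₁ t₂ : Set.Icc (0 : ℝ) T, t₀ < t₁ → t₁ < t₂ →
    M * ((t₂ : ℝ) - t₁) ≤ (t₁ : ℝ) - t₀ →
    eLpNorm (P[fun ω => 𝒜 t₂ ω - 𝒜 t₁ ω - A t₁ t₂ ω | 𝓕 t₀]) (ENNReal.ofReal m) P ≤
      ENNReal.ofReal (C₁ * ((t₁ : ℝ) - t₀) ^ (-α) * ((t₂ : ℝ) - t₁) ^ β₁)) ∧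
  (∀ t₁ t₂ : Set.Icc (0 : ℝ) T, t₁ < t₂ →
    eLpNorm (fun ω => 𝒜 t₂ ω - 𝒜 t₁ ω - A t₁ t₂ ω) (ENNReal.ofReal m) P ≤
      ENNReal.ofReal (C₂ * ((t₂ : ℝ) - t₁) ^ (β₁ - α) + C₃ * ((t₂ : ℝ) - t₁) ^ β₂))

/-- The properties that characterize the process `𝒜`: it starts at `0`, is adapted and in `L_m`,
and satisfies the two bounds for some non-negative constants. -/
structure IsSewing {Ω : Type*} {mΩ : MeasurableSpace Ω} (P : Measure Ω) {d : ℕ} {T : ℝ}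
    (𝓕 : Filtration (Set.Icc (0 : ℝ) T) mΩ)
    (A : Set.Icc (0 : ℝ) T → Set.Icc (0 : ℝ) T → Ω → EuclideanSpace ℝ (Fin d))
    (m M α β₁ β₂ : ℝ) (𝒜 : Set.Icc (0 : ℝ) T → Ω → EuclideanSpace ℝ (Fin d)) : Prop where
  initial : ∀ t : Set.Icc (0 : ℝ) T, (t : ℝ) = 0 → 𝒜 t =ᵐ[P] 0
  adapted : ∀ t, StronglyMeasurable[𝓕 t] (𝒜 t)
  memLp : ∀ t, MemLp (𝒜 t) (ENNReal.ofReal m) P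
  bounds : ∃ C₁ C₂ C₃ : ℝ, 0 ≤ C₁ ∧ 0 ≤ C₂ ∧ 0 ≤ C₃ ∧
    SewingBounds P 𝓕 A m M α β₁ β₂ 𝒜 C₁ C₂ C₃

end

/-!
The process is the `L_m`-limit of the Riemann sums of `A` along the dyadic grids. Passing from one
grid to the next adds a sum of terms `δA` over cells of width `w`, and such a sum is controlled by
two effects. The parts centred at a conditional expectation with a fixed lag are martingale
differences along residue classes, so the Burkholder-Davis-Gundy inequality bounds the sum of `N`
of them by a multiple of `N ^ (1 / 2)`. The conditional expectations are grouped in pairs and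
treated in the same way one scale up: the lag doubles, which costs a factor `2 ^ (1 - α)` per scale.
For an exponent `θ` strictly between `max (1 / 2) (1 - α)` and `β₁ - α` the iteration gives the
bound `N ^ θ`, and summing over the grids leaves convergent geometric series.

The error `𝒜 t - 𝒜 s - A s t` satisfies bounds of the same form as `δA`, so the same estimate
applies to any partition once its intervals are sorted by length into dyadic classes. Hence its
Riemann sums tend to `0` with the mesh. This is the convergence of the Riemann sums of `A`, and it
also implies uniqueness.

For `m ≥ 2` the Burkholder-Davis-Gundy constant is finite: a second-order expansion of `‖·‖ ^ m`
along the partial sums, Doob's maximal inequality and Young's inequality bound the `m`-th moment of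
the maximal function by half of itself plus a multiple of that of the square function.
-/

/-! ### The discrete Burkholder-Davis-Gundy inequality -/

section PowerInequalities

lemma mul_mul_rpow_sub_one_le {a b p : ℝ} (ha : 0 ≤ a) (hb : 0 ≤ b) (hp : 1 ≤ p) :
    p * (a * b ^ (p - 1)) ≤ a ^ p + (p - 1) * b ^ p := by
  have hp₀ : 0 < p := by linarith
  have amgm := Real.geom_mean_le_arith_mean2_weighted (w₁ := 1 / p) (w₂ := (p - 1) / p)
    (p₁ := a ^ p) (p₂ := b ^ p) (by positivity) (div_nonneg (by linarith) hp₀.le)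
    (by positivity) (by positivity) (by field_simp; ring)
  rw [← Real.rpow_mul ha, ← Real.rpow_mul hb, mul_one_div_cancel hp₀.ne', Real.rpow_one,
    mul_div_cancel₀ _ hp₀.ne'] at amgm
  calc p * (a * b ^ (p - 1)) ≤ p * (1 / p * a ^ p + (p - 1) / p * b ^ p) := by gcongr
    _ = a ^ p + (p - 1) * b ^ p := by field_simp

lemma rpow_sub_one_mul_self {a p : ℝ} (ha : 0 ≤ a) (hp : p ≠ 0) : a ^ (p - 1) * a = a ^ p := by
  rw [← Real.rpow_add_one' ha (by simpa using hp), sub_add_cancel]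

lemma rpow_sub_two_mul_sq {a p : ℝ} (ha : 0 ≤ a) (hp : 2 ≤ p) : a ^ (p - 2) * a ^ 2 = a ^ p := by
  rw [← Real.rpow_two, ← Real.rpow_add_of_nonneg ha (by linarith) (by norm_num), sub_add_cancel]

lemma rpow_sub_rpow_le {a b p : ℝ} (ha : 0 ≤ a) (hb : 0 ≤ b) (hp : 1 ≤ p) :
    b ^ p - a ^ p ≤ p * b ^ (p - 1) * (b - a) := by
  have young := mul_mul_rpow_sub_one_le ha hb hp
  have hbp := rpow_sub_one_mul_self hb (p := p) (by linarith)
  linear_combination young - p * hbp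

lemma abs_rpow_sub_rpow_mul_le {a b s : ℝ} (ha : 0 ≤ a) (hb : 0 ≤ b) (hs : 0 ≤ s) :
    |b ^ s - a ^ s| * a ≤ (s + 1) * max a b ^ s * |a - b| := by
  have has : a ^ (s + 1) = a ^ s * a := Real.rpow_add_one' ha (by linarith)
  have hbs : b ^ (s + 1) = b ^ s * b := Real.rpow_add_one' hb (by linarith)
  have hbs₀ : 0 ≤ b ^ s := Real.rpow_nonneg hb s
  rcases le_total a b with h | h
  · have tangent := rpow_sub_rpow_le ha hb (p := s + 1) (by linarith)
    rw [add_sub_cancel_right] at tangent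
    rw [max_eq_right h, abs_of_nonneg (sub_nonneg.2 (Real.rpow_le_rpow ha h hs)),
      abs_of_nonpos (by linarith)]
    nlinarith
  · have tangent := rpow_sub_rpow_le hb ha (p := s + 1) (by linarith)
    rw [add_sub_cancel_right] at tangent
    rw [max_eq_left h, abs_of_nonpos (sub_nonpos.2 (Real.rpow_le_rpow hb h hs)),
      abs_of_nonneg (by linarith)]
    nlinarith

lemma rpow_mul_rpow_le_add {x y c p q : ℝ} (hx : 0 ≤ x) (hy : 0 ≤ y) (hc : 0 < c) (hp : 0 ≤ p)
    (hq : 0 ≤ q) :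
    x ^ p * y ^ q ≤ c ^ q * x ^ (p + q) + (c ^ p)⁻¹ * y ^ (p + q) := by
  rcases le_total y (c * x) with h | h
  · refine le_add_of_le_of_nonneg ?_ (by positivity)
    calc x ^ p * y ^ q ≤ x ^ p * (c * x) ^ q := by gcongr
      _ = c ^ q * x ^ (p + q) := by
        rw [Real.mul_rpow hc.le hx, Real.rpow_add_of_nonneg hx hp hq]; ring
  · refine le_add_of_nonneg_of_le (by positivity) ?_
    calc x ^ p * y ^ q = (c ^ p)⁻¹ * ((c * x) ^ p * y ^ q) := by
          rw [Real.mul_rpow hc.le hx]; field_simp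
      _ ≤ (c ^ p)⁻¹ * (y ^ p * y ^ q) := by gcongr
      _ = (c ^ p)⁻¹ * y ^ (p + q) := by rw [Real.rpow_add_of_nonneg hy hp hq]

lemma running_max_increment_le {m S s b : ℝ} (hm : 1 ≤ m) (hS : 0 ≤ S) (hb : 0 ≤ b) :
    m * (S ^ (m - 1) * (b - s)) ≤
      (m * (max S b ^ (m - 1) * b) - (m - 1) * max S b ^ m) -
        (m * (S ^ (m - 1) * s) - (m - 1) * S ^ m) := by
  rcases le_total b S with h | h
  · rw [max_eq_left h]; linarith
  · rw [max_eq_right h, rpow_sub_one_mul_self hb (by linarith)]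
    linarith [mul_mul_rpow_sub_one_le hb hS hm]

section InnerProductSpace

variable {E : Type*} [NormedAddCommGroup E] [InnerProductSpace ℝ E]

lemma inv_norm_mul_inner_le_norm_add_sub_norm (x y : E) :
    ‖x‖⁻¹ * inner ℝ x y ≤ ‖x + y‖ - ‖x‖ := by
  rcases eq_or_ne x 0 with rfl | hx
  · simp
  · have hcs : ‖x‖ ^ 2 + inner ℝ x y ≤ ‖x‖ * ‖x + y‖ := by
      rw [← real_inner_self_eq_norm_sq, ← inner_add_right]
      exact real_inner_le_norm x (x + y)
    rw [inv_mul_le_iff₀ (norm_pos_iff.2 hx)]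
    linarith

lemma norm_add_rpow_le_tangent {m : ℝ} (hm : 2 ≤ m) (x y : E) :
    ‖x + y‖ ^ m ≤ ‖x‖ ^ m + m / 2 * ‖x + y‖ ^ (m - 2) * (2 * inner ℝ x y + ‖y‖ ^ 2) := by
  have tangent := rpow_sub_rpow_le (a := ‖x‖ ^ 2) (b := ‖x + y‖ ^ 2) (p := m / 2) (by positivity)
    (by positivity) (by linarith)
  simp only [← Real.rpow_natCast_mul (norm_nonneg _)] at tangent
  push_cast at tangent
  rw [mul_div_cancel₀ m two_ne_zero, show (2 : ℝ) * (m / 2 - 1) = m - 2 by ring,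
    norm_add_sq_real x y] at tangent
  linarith

lemma norm_add_rpow_le {m : ℝ} (hm : 2 ≤ m) (x y : E) :
    ‖x + y‖ ^ m ≤ ‖x‖ ^ m + m * (‖x‖ ^ (m - 2) * inner ℝ x y) +
      m ^ 2 * (max ‖x‖ ‖x + y‖ ^ (m - 2) * ‖y‖ ^ 2) := by
  have tangent := norm_add_rpow_le_tangent hm x y
  set B := max ‖x‖ ‖x + y‖ ^ (m - 2)
  have hB : 0 ≤ B * ‖y‖ ^ 2 := by positivity
  have : 0 ≤ m - 2 + 1 := by linarith
  have first_order_error : (‖x + y‖ ^ (m - 2) - ‖x‖ ^ (m - 2)) * inner ℝ x y ≤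
      (m - 2 + 1) * (B * ‖y‖ ^ 2) := by
    calc (‖x + y‖ ^ (m - 2) - ‖x‖ ^ (m - 2)) * inner ℝ x y
        ≤ |‖x + y‖ ^ (m - 2) - ‖x‖ ^ (m - 2)| * |inner ℝ x y| := by
          rw [← abs_mul]; exact le_abs_self _
      _ ≤ |‖x + y‖ ^ (m - 2) - ‖x‖ ^ (m - 2)| * (‖x‖ * ‖y‖) := by
          gcongr; exact abs_real_inner_le_norm x y
      _ = |‖x + y‖ ^ (m - 2) - ‖x‖ ^ (m - 2)| * ‖x‖ * ‖y‖ := by ring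
      _ ≤ (m - 2 + 1) * B * |‖x‖ - ‖x + y‖| * ‖y‖ := by
          refine mul_le_mul_of_nonneg_right ?_ (norm_nonneg y)
          exact abs_rpow_sub_rpow_mul_le (s := m - 2) (norm_nonneg x) (norm_nonneg (x + y))
            (by linarith)
      _ ≤ (m - 2 + 1) * B * ‖y‖ * ‖y‖ := by
          gcongr
          simpa using abs_norm_sub_norm_le x (x + y)
      _ = (m - 2 + 1) * (B * ‖y‖ ^ 2) := by ring
  have second_order : ‖x + y‖ ^ (m - 2) * ‖y‖ ^ 2 ≤ B * ‖y‖ ^ 2 := by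
    gcongr
    exact Real.rpow_le_rpow (norm_nonneg _) (le_max_right _ _) (by linarith)
  linarith [mul_nonneg (show 0 ≤ m / 2 by linarith) (sub_nonneg.2 second_order),
    mul_le_mul_of_nonneg_left first_order_error (show 0 ≤ m by linarith),
    mul_nonneg (show 0 ≤ m / 2 by linarith) hB]

end InnerProductSpace

end PowerInequalities

section BDG

variable {Ω : Type*} {mΩ : MeasurableSpace Ω} {P : Measure Ω}

lemma integrable_rpow_mul_rpow {f g : Ω → ℝ} {a b m : ℝ} (ha : 0 ≤ a) (hb : 0 ≤ b)
    (hab : a + b = m) (hm : 0 < m) (hf : MemLp f (ENNReal.ofReal m) P)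
    (hg : MemLp g (ENNReal.ofReal m) P) (hf₀ : 0 ≤ f) (hg₀ : 0 ≤ g) :
    Integrable (fun ω => f ω ^ a * g ω ^ b) P := by
  subst hab
  have integrable_rpow {h : Ω → ℝ} (hh : MemLp h (ENNReal.ofReal (a + b)) P) (hh₀ : 0 ≤ h) :
      Integrable (fun ω => h ω ^ (a + b)) P := by
    have hint := hh.integrable_norm_rpow (by simpa using hm) (by simp)
    simpa only [Real.norm_of_nonneg (hh₀ _), ENNReal.toReal_ofReal hm.le] using hint
  refine ((integrable_rpow hf hf₀).add (integrable_rpow hg hg₀)).mono'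
    ((hf.1.aemeasurable.pow_const a).mul (hg.1.aemeasurable.pow_const b)).aestronglyMeasurable
    (ae_of_all _ fun ω => ?_)
  have split := rpow_mul_rpow_le_add (hf₀ ω) (hg₀ ω) one_pos ha hb
  have hfω : 0 ≤ f ω := hf₀ ω
  have hgω : 0 ≤ g ω := hg₀ ω
  rw [Real.norm_of_nonneg (by positivity)]
  simpa using split

lemma integral_inner_eq_zero_of_condExp_eq_zero [IsFiniteMeasure P] {E : Type*}
    [NormedAddCommGroup E] [InnerProductSpace ℝ E] [CompleteSpace E] {m₀ : MeasurableSpace Ω}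
    (hm₀ : m₀ ≤ mΩ) {V X : Ω → E} (hV : StronglyMeasurable[m₀] V) (hX : Integrable X P)
    (hVX : Integrable (fun ω => inner ℝ (V ω) (X ω)) P) (h : P[X | m₀] =ᵐ[P] 0) :
    ∫ ω, inner ℝ (V ω) (X ω) ∂P = 0 := by
  have pull_out : P[fun ω => inner ℝ (V ω) (X ω) | m₀] =ᵐ[P]
      fun ω => inner ℝ (V ω) (P[X | m₀] ω) :=
    condExp_bilin_of_stronglyMeasurable_left (innerSL ℝ) hV hVX hX
  have hzero : P[fun ω => inner ℝ (V ω) (X ω) | m₀] =ᵐ[P] 0 := by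
    filter_upwards [pull_out, h] with ω hω hXω
    simpa [hXω] using hω
  rw [← integral_condExp hm₀, integral_congr_ae hzero]
  exact integral_zero _ _

variable {E : Type*} [NormedAddCommGroup E]

/-- The sequences to which the discrete Burkholder-Davis-Gundy inequality applies: `L_m`-valued
martingale differences, the first of which may have a non-zero mean. -/
structure IsMartingaleDifference [NormedSpace ℝ E] (P : Measure Ω) (m : ℝ) (𝓖 : Filtration ℕ mΩ)
    (X : ℕ → Ω → E) : Prop where
  adapted : ∀ n, StronglyMeasurable[𝓖 n] (X n)
  memLp : ∀ n, MemLp (X n) (ENNReal.ofReal m) P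
  condExp : ∀ n, P[X (n + 1) | 𝓖 n] =ᵐ[P] 0

/-- The partial sums of a sequence of random variables. -/
def partialSum (X : ℕ → Ω → E) (n : ℕ) (ω : Ω) : E := ∑ i ∈ Finset.range n, X i ω

/-- The maximal function `max_{k ≤ n} ‖∑_{i < k} X i‖` of Doob's inequality. -/
def maxPartialSum (X : ℕ → Ω → E) (n : ℕ) (ω : Ω) : ℝ :=
  partialSups (fun k => ‖partialSum X k ω‖) n

/-- The square function of the Burkholder-Davis-Gundy inequality. -/
noncomputable def squareFun (X : ℕ → Ω → E) (n : ℕ) (ω : Ω) : ℝ :=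
  √(∑ i ∈ Finset.range n, ‖X i ω‖ ^ 2)

variable {m : ℝ} {𝓖 : Filtration ℕ mΩ} {X : ℕ → Ω → E}

lemma partialSum_zero (ω : Ω) : partialSum X 0 ω = 0 := rfl

lemma partialSum_succ (n : ℕ) (ω : Ω) : partialSum X (n + 1) ω = partialSum X n ω + X n ω :=
  Finset.sum_range_succ _ _

lemma maxPartialSum_zero (ω : Ω) : maxPartialSum X 0 ω = 0 := by
  simp [maxPartialSum, partialSum]

lemma maxPartialSum_succ (n : ℕ) (ω : Ω) :
    maxPartialSum X (n + 1) ω = max (maxPartialSum X n ω) ‖partialSum X (n + 1) ω‖ :=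
  partialSups_succ _ n

lemma norm_partialSum_le_maxPartialSum {n N : ℕ} (h : n ≤ N) (ω : Ω) :
    ‖partialSum X n ω‖ ≤ maxPartialSum X N ω :=
  le_partialSups_of_le (fun k => ‖partialSum X k ω‖) h

lemma maxPartialSum_nonneg (n : ℕ) (ω : Ω) : 0 ≤ maxPartialSum X n ω :=
  (norm_nonneg (partialSum X n ω)).trans (norm_partialSum_le_maxPartialSum le_rfl ω)

lemma stronglyMeasurable_maxPartialSum {m₀ : MeasurableSpace Ω} {n : ℕ}
    (h : ∀ k ≤ n, StronglyMeasurable[m₀] (partialSum X k)) :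
    StronglyMeasurable[m₀] (maxPartialSum X n) := by
  induction n with
  | zero =>
    rw [show maxPartialSum X 0 = _ from funext maxPartialSum_zero]
    exact stronglyMeasurable_const
  | succ n ih =>
    rw [show maxPartialSum X (n + 1) = _ from funext (maxPartialSum_succ n)]
    exact (ih fun k hk => h k (by lia)).sup (h (n + 1) le_rfl).norm

lemma squareFun_nonneg (n : ℕ) (ω : Ω) : 0 ≤ squareFun X n ω := Real.sqrt_nonneg _

lemma sq_squareFun (n : ℕ) (ω : Ω) : squareFun X n ω ^ 2 = ∑ i ∈ Finset.range n, ‖X i ω‖ ^ 2 :=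
  Real.sq_sqrt (Finset.sum_nonneg fun _ _ => by positivity)

lemma squareFun_le_sum_norm (n : ℕ) (ω : Ω) :
    squareFun X n ω ≤ ∑ i ∈ Finset.range n, ‖X i ω‖ :=
  Real.sqrt_le_iff.2 ⟨Finset.sum_nonneg fun _ _ => norm_nonneg _,
    Finset.sum_sq_le_sq_sum_of_nonneg fun _ _ => norm_nonneg _⟩

/-- The functional `m S ^ (m - 1) ‖s‖ - (m - 1) S ^ m` of a martingale `s` and its maximal function
`S`. Along the martingale it is a submartingale, and this is Doob's maximal inequality. -/
noncomputable def doobFunctional (m : ℝ) (X : ℕ → Ω → E) (n : ℕ) (ω : Ω) : ℝ :=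
  m * (maxPartialSum X n ω ^ (m - 1) * ‖partialSum X n ω‖) - (m - 1) * maxPartialSum X n ω ^ m

lemma mul_inner_le_doobFunctional_sub [InnerProductSpace ℝ E] (hm : 1 ≤ m) (n : ℕ) (ω : Ω) :
    m * (maxPartialSum X n ω ^ (m - 1) * ‖partialSum X n ω‖⁻¹ *
        inner ℝ (partialSum X n ω) (X n ω)) ≤
      doobFunctional m X (n + 1) ω - doobFunctional m X n ω := by
  have hmax := maxPartialSum_nonneg (X := X) n ω
  rw [doobFunctional, doobFunctional, maxPartialSum_succ]
  refine le_trans ?_ (running_max_increment_le hm hmax (norm_nonneg _))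
  rw [mul_assoc (maxPartialSum X n ω ^ (m - 1)), partialSum_succ]
  gcongr
  exact inv_norm_mul_inner_le_norm_add_sub_norm _ _

namespace IsMartingaleDifference

section NormedSpace

variable [NormedSpace ℝ E]

lemma memLp_partialSum (hX : IsMartingaleDifference P m 𝓖 X) (n : ℕ) :
    MemLp (partialSum X n) (ENNReal.ofReal m) P :=
  memLp_finsetSum _ fun i _ => hX.memLp i

lemma memLp_maxPartialSum (hX : IsMartingaleDifference P m 𝓖 X) (n : ℕ) :
    MemLp (maxPartialSum X n) (ENNReal.ofReal m) P := by
  induction n with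
  | zero =>
    rw [show maxPartialSum X 0 = _ from funext maxPartialSum_zero]
    exact MemLp.zero'
  | succ n ih =>
    rw [show maxPartialSum X (n + 1) = _ from funext (maxPartialSum_succ n)]
    exact ih.sup (hX.memLp_partialSum (n + 1)).norm

lemma memLp_squareFun (hX : IsMartingaleDifference P m 𝓖 X) (n : ℕ) :
    MemLp (squareFun X n) (ENNReal.ofReal m) P := by
  refine (memLp_finsetSum (Finset.range n) fun i _ => (hX.memLp i).norm).mono' ?_ ?_
  · refine Real.continuous_sqrt.comp_aestronglyMeasurable ?_
    exact Finset.aestronglyMeasurable_fun_sum _ fun i _ => (hX.memLp i).1.norm.pow 2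
  · refine ae_of_all _ fun ω => ?_
    rw [Real.norm_of_nonneg (squareFun_nonneg n ω)]
    simpa using squareFun_le_sum_norm n ω

lemma stronglyMeasurable_partialSum (hX : IsMartingaleDifference P m 𝓖 X) {k n : ℕ} (hk : k ≤ n) :
    StronglyMeasurable[𝓖 (n - 1)] (partialSum X k) :=
  Finset.stronglyMeasurable_fun_sum _ fun i hi =>
    (hX.adapted i).mono (𝓖.mono (by have := Finset.mem_range.1 hi; omega))

lemma integrable_rpow_mul_rpow_maxPartialSum (hX : IsMartingaleDifference P m 𝓖 X) {a b : ℝ}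
    (ha : 0 ≤ a) (hb : 0 ≤ b) (hab : a + b = m) (hm : 0 < m) (n : ℕ) {g : Ω → ℝ}
    (hg : MemLp g (ENNReal.ofReal m) P) (hg₀ : 0 ≤ g) :
    Integrable (fun ω => maxPartialSum X n ω ^ a * g ω ^ b) P :=
  integrable_rpow_mul_rpow ha hb hab hm (hX.memLp_maxPartialSum n) hg (maxPartialSum_nonneg n) hg₀

lemma integrable_maxPartialSum_rpow (hX : IsMartingaleDifference P m 𝓖 X) (hm : 0 < m) (n : ℕ) :
    Integrable (fun ω => maxPartialSum X n ω ^ m) P := by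
  simpa using hX.integrable_rpow_mul_rpow_maxPartialSum hm.le le_rfl (add_zero m) hm n
    (hX.memLp_maxPartialSum n) (maxPartialSum_nonneg n)

lemma integrable_maxPartialSum_rpow_mul_sq (hX : IsMartingaleDifference P m 𝓖 X) (hm : 2 ≤ m)
    (n : ℕ) {g : Ω → ℝ} (hg : MemLp g (ENNReal.ofReal m) P) (hg₀ : 0 ≤ g) :
    Integrable (fun ω => maxPartialSum X n ω ^ (m - 2) * g ω ^ 2) P := by
  simpa using hX.integrable_rpow_mul_rpow_maxPartialSum (by linarith) zero_le_two
    (sub_add_cancel m 2) (by linarith) n hg hg₀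

lemma integrable_doobFunctional (hX : IsMartingaleDifference P m 𝓖 X) (hm : 1 ≤ m) (n : ℕ) :
    Integrable (doobFunctional m X n) P := by
  have hprod : Integrable (fun ω => maxPartialSum X n ω ^ (m - 1) * ‖partialSum X n ω‖) P := by
    simpa using hX.integrable_rpow_mul_rpow_maxPartialSum (b := 1) (by linarith) zero_le_one
      (sub_add_cancel m 1) (by linarith) n (hX.memLp_partialSum n).norm fun _ => norm_nonneg _
  exact (hprod.const_mul m).sub
    ((hX.integrable_maxPartialSum_rpow (by linarith) n).const_mul (m - 1))

lemma integrable_norm_partialSum_rpow (hX : IsMartingaleDifference P m 𝓖 X) (hm : 0 < m) (n : ℕ) :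
    Integrable (fun ω => ‖partialSum X n ω‖ ^ m) P := by
  simpa using hX.integrable_rpow_mul_rpow_maxPartialSum le_rfl hm.le (zero_add m) hm n
    (hX.memLp_partialSum n).norm fun _ => norm_nonneg _

lemma integrable_squareFun_rpow (hX : IsMartingaleDifference P m 𝓖 X) (hm : 0 < m) (n : ℕ) :
    Integrable (fun ω => squareFun X n ω ^ m) P := by
  simpa using hX.integrable_rpow_mul_rpow_maxPartialSum le_rfl hm.le (zero_add m) hm n
    (hX.memLp_squareFun n) (squareFun_nonneg n)

lemma integral_maxPartialSum_rpow_mul_sq_squareFun_le (hX : IsMartingaleDifference P m 𝓖 X)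
    (hm : 2 ≤ m) (N : ℕ) {K : ℝ} (hK : 0 < K) :
    ∫ ω, maxPartialSum X N ω ^ (m - 2) * squareFun X N ω ^ 2 ∂P ≤
      (K ^ 2)⁻¹ * ∫ ω, maxPartialSum X N ω ^ m ∂P +
        K ^ (m - 2) * ∫ ω, squareFun X N ω ^ m ∂P := by
  have hmax := (hX.integrable_maxPartialSum_rpow (by linarith) N).const_mul (K ^ 2)⁻¹
  have hsq := (hX.integrable_squareFun_rpow (by linarith) N).const_mul (K ^ (m - 2))
  rw [← integral_const_mul, ← integral_const_mul, ← integral_add hmax hsq]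
  refine integral_mono (hX.integrable_maxPartialSum_rpow_mul_sq hm N (hX.memLp_squareFun N)
    (squareFun_nonneg N)) (hmax.add hsq) fun ω => ?_
  have split := rpow_mul_rpow_le_add (c := K⁻¹) (p := m - 2) (q := 2)
    (maxPartialSum_nonneg (X := X) N ω) (squareFun_nonneg (X := X) N ω) (inv_pos.2 hK)
    (by linarith) zero_le_two
  rwa [sub_add_cancel, Real.inv_rpow hK.le, Real.inv_rpow hK.le, inv_inv, Real.rpow_two,
    Real.rpow_two] at split

end NormedSpace

section InnerProductSpace

variable [InnerProductSpace ℝ E] {n : ℕ} {w : Ω → ℝ}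

lemma integrable_mul_inner_partialSum (hX : IsMartingaleDifference P m 𝓖 X) (hm : 1 ≤ m)
    (hw : StronglyMeasurable[𝓖 (n - 1)] w)
    (hw_le : ∀ ω, |w ω| * ‖partialSum X n ω‖ ≤ maxPartialSum X n ω ^ (m - 1)) :
    Integrable (fun ω => w ω * inner ℝ (partialSum X n ω) (X n ω)) P := by
  refine (hX.integrable_rpow_mul_rpow_maxPartialSum (b := 1) (by linarith) zero_le_one
    (sub_add_cancel m 1) (by linarith) n (hX.memLp n).norm fun _ => norm_nonneg _).mono' ?_
    (ae_of_all _ fun ω => ?_)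
  · exact (hw.mono (𝓖.le _)).aestronglyMeasurable.mul
      ((hX.memLp_partialSum n).1.inner (hX.memLp n).1)
  · rw [Real.rpow_one, norm_mul, Real.norm_eq_abs]
    calc |w ω| * ‖inner ℝ (partialSum X n ω) (X n ω)‖
        ≤ |w ω| * (‖partialSum X n ω‖ * ‖X n ω‖) := by
          gcongr; exact norm_inner_le_norm _ _
      _ ≤ maxPartialSum X n ω ^ (m - 1) * ‖X n ω‖ := by
          rw [← mul_assoc]
          gcongr
          exact hw_le ω

variable [CompleteSpace E] [IsFiniteMeasure P]

lemma integral_mul_inner_partialSum (hX : IsMartingaleDifference P m 𝓖 X) (hm : 1 ≤ m)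
    (hw : StronglyMeasurable[𝓖 (n - 1)] w)
    (hw_le : ∀ ω, |w ω| * ‖partialSum X n ω‖ ≤ maxPartialSum X n ω ^ (m - 1)) :
    ∫ ω, w ω * inner ℝ (partialSum X n ω) (X n ω) ∂P = 0 := by
  cases n with
  | zero => simp [partialSum_zero]
  | succ n =>
    have hint := hX.integrable_mul_inner_partialSum hm hw hw_le
    simp only [← real_inner_smul_left] at hint ⊢
    exact integral_inner_eq_zero_of_condExp_eq_zero (𝓖.le n)
      (hw.smul (hX.stronglyMeasurable_partialSum le_rfl))
      ((hX.memLp (n + 1)).integrable (by simpa using hm)) hint (hX.condExp n)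

lemma integral_doobFunctional_nonneg (hX : IsMartingaleDifference P m 𝓖 X) (hm : 1 ≤ m) (n : ℕ) :
    0 ≤ ∫ ω, doobFunctional m X n ω ∂P := by
  induction n with
  | zero =>
    have hm₀ : m ≠ 0 := by linarith
    simp [doobFunctional, maxPartialSum_zero, partialSum_zero, Real.zero_rpow hm₀]
  | succ n ih =>
    let w ω := maxPartialSum X n ω ^ (m - 1) * ‖partialSum X n ω‖⁻¹
    have hw : StronglyMeasurable[𝓖 (n - 1)] w := by
      have hS := hX.stronglyMeasurable_partialSum (le_refl n)
      have hmax : StronglyMeasurable[𝓖 (n - 1)] (maxPartialSum X n) :=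
        stronglyMeasurable_maxPartialSum fun k hk => hX.stronglyMeasurable_partialSum hk
      exact ((hmax.measurable.pow_const _).mul hS.norm.measurable.inv).stronglyMeasurable
    have hw_le ω : |w ω| * ‖partialSum X n ω‖ ≤ maxPartialSum X n ω ^ (m - 1) := by
      have hmax : 0 ≤ maxPartialSum X n ω ^ (m - 1) :=
        Real.rpow_nonneg (maxPartialSum_nonneg n ω) _
      rw [abs_of_nonneg (by positivity), mul_assoc]
      exact mul_le_of_le_one_right hmax inv_mul_le_one
    have hΦ k := hX.integrable_doobFunctional hm k
    have increment := integral_mono ((hX.integrable_mul_inner_partialSum hm hw hw_le).const_mul m)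
      ((hΦ (n + 1)).sub (hΦ n)) (mul_inner_le_doobFunctional_sub hm n)
    rw [integral_const_mul, hX.integral_mul_inner_partialSum hm hw hw_le, mul_zero,
      integral_sub' (hΦ (n + 1)) (hΦ n)] at increment
    linarith

lemma integral_maxPartialSum_rpow_le (hX : IsMartingaleDifference P m 𝓖 X) (hm : 2 ≤ m) (n : ℕ) :
    ∫ ω, maxPartialSum X n ω ^ m ∂P ≤ 4 ^ m * ∫ ω, ‖partialSum X n ω‖ ^ m ∂P := by
  have hm₀ : 0 < m := by linarith
  have hmax := hX.integrable_maxPartialSum_rpow hm₀ n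
  have hnorm := hX.integrable_norm_partialSum_rpow hm₀ n
  have pointwise ω : doobFunctional m X n ω ≤
      m * 4 ^ (m - 1) * ‖partialSum X n ω‖ ^ m - m / 4 * maxPartialSum X n ω ^ m := by
    have hmax_nonneg := maxPartialSum_nonneg (X := X) n ω
    have split := rpow_mul_rpow_le_add (c := 1 / 4) (p := m - 1) (q := 1) hmax_nonneg
      (norm_nonneg (partialSum X n ω)) (by norm_num) (by linarith) zero_le_one
    rw [Real.rpow_one, Real.rpow_one, one_div, Real.inv_rpow (by norm_num), inv_inv,
      sub_add_cancel] at split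
    have hpow : 0 ≤ (m - 2) * maxPartialSum X n ω ^ m :=
      mul_nonneg (by linarith) (Real.rpow_nonneg hmax_nonneg m)
    unfold doobFunctional
    linarith [mul_le_mul_of_nonneg_left split hm₀.le]
  have integrated := integral_mono (hX.integrable_doobFunctional (by linarith) n)
    ((hnorm.const_mul (m * 4 ^ (m - 1))).sub (hmax.const_mul (m / 4))) pointwise
  rw [integral_sub' (hnorm.const_mul _) (hmax.const_mul _), integral_const_mul,
    integral_const_mul] at integrated
  have hdoob := hX.integral_doobFunctional_nonneg (by linarith) n
  rw [← rpow_sub_one_mul_self (by norm_num : (0 : ℝ) ≤ 4) hm₀.ne']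
  refine le_of_mul_le_mul_left ?_ (show 0 < m / 4 by linarith)
  linarith

lemma integral_norm_partialSum_rpow_succ_le (hX : IsMartingaleDifference P m 𝓖 X) (hm : 2 ≤ m)
    {n N : ℕ} (hn : n < N) :
    ∫ ω, ‖partialSum X (n + 1) ω‖ ^ m ∂P ≤ ∫ ω, ‖partialSum X n ω‖ ^ m ∂P +
      m ^ 2 * ∫ ω, maxPartialSum X N ω ^ (m - 2) * ‖X n ω‖ ^ 2 ∂P := by
  have hm₀ : 0 < m := by linarith
  let w ω := ‖partialSum X n ω‖ ^ (m - 2)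
  have hw : StronglyMeasurable[𝓖 (n - 1)] w :=
    ((hX.stronglyMeasurable_partialSum le_rfl).norm.measurable.pow_const _).stronglyMeasurable
  have hw_le ω : |w ω| * ‖partialSum X n ω‖ ≤ maxPartialSum X n ω ^ (m - 1) := by
    calc |w ω| * ‖partialSum X n ω‖ = ‖partialSum X n ω‖ ^ (m - 1 - 1) * ‖partialSum X n ω‖ := by
          rw [abs_of_nonneg (by positivity), show m - 1 - 1 = m - 2 by ring]
      _ = ‖partialSum X n ω‖ ^ (m - 1) := rpow_sub_one_mul_self (norm_nonneg _) (by linarith)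
      _ ≤ maxPartialSum X n ω ^ (m - 1) := by
          gcongr
          · linarith
          · exact norm_partialSum_le_maxPartialSum le_rfl ω
  have pointwise ω : ‖partialSum X (n + 1) ω‖ ^ m ≤ ‖partialSum X n ω‖ ^ m +
      m * (w ω * inner ℝ (partialSum X n ω) (X n ω)) +
      m ^ 2 * (maxPartialSum X N ω ^ (m - 2) * ‖X n ω‖ ^ 2) := by
    have hmax : max ‖partialSum X n ω‖ ‖partialSum X (n + 1) ω‖ ≤ maxPartialSum X N ω :=
      max_le (norm_partialSum_le_maxPartialSum hn.le ω) (norm_partialSum_le_maxPartialSum hn ω)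
    rw [partialSum_succ] at hmax ⊢
    refine (norm_add_rpow_le hm _ _).trans ?_
    gcongr
  have hS := hX.integrable_norm_partialSum_rpow hm₀ n
  have hinner := (hX.integrable_mul_inner_partialSum (by linarith) hw hw_le).const_mul m
  have hsq := (hX.integrable_maxPartialSum_rpow_mul_sq hm N (hX.memLp n).norm
    fun _ => norm_nonneg _).const_mul (m ^ 2)
  have integrated := integral_mono (hX.integrable_norm_partialSum_rpow hm₀ (n + 1))
    ((hS.add hinner).add hsq) pointwise
  rwa [integral_add' (hS.add hinner) hsq, integral_add' hS hinner, integral_const_mul,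
    integral_const_mul, hX.integral_mul_inner_partialSum (by linarith) hw hw_le, mul_zero,
    add_zero] at integrated

lemma integral_norm_partialSum_rpow_le (hX : IsMartingaleDifference P m 𝓖 X) (hm : 2 ≤ m)
    (N : ℕ) :
    ∫ ω, ‖partialSum X N ω‖ ^ m ∂P ≤
      m ^ 2 * ∫ ω, maxPartialSum X N ω ^ (m - 2) * squareFun X N ω ^ 2 ∂P := by
  have hm₀ : m ≠ 0 := by linarith
  suffices ∀ n ≤ N, ∫ ω, ‖partialSum X n ω‖ ^ m ∂P ≤
      m ^ 2 * ∫ ω, maxPartialSum X N ω ^ (m - 2) * squareFun X n ω ^ 2 ∂P from this N le_rfl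
  intro n hn
  induction n with
  | zero => simp [partialSum_zero, sq_squareFun, Real.zero_rpow hm₀]
  | succ n ih =>
    have hold := hX.integrable_maxPartialSum_rpow_mul_sq hm N (hX.memLp_squareFun n)
      (squareFun_nonneg n)
    have hnew := hX.integrable_maxPartialSum_rpow_mul_sq hm N (hX.memLp n).norm
      fun _ => norm_nonneg _
    have split : ∫ ω, maxPartialSum X N ω ^ (m - 2) * squareFun X (n + 1) ω ^ 2 ∂P =
        ∫ ω, maxPartialSum X N ω ^ (m - 2) * squareFun X n ω ^ 2 ∂P +
          ∫ ω, maxPartialSum X N ω ^ (m - 2) * ‖X n ω‖ ^ 2 ∂P := by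
      rw [← integral_add hold hnew]
      simp only [sq_squareFun, Finset.sum_range_succ, mul_add]
    rw [split, mul_add]
    linarith [ih (by lia), hX.integral_norm_partialSum_rpow_succ_le hm (show n < N by lia)]

lemma integral_norm_partialSum_rpow_le_squareFun (hX : IsMartingaleDifference P m 𝓖 X)
    (hm : 2 ≤ m) (N : ℕ) :
    ∫ ω, ‖partialSum X N ω‖ ^ m ∂P ≤
      √(2 * (4 ^ m * m ^ 2)) ^ m * ∫ ω, squareFun X N ω ^ m ∂P := by
  have hm₀ : 0 < m := by linarith
  set K := √(2 * (4 ^ m * m ^ 2))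
  have hK : 0 < K := Real.sqrt_pos.2 (by positivity)
  have hK_sq : K ^ 2 = 2 * (4 ^ m * m ^ 2) := Real.sq_sqrt (by positivity)
  have norm_le_max : ∫ ω, ‖partialSum X N ω‖ ^ m ∂P ≤ ∫ ω, maxPartialSum X N ω ^ m ∂P :=
    integral_mono (hX.integrable_norm_partialSum_rpow hm₀ N)
      (hX.integrable_maxPartialSum_rpow hm₀ N) fun ω =>
      Real.rpow_le_rpow (norm_nonneg _) (norm_partialSum_le_maxPartialSum le_rfl ω) hm₀.le
  refine norm_le_max.trans ?_
  set I := ∫ ω, maxPartialSum X N ω ^ m ∂P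
  set Q := ∫ ω, squareFun X N ω ^ m ∂P
  have absorb : I ≤ I / 2 + K ^ 2 / 2 * (K ^ (m - 2) * Q) := calc
    I ≤ 4 ^ m * (m ^ 2 * ((K ^ 2)⁻¹ * I + K ^ (m - 2) * Q)) := by
      refine (hX.integral_maxPartialSum_rpow_le hm N).trans ?_
      gcongr
      refine (hX.integral_norm_partialSum_rpow_le hm N).trans ?_
      gcongr
      exact hX.integral_maxPartialSum_rpow_mul_sq_squareFun_le hm N hK
    _ = K ^ 2 / 2 * ((K ^ 2)⁻¹ * I + K ^ (m - 2) * Q) := by rw [hK_sq]; ring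
    _ = I / 2 + K ^ 2 / 2 * (K ^ (m - 2) * Q) := by field_simp
  rw [← rpow_sub_two_mul_sq hK.le hm]
  linarith

end InnerProductSpace

end IsMartingaleDifference

lemma eLpNorm_sq_rpow_half (hm : 2 ≤ m) (f : Ω → ℝ) :
    eLpNorm (fun ω => f ω ^ 2) (ENNReal.ofReal (m / 2)) P ^ (1 / 2 : ℝ) =
      eLpNorm f (ENNReal.ofReal m) P := by
  have h := eLpNorm_norm_rpow (p := ENNReal.ofReal (m / 2)) (μ := P) f two_pos
  rw [← ENNReal.ofReal_mul (by linarith), div_mul_cancel₀ _ two_ne_zero] at h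
  simp only [Real.rpow_two, Real.norm_eq_abs, sq_abs] at h
  rw [h, ← ENNReal.rpow_mul]
  norm_num

lemma eLpNorm_sum_sq_rpow_half (hm : 2 ≤ m) (X : ℕ → Ω → E) (N : ℕ) :
    eLpNorm (fun ω => ∑ n ∈ Finset.range N, ‖X n ω‖ ^ 2) (ENNReal.ofReal (m / 2)) P
      ^ (1 / 2 : ℝ) = eLpNorm (squareFun X N) (ENNReal.ofReal m) P := by
  simp only [← eLpNorm_sq_rpow_half hm, sq_squareFun]

end BDG

section BDGConstant

variable {m : ℝ}

lemma isBDGConstant_sqrt (hm : 2 ≤ m) (d : ℕ) :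
    IsBDGConstant.{u} m d √(2 * (4 ^ m * m ^ 2)) := by
  intro Ω mΩ P _ 𝓖 X hadapted hmemLp hcondExp N
  have hX : IsMartingaleDifference P m 𝓖 X := ⟨hadapted, hmemLp, hcondExp⟩
  have hm₀ : 0 < m := by linarith
  have hm_ne : ENNReal.ofReal m ≠ 0 := by simpa using hm₀
  rw [eLpNorm_sum_sq_rpow_half hm]
  change eLpNorm (partialSum X N) _ P ≤ _
  rw [(hX.memLp_partialSum N).eLpNorm_eq_integral_rpow_norm hm_ne (by simp),
    (hX.memLp_squareFun N).eLpNorm_eq_integral_rpow_norm hm_ne (by simp),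
    ENNReal.toReal_ofReal hm₀.le, ← ENNReal.ofReal_mul (by positivity)]
  simp only [Real.norm_of_nonneg (squareFun_nonneg (X := X) N _)]
  refine ENNReal.ofReal_le_ofReal ?_
  set K := √(2 * (4 ^ m * m ^ 2))
  set Q := ∫ ω, squareFun X N ω ^ m ∂P
  have hQ : 0 ≤ Q := integral_nonneg fun ω => Real.rpow_nonneg (squareFun_nonneg N ω) _
  calc (∫ ω, ‖partialSum X N ω‖ ^ m ∂P) ^ m⁻¹ ≤ (K ^ m * Q) ^ m⁻¹ := by
        gcongr
        exact hX.integral_norm_partialSum_rpow_le_squareFun hm N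
    _ = K * Q ^ m⁻¹ := by
        rw [Real.mul_rpow (by positivity) hQ, Real.rpow_rpow_inv (Real.sqrt_nonneg _) hm₀.ne']

lemma bdgConst_nonneg (m : ℝ) (d : ℕ) : 0 ≤ bdgConst.{u} m d :=
  Real.sInf_nonneg fun _ h => h.1

lemma isBDGConstant_bdgConst (hm : 2 ≤ m) (d : ℕ) :
    IsBDGConstant.{u} m d (bdgConst.{u} m d) := by
  intro Ω mΩ P _ 𝓖 X hadapted hmemLp hcondExp N
  have hX : IsMartingaleDifference P m 𝓖 X := ⟨hadapted, hmemLp, hcondExp⟩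
  set R := eLpNorm (fun ω => ∑ n ∈ Finset.range N, ‖X n ω‖ ^ 2) (ENNReal.ofReal (m / 2)) P
    ^ (1 / 2 : ℝ) with hR
  have hR_ne_top : R ≠ ∞ := by
    rw [hR, eLpNorm_sum_sq_rpow_half hm]
    exact (hX.memLp_squareFun N).2.ne
  have hlim : Tendsto (fun c : ℝ => ENNReal.ofReal c * R) (𝓝[>] (bdgConst.{u} m d))
      (𝓝 (ENNReal.ofReal (bdgConst.{u} m d) * R)) :=
    ENNReal.Tendsto.mul_const
      ((ENNReal.continuous_ofReal.tendsto _).mono_left nhdsWithin_le_nhds) (Or.inr hR_ne_top)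
  refine ge_of_tendsto hlim ?_
  filter_upwards [self_mem_nhdsWithin] with c hc
  obtain ⟨c', ⟨-, hc'⟩, hlt⟩ :=
    exists_lt_of_csInf_lt (s := {c | 0 ≤ c ∧ IsBDGConstant.{u} m d c})
      ⟨_, Real.sqrt_nonneg _, isBDGConstant_sqrt hm d⟩ hc
  refine (hc' Ω mΩ P ‹_› 𝓖 X hadapted hmemLp hcondExp N).trans ?_
  gcongr

end BDGConstant

/-! ### Sums with decaying conditional expectations -/

lemma sum_range_mul_eq_sum_sum {M : Type*} [AddCommMonoid M] (f : ℕ → M) (N q : ℕ) :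
    ∑ j ∈ Finset.range (N * q), f j =
      ∑ k ∈ Finset.range N, ∑ r ∈ Finset.range q, f (k * q + r) := by
  induction N with
  | zero => simp
  | succ N ih => rw [Nat.succ_mul, Finset.sum_range_add, ih, Finset.sum_range_succ]

/-- The filtration in discrete time that observes `𝓕` at the times `φ k` only. -/
def subsample {Ω ι : Type*} {mΩ : MeasurableSpace Ω} [Preorder ι] (𝓕 : Filtration ι mΩ)
    {φ : ℕ → ι} (hφ : Monotone φ) : Filtration ℕ mΩ where
  seq k := 𝓕 (φ k)
  mono' _ _ h := 𝓕.mono (hφ h)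
  le' _ := 𝓕.le _

lemma condExp_sub_condExp_self {Ω E : Type*} {m₀ mΩ : MeasurableSpace Ω} {P : Measure Ω}
    [IsFiniteMeasure P] [NormedAddCommGroup E] [NormedSpace ℝ E] [CompleteSpace E]
    (hm₀ : m₀ ≤ mΩ) {f : Ω → E} (hf : Integrable f P) : P[f - P[f | m₀] | m₀] =ᵐ[P] 0 := by
  refine (condExp_sub hf integrable_condExp m₀).trans ?_
  rw [condExp_of_stronglyMeasurable hm₀ stronglyMeasurable_condExp integrable_condExp, sub_self]

section CondExpDecay

variable {Ω E : Type*} {mΩ : MeasurableSpace Ω} [NormedAddCommGroup E] [NormedSpace ℝ E]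

/-- A sequence whose `j`-th member is revealed at time `j + 1` and has `L_m`-norm at most `b`, and
whose conditional expectations, with a lag of at least `L`, decay like the lag to the power `-α`. -/
structure HasCondExpDecay (P : Measure Ω) (m α : ℝ) (L : ℕ) (𝓖 : Filtration ℕ mΩ) (b g : ℝ)
    (R : ℕ → Ω → E) : Prop where
  adapted : ∀ j, StronglyMeasurable[𝓖 (j + 1)] (R j)
  eLpNorm_le : ∀ j, eLpNorm (R j) (ENNReal.ofReal m) P ≤ ENNReal.ofReal b
  eLpNorm_condExp_le : ∀ i j, i + L ≤ j →
    eLpNorm (P[R j | 𝓖 i]) (ENNReal.ofReal m) P ≤ ENNReal.ofReal (g * ((j : ℝ) - i) ^ (-α))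

/-- The conditional expectation of `R j` given what is known `L` steps earlier. It is replaced by
`0` for the first `L` members of the sequence. -/
noncomputable def laggedCondExp (P : Measure Ω) (𝓖 : Filtration ℕ mΩ) (L : ℕ) (R : ℕ → Ω → E)
    (j : ℕ) : Ω → E :=
  if L ≤ j then P[R j | 𝓖 (j - L)] else 0

variable {P : Measure Ω} {𝓖 : Filtration ℕ mΩ} {L : ℕ} {R : ℕ → Ω → E}

lemma laggedCondExp_of_le {j : ℕ} (h : L ≤ j) :
    laggedCondExp P 𝓖 L R j = P[R j | 𝓖 (j - L)] := if_pos h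

lemma laggedCondExp_induction {p : ℕ → (Ω → E) → Prop} (zero : ∀ j, p j 0)
    (condExp : ∀ j, L ≤ j → p j (P[R j | 𝓖 (j - L)])) (j : ℕ) :
    p j (laggedCondExp P 𝓖 L R j) := by
  unfold laggedCondExp
  split_ifs with h
  exacts [condExp j h, zero j]

lemma stronglyMeasurable_laggedCondExp (j : ℕ) :
    StronglyMeasurable[𝓖 j] (laggedCondExp P 𝓖 L R j) :=
  laggedCondExp_induction (p := fun j => StronglyMeasurable[𝓖 j])
    (fun _ => stronglyMeasurable_zero)
    (fun j _ => stronglyMeasurable_condExp.mono (𝓖.mono (Nat.sub_le j L))) j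

lemma integrable_laggedCondExp [CompleteSpace E] (j : ℕ) :
    Integrable (laggedCondExp P 𝓖 L R j) P := by
  unfold laggedCondExp
  split_ifs
  exacts [integrable_condExp, integrable_zero _ _ _]

namespace HasCondExpDecay

variable {m α b g : ℝ}

lemma memLp (hR : HasCondExpDecay P m α L 𝓖 b g R) (j : ℕ) :
    MemLp (R j) (ENNReal.ofReal m) P :=
  ⟨((hR.adapted j).mono (𝓖.le _)).aestronglyMeasurable,
    (hR.eLpNorm_le j).trans_lt ENNReal.ofReal_lt_top⟩

lemma eLpNorm_laggedCondExp_le_decay (hR : HasCondExpDecay P m α L 𝓖 b g R) (hL : 1 ≤ L)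
    (hα : 0 ≤ α) (hg : 0 ≤ g) (j : ℕ) :
    eLpNorm (laggedCondExp P 𝓖 L R j) (ENNReal.ofReal m) P ≤ ENNReal.ofReal g := by
  refine laggedCondExp_induction
    (p := fun _ f => eLpNorm f (ENNReal.ofReal m) P ≤ ENNReal.ofReal g) (by simp) (fun j h => ?_) j
  refine (hR.eLpNorm_condExp_le (j - L) j (by lia)).trans (ENNReal.ofReal_le_ofReal ?_)
  rw [Nat.cast_sub h, sub_sub_cancel]
  exact mul_le_of_le_one_right hg
    (Real.rpow_le_one_of_one_le_of_nonpos (by exact_mod_cast hL) (by linarith))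

lemma eLpNorm_laggedCondExp_le_size [CompleteSpace E] (hR : HasCondExpDecay P m α L 𝓖 b g R)
    (hm : 1 ≤ m) (j : ℕ) :
    eLpNorm (laggedCondExp P 𝓖 L R j) (ENNReal.ofReal m) P ≤ ENNReal.ofReal b :=
  laggedCondExp_induction (p := fun _ f => eLpNorm f (ENNReal.ofReal m) P ≤ ENNReal.ofReal b)
    (by simp) (fun j _ => (eLpNorm_condExp_le_eLpNorm (R j) (ENNReal.one_le_ofReal.2 hm)).trans
      (hR.eLpNorm_le j)) j

lemma eLpNorm_condExp_laggedCondExp_le [CompleteSpace E] [IsFiniteMeasure P]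
    (hR : HasCondExpDecay P m α L 𝓖 b g R) {i j : ℕ} (hij : i + L ≤ j - L) (hj : L ≤ j) :
    eLpNorm (P[laggedCondExp P 𝓖 L R j | 𝓖 i]) (ENNReal.ofReal m) P ≤
      ENNReal.ofReal (g * ((j : ℝ) - i) ^ (-α)) := by
  rw [laggedCondExp_of_le hj,
    eLpNorm_congr_ae (condExp_condExp_of_le (𝓖.mono (by lia : i ≤ j - L)) (𝓖.le _))]
  exact hR.eLpNorm_condExp_le i j (by lia)

-- A pair of neighbours counts as one step, which halves the lag; hence the factor `2 ^ (-α)`,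
-- and another factor `2` because there are two neighbours.
lemma pair_laggedCondExp [CompleteSpace E] [IsFiniteMeasure P]
    (hR : HasCondExpDecay P m α L 𝓖 b g R) (hm : 1 ≤ m) (hL : 1 ≤ L) (hα : 0 ≤ α) (hg : 0 ≤ g) :
    HasCondExpDecay P m α L (subsample 𝓖 (fun _ _ h => Nat.mul_le_mul_right 2 h)) (2 * g)
      (2 ^ (1 - α) * g)
      (fun j => laggedCondExp P 𝓖 L R (j * 2) + laggedCondExp P 𝓖 L R (j * 2 + 1)) where
  adapted j := by
    have measurable {l : ℕ} (hl : l ≤ (j + 1) * 2) :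
        StronglyMeasurable[𝓖 ((j + 1) * 2)] (laggedCondExp P 𝓖 L R l) :=
      (stronglyMeasurable_laggedCondExp l).mono (𝓖.mono hl)
    exact (measurable (by lia)).add (measurable (by lia))
  eLpNorm_le j := by
    have hW := hR.eLpNorm_laggedCondExp_le_decay hL hα hg
    refine (eLpNorm_add_le (integrable_laggedCondExp _).1 (integrable_laggedCondExp _).1
      (ENNReal.one_le_ofReal.2 hm)).trans ?_
    rw [two_mul, ENNReal.ofReal_add hg hg]
    exact add_le_add (hW _) (hW _)
  eLpNorm_condExp_le i j hij := by
    have hij_pos : (0 : ℝ) < (j : ℝ) - i := sub_pos.2 (by exact_mod_cast (by lia : i < j))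
    have decay {l : ℕ} (hl : j * 2 ≤ l) :
        eLpNorm (P[laggedCondExp P 𝓖 L R l | 𝓖 (i * 2)]) (ENNReal.ofReal m) P ≤
          ENNReal.ofReal (g * (2 ^ (-α) * ((j : ℝ) - i) ^ (-α))) := by
      refine (hR.eLpNorm_condExp_laggedCondExp_le (by lia) (by lia)).trans
        (ENNReal.ofReal_le_ofReal ?_)
      have hl' : (j : ℝ) * 2 ≤ l := by exact_mod_cast hl
      rw [← Real.mul_rpow two_pos.le hij_pos.le]
      refine mul_le_mul_of_nonneg_left ?_ hg
      exact Real.rpow_le_rpow_of_nonpos (by linarith) (by push_cast; linarith) (by linarith)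
    change eLpNorm (P[_ | 𝓖 (i * 2)]) _ P ≤ _
    rw [eLpNorm_congr_ae (condExp_add (integrable_laggedCondExp _) (integrable_laggedCondExp _) _)]
    refine (eLpNorm_add_le integrable_condExp.1 integrable_condExp.1
      (ENNReal.one_le_ofReal.2 hm)).trans ?_
    refine (add_le_add (decay le_rfl) (decay (Nat.le_succ _))).trans_eq ?_
    rw [← ENNReal.ofReal_add (by positivity) (by positivity), sub_eq_add_neg (1 : ℝ) α,
      Real.rpow_add two_pos, Real.rpow_one]
    ring_nf

end HasCondExpDecay

end CondExpDecay

section SquareFunction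

variable {Ω E : Type*} {mΩ : MeasurableSpace Ω} {P : Measure Ω} [NormedAddCommGroup E] {m b : ℝ}

lemma eLpNorm_squareFun_le (hm : 2 ≤ m) (hb : 0 ≤ b) {X : ℕ → Ω → E}
    (hX : ∀ n, AEStronglyMeasurable (X n) P)
    (hXb : ∀ n, eLpNorm (X n) (ENNReal.ofReal m) P ≤ ENNReal.ofReal b) (N : ℕ) :
    eLpNorm (squareFun X N) (ENNReal.ofReal m) P ≤
      ENNReal.ofReal (b * (N : ℝ) ^ (1 / 2 : ℝ)) := by
  have sq_le n : eLpNorm (fun ω => ‖X n ω‖ ^ 2) (ENNReal.ofReal (m / 2)) P ≤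
      ENNReal.ofReal (b ^ 2) := by
    have norm_sq := eLpNorm_norm_rpow (p := ENNReal.ofReal (m / 2)) (μ := P) (X n) two_pos
    rw [← ENNReal.ofReal_mul (by linarith), div_mul_cancel₀ m two_ne_zero] at norm_sq
    simp only [Real.rpow_two, ENNReal.rpow_two] at norm_sq
    rw [norm_sq, ENNReal.ofReal_pow hb]
    gcongr
    exact hXb n
  rw [← eLpNorm_sum_sq_rpow_half hm]
  calc eLpNorm (fun ω => ∑ n ∈ Finset.range N, ‖X n ω‖ ^ 2) (ENNReal.ofReal (m / 2)) P
        ^ (1 / 2 : ℝ)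
      ≤ (∑ n ∈ Finset.range N,
          eLpNorm (fun ω => ‖X n ω‖ ^ 2) (ENNReal.ofReal (m / 2)) P) ^ (1 / 2 : ℝ) := by
        gcongr
        simpa only [Finset.sum_fn] using eLpNorm_sum_le (f := fun n ω => ‖X n ω‖ ^ 2)
          (fun n _ => (hX n).norm.pow 2) (ENNReal.one_le_ofReal.2 (by linarith))
    _ ≤ (∑ _n ∈ Finset.range N, ENNReal.ofReal (b ^ 2)) ^ (1 / 2 : ℝ) := by
        gcongr
        exact sq_le _
    _ = ENNReal.ofReal (b * (N : ℝ) ^ (1 / 2 : ℝ)) := by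
        rw [Finset.sum_const, Finset.card_range, nsmul_eq_mul, ← ENNReal.ofReal_natCast,
          ← ENNReal.ofReal_mul (by positivity), ENNReal.ofReal_rpow_of_nonneg (by positivity)
          (by norm_num), mul_comm, Real.mul_rpow (by positivity) (by positivity),
          ← Real.sqrt_eq_rpow (b ^ 2), Real.sqrt_sq hb]

end SquareFunction

namespace IsBDGConstant

section Sums

variable {Ω : Type u} {mΩ : MeasurableSpace Ω} {P : Measure Ω} [IsProbabilityMeasure P]
  {d : ℕ} {m κ α b g : ℝ} {𝓖 : Filtration ℕ mΩ} {L : ℕ}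

lemma eLpNorm_sum_le_of_martingaleDifference (hκ : IsBDGConstant.{u} m d κ) (hm : 2 ≤ m)
    (hb : 0 ≤ b) {X : ℕ → Ω → EuclideanSpace ℝ (Fin d)} (hX : IsMartingaleDifference P m 𝓖 X)
    (hXb : ∀ n, eLpNorm (X n) (ENNReal.ofReal m) P ≤ ENNReal.ofReal b) (N : ℕ) :
    eLpNorm (fun ω => ∑ n ∈ Finset.range N, X n ω) (ENNReal.ofReal m) P ≤
      ENNReal.ofReal κ * ENNReal.ofReal (b * (N : ℝ) ^ (1 / 2 : ℝ)) := by
  refine (hκ Ω mΩ P ‹_› 𝓖 X hX.adapted hX.memLp hX.condExp N).trans ?_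
  rw [eLpNorm_sum_sq_rpow_half hm]
  gcongr
  exact eLpNorm_squareFun_le hm hb (fun n => (hX.memLp n).1) hXb N

lemma eLpNorm_le_mul (hκ : IsBDGConstant.{u} m d κ) (hm : 2 ≤ m)
    {f : Ω → EuclideanSpace ℝ (Fin d)} (hf : StronglyMeasurable f) (hb : 0 ≤ b)
    (hfb : eLpNorm f (ENNReal.ofReal m) P ≤ ENNReal.ofReal b) :
    eLpNorm f (ENNReal.ofReal m) P ≤ ENNReal.ofReal κ * ENNReal.ofReal b := by
  let X : ℕ → Ω → EuclideanSpace ℝ (Fin d) := fun n => if n = 0 then f else 0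
  have hX : IsMartingaleDifference P m ⊤ X := by
    refine ⟨fun n => ?_, fun n => ?_, fun n => by simp [X]⟩
    · dsimp only [X]; split_ifs; exacts [hf, stronglyMeasurable_zero]
    · dsimp only [X]
      split_ifs
      exacts [⟨hf.aestronglyMeasurable, hfb.trans_lt ENNReal.ofReal_lt_top⟩, MemLp.zero]
  have hXb n : eLpNorm (X n) (ENNReal.ofReal m) P ≤ ENNReal.ofReal b := by
    dsimp only [X]
    split_ifs
    exacts [hfb, by simp]
  simpa [X] using hκ.eLpNorm_sum_le_of_martingaleDifference hm hb hX hXb 1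

-- The indices in one residue class modulo `L + 1` form a sequence of martingale differences.
lemma eLpNorm_sum_range_mul_le_of_lag (hκ : IsBDGConstant.{u} m d κ) (hm : 2 ≤ m) (hb : 0 ≤ b)
    {Z : ℕ → Ω → EuclideanSpace ℝ (Fin d)} (hZ : ∀ j, StronglyMeasurable[𝓖 (j + 1)] (Z j))
    (hZb : ∀ j, eLpNorm (Z j) (ENNReal.ofReal m) P ≤ ENNReal.ofReal b)
    (hZ₀ : ∀ j, P[Z (j + L) | 𝓖 j] =ᵐ[P] 0) (N : ℕ) :
    eLpNorm (fun ω => ∑ j ∈ Finset.range (N * (L + 1)), Z j ω) (ENNReal.ofReal m) P ≤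
      ENNReal.ofReal κ * ENNReal.ofReal ((L + 1) * (b * (N : ℝ) ^ (1 / 2 : ℝ))) := by
  have residue_class r : eLpNorm (fun ω => ∑ k ∈ Finset.range N, Z (k * (L + 1) + r) ω)
      (ENNReal.ofReal m) P ≤ ENNReal.ofReal κ * ENNReal.ofReal (b * (N : ℝ) ^ (1 / 2 : ℝ)) := by
    have hmono : Monotone fun k : ℕ => k * (L + 1) + r + 1 := fun _ _ h => by
      dsimp only
      gcongr
    refine hκ.eLpNorm_sum_le_of_martingaleDifference (𝓖 := subsample 𝓖 hmono) hm hb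
      ⟨fun k => hZ _, fun k => ?_, fun k => ?_⟩ (fun k => hZb _) N
    · exact ⟨((hZ _).mono (𝓖.le _)).aestronglyMeasurable,
        (hZb _).trans_lt ENNReal.ofReal_lt_top⟩
    · rw [show (k + 1) * (L + 1) + r = k * (L + 1) + r + 1 + L by ring]
      exact hZ₀ _
  simp only [sum_range_mul_eq_sum_sum]
  calc eLpNorm (fun ω => ∑ k ∈ Finset.range N, ∑ r ∈ Finset.range (L + 1),
        Z (k * (L + 1) + r) ω) (ENNReal.ofReal m) P
      = eLpNorm (∑ r ∈ Finset.range (L + 1), fun ω => ∑ k ∈ Finset.range N,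
          Z (k * (L + 1) + r) ω) (ENNReal.ofReal m) P := by
        simp only [Finset.sum_fn, Finset.sum_comm (s := Finset.range N)]
    _ ≤ ∑ r ∈ Finset.range (L + 1), eLpNorm (fun ω => ∑ k ∈ Finset.range N,
          Z (k * (L + 1) + r) ω) (ENNReal.ofReal m) P :=
        eLpNorm_sum_le (fun r _ => (Finset.stronglyMeasurable_fun_sum _ fun k _ =>
          (hZ _).mono (𝓖.le _)).aestronglyMeasurable) (ENNReal.one_le_ofReal.2 (by linarith))
    _ ≤ ∑ _r ∈ Finset.range (L + 1),
          ENNReal.ofReal κ * ENNReal.ofReal (b * (N : ℝ) ^ (1 / 2 : ℝ)) :=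
        Finset.sum_le_sum fun r _ => residue_class r
    _ = ENNReal.ofReal κ * ENNReal.ofReal ((L + 1) * (b * (N : ℝ) ^ (1 / 2 : ℝ))) := by
        rw [Finset.sum_const, Finset.card_range, nsmul_eq_mul, mul_left_comm,
          ← ENNReal.ofReal_natCast, ← ENNReal.ofReal_mul (by positivity)]
        push_cast
        rfl

lemma eLpNorm_sum_le_of_lag (hκ : IsBDGConstant.{u} m d κ) (hm : 2 ≤ m) (hb : 0 ≤ b)
    {Z : ℕ → Ω → EuclideanSpace ℝ (Fin d)} (hZ : ∀ j, StronglyMeasurable[𝓖 (j + 1)] (Z j))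
    (hZb : ∀ j, eLpNorm (Z j) (ENNReal.ofReal m) P ≤ ENNReal.ofReal b)
    (hZ₀ : ∀ j, P[Z (j + L) | 𝓖 j] =ᵐ[P] 0) (N : ℕ) :
    eLpNorm (fun ω => ∑ j ∈ Finset.range N, Z j ω) (ENNReal.ofReal m) P ≤
      ENNReal.ofReal κ * ENNReal.ofReal ((L + 1) * (b * (N : ℝ) ^ (1 / 2 : ℝ))) := by
  let truncated : ℕ → Ω → EuclideanSpace ℝ (Fin d) := fun j => if j < N then Z j else 0
  have truncated_induction {p : (Ω → EuclideanSpace ℝ (Fin d)) → Prop} (j : ℕ) (h₀ : p 0)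
      (h : p (Z j)) : p (truncated j) := by
    dsimp only [truncated]
    split_ifs
    exacts [h, h₀]
  have hsum ω : ∑ j ∈ Finset.range N, Z j ω =
      ∑ j ∈ Finset.range (N * (L + 1)), truncated j ω := by
    rw [← Finset.sum_subset (Finset.range_mono (Nat.le_mul_of_pos_right N L.succ_pos))]
    · exact Finset.sum_congr rfl fun j hj => by simp [truncated, Finset.mem_range.1 hj]
    · intro j _ hj
      simp [truncated, show ¬ j < N by simpa using hj]
  simp only [hsum]
  exact hκ.eLpNorm_sum_range_mul_le_of_lag hm hb
    (fun j => truncated_induction j stronglyMeasurable_zero (hZ j))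
    (fun j => truncated_induction (p := fun f => eLpNorm f _ P ≤ _) j (by simp) (hZb j))
    (fun j => truncated_induction (p := fun f => P[f | 𝓖 j] =ᵐ[P] 0) (j + L) (by simp) (hZ₀ j)) N

variable {R : ℕ → Ω → EuclideanSpace ℝ (Fin d)}

lemma eLpNorm_sum_sub_laggedCondExp_le (hκ : IsBDGConstant.{u} m d κ) (hm : 2 ≤ m) (hb : 0 ≤ b)
    (hR : HasCondExpDecay P m α L 𝓖 b g R) (N : ℕ) :
    eLpNorm (fun ω => ∑ j ∈ Finset.range N, (R j - laggedCondExp P 𝓖 L R j) ω)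
        (ENNReal.ofReal m) P ≤
      ENNReal.ofReal κ * ENNReal.ofReal ((L + 1) * (2 * b * (N : ℝ) ^ (1 / 2 : ℝ))) := by
  have hp : 1 ≤ ENNReal.ofReal m := ENNReal.one_le_ofReal.2 (by linarith)
  refine hκ.eLpNorm_sum_le_of_lag (𝓖 := 𝓖) hm (by positivity) (fun j => ?_) (fun j => ?_)
    (fun j => ?_) N
  · exact (hR.adapted j).sub ((stronglyMeasurable_laggedCondExp j).mono (𝓖.mono j.le_succ))
  · refine (eLpNorm_sub_le (hR.memLp j).1 (integrable_laggedCondExp j).1 hp).trans ?_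
    rw [two_mul, ENNReal.ofReal_add hb hb]
    exact add_le_add (hR.eLpNorm_le j) (hR.eLpNorm_laggedCondExp_le_size (by linarith) j)
  · rw [laggedCondExp_of_le (Nat.le_add_left L j), Nat.add_sub_cancel]
    exact condExp_sub_condExp_self (𝓖.le j) ((hR.memLp _).integrable hp)

-- The centred parts `R j - E[R j | 𝓖 (j - L)]` are summed by the Burkholder-Davis-Gundy
-- inequality; the conditional expectations are grouped in pairs, and the induction hypothesis
-- applies to these pairs.
lemma eLpNorm_sum_two_pow_le (hκ : IsBDGConstant.{u} m d κ) (hm : 2 ≤ m) (hL : 1 ≤ L)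
    (hα : 0 ≤ α) {θ D : ℝ} (hθ : 1 / 2 ≤ θ) (hD₀ : 0 ≤ D)
    (hD : 4 * ((L : ℝ) + 1) ≤ D * (2 ^ θ - 2 ^ (1 - α))) (hb : 0 ≤ b) (hg : 0 ≤ g)
    (hR : HasCondExpDecay P m α L 𝓖 b g R) (n : ℕ) :
    eLpNorm (fun ω => ∑ j ∈ Finset.range (2 ^ n), R j ω) (ENNReal.ofReal m) P ≤
      ENNReal.ofReal κ * ENNReal.ofReal (2 * (L + 1) * b * ((2 : ℝ) ^ n) ^ (1 / 2 : ℝ) +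
        D * g * ((2 : ℝ) ^ n) ^ θ) := by
  induction n generalizing 𝓖 R b g with
  | zero =>
    simp only [pow_zero, Finset.sum_range_one, Real.one_rpow, mul_one]
    refine (hκ.eLpNorm_le_mul hm ((hR.adapted 0).mono (𝓖.le _)) hb (hR.eLpNorm_le 0)).trans ?_
    gcongr
    nlinarith [mul_nonneg hD₀ hg, mul_nonneg (Nat.cast_nonneg (α := ℝ) L) hb]
  | succ n ih =>
    let W := laggedCondExp P 𝓖 L R
    have split : (fun ω => ∑ j ∈ Finset.range (2 ^ (n + 1)), R j ω) =
        (fun ω => ∑ j ∈ Finset.range (2 ^ (n + 1)), (R j - W j) ω) +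
          fun ω => ∑ j ∈ Finset.range (2 ^ n), (W (j * 2) + W (j * 2 + 1)) ω := by
      funext ω
      simp only [Pi.add_apply, Pi.sub_apply, Finset.sum_sub_distrib]
      rw [pow_succ, sum_range_mul_eq_sum_sum (fun j => W j ω)]
      simp [Finset.sum_range_succ]
    have hW j : AEStronglyMeasurable (W j) P := (integrable_laggedCondExp j).1
    have centred := hκ.eLpNorm_sum_sub_laggedCondExp_le hm hb hR (2 ^ (n + 1))
    have pairs := ih (by positivity) (by positivity)
      (hR.pair_laggedCondExp (by linarith) hL hα hg)
    rw [split]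
    refine (eLpNorm_add_le ?_ ?_ (ENNReal.one_le_ofReal.2 (by linarith))).trans
      ((add_le_add centred pairs).trans ?_)
    · exact Finset.aestronglyMeasurable_fun_sum _ fun j _ => (hR.memLp j).1.sub (hW j)
    · exact Finset.aestronglyMeasurable_fun_sum _ fun j _ => (hW _).add (hW _)
    rw [← mul_add, ← ENNReal.ofReal_add (by positivity) (by positivity)]
    gcongr ENNReal.ofReal κ * ENNReal.ofReal ?_
    have hgrowth : ((2 : ℝ) ^ n) ^ (1 / 2 : ℝ) ≤ ((2 : ℝ) ^ n) ^ θ :=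
      Real.rpow_le_rpow_of_exponent_le (one_le_pow₀ one_le_two) hθ
    have absorb : 4 * ((L : ℝ) + 1) * (g * ((2 : ℝ) ^ n) ^ (1 / 2 : ℝ)) ≤
        D * (2 ^ θ - 2 ^ (1 - α)) * (g * ((2 : ℝ) ^ n) ^ θ) := by
      have : 0 ≤ D * (2 ^ θ - 2 ^ (1 - α)) := le_trans (by positivity) hD
      gcongr
    rw [pow_succ (2 : ℝ) n, Real.mul_rpow (y := (2 : ℝ)) (z := θ) (by positivity) two_pos.le]
    push_cast [pow_succ]
    linarith

end Sums

end IsBDGConstant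

/-- The lag, counted in windows, after which the conditional bound of `IsWindowLocalized` applies:
a lag of `2 M` windows is required, and the windows of a sequence overlap. -/
noncomputable def windowLag (M : ℝ) : ℕ := ⌈2 * M⌉₊ + 4

/-- The constant in the moment bound for sums over windows. -/
noncomputable def windowConst (M α θ : ℝ) : ℝ :=
  max (2 * (windowLag M + 1)) (4 * (windowLag M + 1) / (2 ^ θ - 2 ^ (1 - α)) * 2 ^ α)

lemma windowConst_nonneg (M α θ : ℝ) : 0 ≤ windowConst M α θ :=
  le_max_of_le_left (by positivity)

lemma le_windowLag (M : ℝ) : 2 * M + 4 ≤ windowLag M := by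
  rw [windowLag]
  push_cast
  linarith [Nat.le_ceil (2 * M)]

lemma four_le_windowLag (M : ℝ) : 4 ≤ windowLag M := Nat.le_add_left 4 _

section Windows

variable {Ω E : Type*} {mΩ : MeasurableSpace Ω} {P : Measure Ω} [NormedAddCommGroup E]
  [NormedSpace ℝ E] {T : ℝ} {𝓕 : Filtration (Set.Icc (0 : ℝ) T) mΩ} {m M α a b g r w : ℝ}

/-- A random variable that is revealed at time `e` and has `L_m`-norm at most `b`, and whose
conditional expectation given `𝓕 t₀` is of size `g (s - t₀) ^ (-α)` if `r ≤ s - t₀`. -/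
structure IsLocalized (P : Measure Ω) (𝓕 : Filtration (Set.Icc (0 : ℝ) T) mΩ)
    (m r α b g : ℝ) (s e : Set.Icc (0 : ℝ) T) (R : Ω → E) : Prop where
  adapted : StronglyMeasurable[𝓕 e] R
  eLpNorm_le : eLpNorm R (ENNReal.ofReal m) P ≤ ENNReal.ofReal b
  eLpNorm_condExp_le : ∀ t₀ : Set.Icc (0 : ℝ) T, t₀ < s → r ≤ (s : ℝ) - t₀ →
    eLpNorm (P[R | 𝓕 t₀]) (ENNReal.ofReal m) P ≤ ENNReal.ofReal (g * ((s : ℝ) - t₀) ^ (-α))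

/-- A sequence whose `j`-th member, unless it vanishes, is localized in the time window
`[a + j w, a + (j + 3) w]`. -/
def IsWindowLocalized (P : Measure Ω) (𝓕 : Filtration (Set.Icc (0 : ℝ) T) mΩ)
    (m M α b g a w : ℝ) (R : ℕ → Ω → E) : Prop :=
  ∀ j : ℕ, R j = 0 ∨ ∃ s e : Set.Icc (0 : ℝ) T, a + j * w ≤ s ∧ (e : ℝ) ≤ a + (j + 3) * w ∧
    IsLocalized P 𝓕 m (M * (2 * w)) α b g s e (R j)

lemma IsLocalized.mono {r' b' g' : ℝ} {s e : Set.Icc (0 : ℝ) T} {R : Ω → E}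
    (h : IsLocalized P 𝓕 m r α b g s e R) (hr : r ≤ r') (hb : b ≤ b') (hg : g ≤ g') :
    IsLocalized P 𝓕 m r' α b' g' s e R where
  adapted := h.adapted
  eLpNorm_le := h.eLpNorm_le.trans (ENNReal.ofReal_le_ofReal hb)
  eLpNorm_condExp_le t₀ ht₀ hr' := by
    have : 0 ≤ (s : ℝ) - t₀ := sub_nonneg.2 (Subtype.coe_le_coe.2 ht₀.le)
    refine (h.eLpNorm_condExp_le t₀ ht₀ (hr.trans hr')).trans (ENNReal.ofReal_le_ofReal ?_)
    gcongr

lemma IsLocalized.eLpNorm_condExp_projIcc_le {s e : Set.Icc (0 : ℝ) T} {R : Ω → E}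
    (hR : IsLocalized P 𝓕 m (M * (2 * w)) α b g s e R) (hT : 0 ≤ T) (hα : 0 ≤ α) (ha : 0 ≤ a)
    (hw : 0 < w) (hg : 0 ≤ g) {i j : ℕ} (hs : a + j * w ≤ s) (hij : i + windowLag M ≤ j) :
    eLpNorm (P[R | 𝓕 (Set.projIcc 0 T hT (a + (i + 2) * w))]) (ENNReal.ofReal m) P ≤
      ENNReal.ofReal (2 ^ α * (g * w ^ (-α)) * ((j : ℝ) - i) ^ (-α)) := by
  set t₀ := Set.projIcc 0 T hT (a + (i + 2) * w)
  have hM : 2 * M + 4 ≤ (j : ℝ) - i := by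
    have : (i : ℝ) + windowLag M ≤ j := by exact_mod_cast hij
    linarith [le_windowLag M]
  have hlag_le : (4 : ℝ) ≤ (j : ℝ) - i := by
    rw [le_sub_iff_add_le]
    exact_mod_cast (by have := four_le_windowLag M; lia : 4 + i ≤ j)
  have ht₀ : (t₀ : ℝ) ≤ a + (i + 2) * w := by
    rw [Set.coe_projIcc]
    exact max_le (by positivity) (min_le_right _ _)
  have hdist : ((j : ℝ) - i - 2) * w ≤ s - t₀ := by linarith
  have hhalf : ((j : ℝ) - i) * w * 2⁻¹ ≤ s - t₀ := le_trans (by nlinarith) hdist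
  refine (hR.eLpNorm_condExp_le t₀ (Subtype.coe_lt_coe.1 (by nlinarith))
    (le_trans (by nlinarith) hdist)).trans (ENNReal.ofReal_le_ofReal ?_)
  calc g * ((s : ℝ) - t₀) ^ (-α)
      ≤ g * (((j : ℝ) - i) * w * 2⁻¹) ^ (-α) :=
        mul_le_mul_of_nonneg_left
          (Real.rpow_le_rpow_of_nonpos (by positivity) hhalf (by linarith)) hg
    _ = 2 ^ α * (g * w ^ (-α)) * ((j : ℝ) - i) ^ (-α) := by
        rw [Real.mul_rpow (by positivity) (by norm_num), Real.mul_rpow (by positivity) hw.le,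
          Real.inv_rpow two_pos.le, Real.rpow_neg two_pos.le, inv_inv]
        ring

lemma monotone_projIcc_window (hT : 0 ≤ T) (a : ℝ) (hw : 0 ≤ w) :
    Monotone fun j : ℕ => Set.projIcc 0 T hT (a + (j + 2) * w) :=
  fun i j hij => Set.monotone_projIcc hT (by gcongr)

lemma IsWindowLocalized.hasCondExpDecay {R : ℕ → Ω → E}
    (hR : IsWindowLocalized P 𝓕 m M α b g a w R) (hT : 0 ≤ T) (hα : 0 ≤ α) (ha : 0 ≤ a)
    (hw : 0 < w) (hg : 0 ≤ g) :
    HasCondExpDecay P m α (windowLag M) (subsample 𝓕 (monotone_projIcc_window hT a hw.le)) b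
      (2 ^ α * (g * w ^ (-α))) R where
  adapted j := by
    rcases hR j with h | ⟨s, e, -, he, hloc⟩
    · rw [h]
      exact stronglyMeasurable_zero
    · refine hloc.adapted.mono (𝓕.mono ?_)
      rw [← Set.projIcc_val hT e]
      refine Set.monotone_projIcc hT ?_
      push_cast
      linarith
  eLpNorm_le j := by
    rcases hR j with h | ⟨s, e, -, -, hloc⟩
    · simp [h]
    · exact hloc.eLpNorm_le
  eLpNorm_condExp_le i j hij := by
    rcases hR j with h | ⟨s, e, hs, -, hloc⟩
    · simp [h]
    · exact hloc.eLpNorm_condExp_projIcc_le hT hα ha hw hg hs hij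

end Windows

lemma IsBDGConstant.eLpNorm_sum_window_le {Ω : Type u} {mΩ : MeasurableSpace Ω} {P : Measure Ω}
    [IsProbabilityMeasure P] {d : ℕ} {T m κ : ℝ} (hκ : IsBDGConstant.{u} m d κ) (hm : 2 ≤ m)
    {𝓕 : Filtration (Set.Icc (0 : ℝ) T) mΩ} (hT : 0 ≤ T) {M α θ a b g w : ℝ} (hα : 0 ≤ α)
    (hθ : 1 / 2 ≤ θ) (hαθ : 1 - α < θ) (ha : 0 ≤ a) (hw : 0 < w) (hb : 0 ≤ b) (hg : 0 ≤ g)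
    {R : ℕ → Ω → EuclideanSpace ℝ (Fin d)} (hR : IsWindowLocalized P 𝓕 m M α b g a w R) (n : ℕ) :
    eLpNorm (fun ω => ∑ j ∈ Finset.range (2 ^ n), R j ω) (ENNReal.ofReal m) P ≤
      ENNReal.ofReal κ * ENNReal.ofReal (windowConst M α θ *
        (b * ((2 : ℝ) ^ n) ^ (1 / 2 : ℝ) + g * w ^ (-α) * ((2 : ℝ) ^ n) ^ θ)) := by
  set D := 4 * ((windowLag M : ℝ) + 1) / (2 ^ θ - 2 ^ (1 - α)) with hD
  have hden : 0 < (2 : ℝ) ^ θ - 2 ^ (1 - α) :=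
    sub_pos.2 (Real.rpow_lt_rpow_of_exponent_lt one_lt_two hαθ)
  refine (hκ.eLpNorm_sum_two_pow_le hm ((four_le_windowLag M).trans' (by norm_num)) hα hθ
    (D := D) (by positivity) (by rw [hD, div_mul_cancel₀ _ hden.ne']) hb (by positivity)
    (hR.hasCondExpDecay hT hα ha hw hg) n).trans ?_
  have hsize : 2 * ((windowLag M : ℝ) + 1) ≤ windowConst M α θ := le_max_left _ _
  have hdecay : D * 2 ^ α ≤ windowConst M α θ := le_max_right _ _
  rw [mul_add (windowConst M α θ), mul_assoc _ b, ← mul_assoc D (2 ^ α), mul_assoc (D * 2 ^ α)]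
  gcongr

/-! ### Dyadic grids -/

/-- The width `T / 2 ^ n` of the cells of the `n`-th dyadic grid on `[0, T]`. -/
noncomputable def dyadicWidth (T : ℝ) (n : ℕ) : ℝ := T * ((2 : ℝ) ^ n)⁻¹

/-- The value of `∑ k, dyadicWidth 1 k ^ γ * (2 ^ (k + 1)) ^ θ` for `θ < γ`. -/
noncomputable def dyadicSum (γ θ : ℝ) : ℝ := 2 ^ θ * (1 - (2 : ℝ) ^ (θ - γ))⁻¹

section Dyadic

variable {T : ℝ}

lemma dyadicWidth_pos (hT : 0 < T) (n : ℕ) : 0 < dyadicWidth T n := by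
  unfold dyadicWidth
  positivity

lemma dyadicWidth_nonneg (hT : 0 ≤ T) (n : ℕ) : 0 ≤ dyadicWidth T n := by
  unfold dyadicWidth
  positivity

lemma two_pow_mul_dyadicWidth (T : ℝ) (n : ℕ) : 2 ^ n * dyadicWidth T n = T := by
  unfold dyadicWidth
  field_simp

lemma dyadicWidth_add (T : ℝ) (n k : ℕ) :
    dyadicWidth T (n + k) = dyadicWidth (dyadicWidth T n) k := by
  unfold dyadicWidth
  rw [pow_add, mul_inv, mul_assoc]

lemma dyadicWidth_succ (T : ℝ) (n : ℕ) : dyadicWidth T (n + 1) = dyadicWidth T n / 2 := by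
  rw [dyadicWidth_add, dyadicWidth, pow_one, div_eq_mul_inv]

lemma exists_dyadicWidth_lt_le {x : ℝ} (hx : 0 < x) (hxT : x ≤ T) :
    ∃ n, dyadicWidth T (n + 1) < x ∧ x ≤ dyadicWidth T n := by
  have hT : 0 < T := hx.trans_le hxT
  obtain ⟨n, hlt, hle⟩ := exists_nat_pow_near_of_lt_one (x := x / T) (y := (1 / 2 : ℝ))
    (by positivity) (by rwa [div_le_one hT]) one_half_pos one_half_lt_one
  rw [lt_div_iff₀ hT, one_div, inv_pow, mul_comm] at hlt
  rw [div_le_iff₀ hT, one_div, inv_pow, mul_comm] at hle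
  exact ⟨n, hlt, hle⟩

variable {γ θ : ℝ}

lemma two_rpow_sub_lt_one (h : θ < γ) : (2 : ℝ) ^ (θ - γ) < 1 :=
  Real.rpow_lt_one_of_one_lt_of_neg one_lt_two (sub_neg.2 h)

lemma dyadicSum_nonneg (h : θ < γ) : 0 ≤ dyadicSum γ θ :=
  mul_nonneg (by positivity) (inv_nonneg.2 (sub_nonneg.2 (two_rpow_sub_lt_one h).le))

lemma dyadicWidth_rpow_mul_two_pow_rpow {h : ℝ} (hh : 0 ≤ h) (γ θ : ℝ) (k : ℕ) :
    dyadicWidth h k ^ γ * ((2 : ℝ) ^ (k + 1)) ^ θ = h ^ γ * 2 ^ θ * ((2 : ℝ) ^ (θ - γ)) ^ k := by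
  have comm (x : ℝ) : ((2 : ℝ) ^ k) ^ x = ((2 : ℝ) ^ x) ^ k :=
    (Real.rpow_pow_comm two_pos.le x k).symm
  rw [dyadicWidth, Real.mul_rpow hh (by positivity), Real.inv_rpow (by positivity), pow_succ,
    Real.mul_rpow (by positivity) two_pos.le, comm, comm, Real.rpow_sub two_pos, div_pow]
  field_simp

lemma hasSum_dyadic {h : ℝ} (hh : 0 ≤ h) (hθγ : θ < γ) :
    HasSum (fun k => dyadicWidth h k ^ γ * ((2 : ℝ) ^ (k + 1)) ^ θ) (h ^ γ * dyadicSum γ θ) := by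
  simp_rw [dyadicWidth_rpow_mul_two_pow_rpow hh, dyadicSum, ← mul_assoc]
  exact (hasSum_geometric_of_lt_one (by positivity) (two_rpow_sub_lt_one hθγ)).mul_left _

end Dyadic

section Floor

variable {x h : ℝ}

lemma floor_div_mul_le (hx : 0 ≤ x) (hh : 0 < h) : (⌊x / h⌋₊ : ℝ) * h ≤ x :=
  (le_div_iff₀ hh).1 (Nat.floor_le (by positivity))

lemma lt_floor_div_add_one_mul (x : ℝ) (hh : 0 < h) : x < (⌊x / h⌋₊ + 1) * h :=
  (div_lt_iff₀ hh).1 (Nat.lt_floor_add_one _)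

lemma sum_range_eq_sum_range_floor {M : Type*} [AddCommMonoid M] {s t : ℝ} (hs : 0 ≤ s)
    (hh : 0 < h) {f : ℕ → M} (left : ∀ j : ℕ, (j + 1) * h ≤ s → f j = 0)
    (right : ∀ j : ℕ, t ≤ j * h → f j = 0) {N J : ℕ} (hN : t ≤ N * h)
    (hJ : t ≤ (⌊s / h⌋₊ + J) * h) :
    ∑ j ∈ Finset.range N, f j = ∑ i ∈ Finset.range J, f (⌊s / h⌋₊ + i) := by
  set j₀ := ⌊s / h⌋₊
  have extend {K : ℕ} (hK : t ≤ K * h) (hKN : K ≤ max N (j₀ + J)) :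
      ∑ j ∈ Finset.range K, f j = ∑ j ∈ Finset.range (max N (j₀ + J)), f j := by
    refine Finset.sum_subset (Finset.range_mono hKN) fun j _ hj => right j (hK.trans ?_)
    have : K ≤ j := by simpa using hj
    gcongr
  rw [extend hN (le_max_left _ _), ← extend (by push_cast; exact hJ) (le_max_right _ _),
    Finset.sum_range_add, Finset.sum_eq_zero, zero_add]
  intro j hj
  have hj' : (j : ℝ) + 1 ≤ j₀ := by exact_mod_cast Finset.mem_range.1 hj
  exact left j ((mul_le_mul_of_nonneg_right hj' hh.le).trans (floor_div_mul_le hs hh))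

end Floor

lemma sewDelta_eq {ι Ω E : Type*} [AddCommGroup E] (A : ι → ι → Ω → E) (a b c : ι) :
    sewDelta A a b c = A a c - A a b - A b c := rfl

section Grid

variable {T : ℝ}

/-- The projection of a real number to `[s, t]`. -/
noncomputable def clip (s t : Set.Icc (0 : ℝ) T) (x : ℝ) : Set.Icc (0 : ℝ) T :=
  ⟨max (s : ℝ) (min (t : ℝ) x), le_max_of_le_left s.2.1,
    max_le s.2.2 ((min_le_left _ _).trans t.2.2)⟩

variable {s t z : Set.Icc (0 : ℝ) T} {x y h : ℝ}

lemma coe_clip : (clip s t x : ℝ) = max (s : ℝ) (min (t : ℝ) x) := rfl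

lemma clip_mono (h : x ≤ y) : clip s t x ≤ clip s t y := by
  rw [← Subtype.coe_le_coe, coe_clip, coe_clip]
  gcongr

lemma clip_of_le (h : x ≤ s) : clip s t x = s :=
  Subtype.ext (max_eq_left ((min_le_right _ _).trans h))

lemma clip_of_ge (hst : s ≤ t) (h : (t : ℝ) ≤ x) : clip s t x = t :=
  Subtype.ext (by rw [coe_clip, min_eq_left h]; exact max_eq_right hst)

lemma left_le_clip : s ≤ clip s t x := Subtype.coe_le_coe.1 (le_max_left _ _)

lemma clip_le_right (hst : s ≤ t) : clip s t x ≤ t :=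
  Subtype.coe_le_coe.1 (max_le hst (min_le_left _ _))

lemma le_clip_of_clip_ne_right (hst : s ≤ t) (hx : clip s t x ≠ t) : x ≤ clip s t x := by
  have hxt : x ≤ t := not_lt.1 fun h => hx (clip_of_ge hst h.le)
  rw [coe_clip, min_eq_right hxt]
  exact le_max_right _ _

lemma clip_sub_clip_le (h : x ≤ y) : (clip s t y : ℝ) - clip s t x ≤ y - x :=
  calc (clip s t y : ℝ) - clip s t x
      ≤ |(clip s t y : ℝ) - clip s t x| := le_abs_self _
    _ ≤ |min (t : ℝ) y - min (t : ℝ) x| := (abs_max_sub_max_le_max _ _ _ _).trans (by simp)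
    _ ≤ |y - x| := (abs_min_sub_min_le_max _ _ _ _).trans (by simp)
    _ = y - x := abs_of_nonneg (sub_nonneg.2 h)

lemma clip_congr_right (hst : s ≤ t) (hx : x ≤ s) : clip z t x = clip z s x :=
  Subtype.ext (by rw [coe_clip, coe_clip, min_eq_right hx, min_eq_right (hx.trans hst)])

lemma clip_congr_left (hzs : z ≤ s) (hst : s ≤ t) (hx : (s : ℝ) ≤ x) :
    clip z t x = clip s t x := by
  have hs : (s : ℝ) ≤ min (t : ℝ) x := le_min hst hx
  exact Subtype.ext (by rw [coe_clip, coe_clip, max_eq_right hs,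
    max_eq_right ((Subtype.coe_le_coe.2 hzs).trans hs)])

variable {Ω E : Type*} [AddCommGroup E]

/-- The germ over the cell `[j h, (j + 1) h]`, restricted to `[s, t]`. -/
noncomputable def cellGerm (A : Set.Icc (0 : ℝ) T → Set.Icc (0 : ℝ) T → Ω → E)
    (s t : Set.Icc (0 : ℝ) T) (h : ℝ) (j : ℕ) : Ω → E :=
  A (clip s t (j * h)) (clip s t ((j + 1) * h))

/-- The error that is made when the cell `[j h, (j + 1) h]`, restricted to `[s, t]`, is halved. -/
noncomputable def cellDelta (A : Set.Icc (0 : ℝ) T → Set.Icc (0 : ℝ) T → Ω → E)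
    (s t : Set.Icc (0 : ℝ) T) (h : ℝ) (j : ℕ) : Ω → E :=
  sewDelta A (clip s t (j * h)) (clip s t ((j + 1 / 2) * h)) (clip s t ((j + 1) * h))

/-- The Riemann sum over `[s, t]` along the points of the `n`-th dyadic grid. -/
noncomputable def gridSum (A : Set.Icc (0 : ℝ) T → Set.Icc (0 : ℝ) T → Ω → E)
    (s t : Set.Icc (0 : ℝ) T) (n : ℕ) : Ω → E :=
  ∑ j ∈ Finset.range (2 ^ n), cellGerm A s t (dyadicWidth T n) j

variable {A : Set.Icc (0 : ℝ) T → Set.Icc (0 : ℝ) T → Ω → E}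

lemma gridSum_sub_gridSum_succ (n : ℕ) : gridSum A s t n - gridSum A s t (n + 1) =
    ∑ j ∈ Finset.range (2 ^ n), cellDelta A s t (dyadicWidth T n) j := by
  rw [gridSum, gridSum, pow_succ 2 n, sum_range_mul_eq_sum_sum, ← Finset.sum_sub_distrib,
    dyadicWidth_succ]
  refine Finset.sum_congr rfl fun j _ => ?_
  set h := dyadicWidth T n
  rw [Finset.sum_range_succ, Finset.sum_range_one, cellDelta, sewDelta_eq]
  have left : ((j * 2 + 0 : ℕ) : ℝ) * (h / 2) = j * h := by push_cast; ring
  have middle : (((j * 2 + 0 : ℕ) : ℝ) + 1) * (h / 2) = (j + 1 / 2) * h := by push_cast; ring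
  have middle' : ((j * 2 + 1 : ℕ) : ℝ) * (h / 2) = (j + 1 / 2) * h := by push_cast; ring
  have right : (((j * 2 + 1 : ℕ) : ℝ) + 1) * (h / 2) = (j + 1) * h := by push_cast; ring
  rw [cellGerm, cellGerm, cellGerm, left, middle, middle', right]
  abel

lemma le_two_pow_mul_dyadicWidth (t : Set.Icc (0 : ℝ) T) (n : ℕ) :
    (t : ℝ) ≤ ((2 ^ n : ℕ) : ℝ) * dyadicWidth T n := by
  push_cast
  exact t.2.2.trans_eq (two_pow_mul_dyadicWidth T n).symm

section Diagonal

variable (hA : ∀ r, A r r = 0)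
include hA

lemma sewDelta_self_left (a c : Set.Icc (0 : ℝ) T) : sewDelta A a a c = 0 := by
  simp [sewDelta_eq, hA]

lemma sewDelta_self_right (a c : Set.Icc (0 : ℝ) T) : sewDelta A a c c = 0 := by
  simp [sewDelta_eq, hA]

lemma cellGerm_eq_zero_of_le (hh : 0 ≤ h) {j : ℕ} (hj : (j + 1) * h ≤ s) :
    cellGerm A s t h j = 0 := by
  rw [cellGerm, clip_of_le hj, clip_of_le (hj.trans' (by gcongr; linarith)), hA]

lemma cellGerm_eq_zero_of_ge (hst : s ≤ t) (hh : 0 ≤ h) {j : ℕ} (hj : (t : ℝ) ≤ j * h) :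
    cellGerm A s t h j = 0 := by
  rw [cellGerm, clip_of_ge hst hj, clip_of_ge hst (hj.trans (by gcongr; linarith)), hA]

lemma cellDelta_eq_zero_of_le (hh : 0 ≤ h) {j : ℕ} (hj : (j + 1) * h ≤ s) :
    cellDelta A s t h j = 0 := by
  have hmid : ((j : ℝ) + 1 / 2) * h ≤ s := hj.trans' (by gcongr; linarith)
  rw [cellDelta, clip_of_le hj, clip_of_le hmid, sewDelta_self_right hA]

lemma cellDelta_eq_zero_of_ge (hst : s ≤ t) (hh : 0 ≤ h) {j : ℕ} (hj : (t : ℝ) ≤ j * h) :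
    cellDelta A s t h j = 0 := by
  rw [cellDelta, clip_of_ge hst hj, clip_of_ge hst (hj.trans (by gcongr; linarith)),
    sewDelta_self_left hA]

lemma cellDelta_eq_zero_or (hst : s ≤ t) (hh : 0 ≤ h) (j : ℕ) :
    cellDelta A s t h j = 0 ∨ ∃ a b c : Set.Icc (0 : ℝ) T,
      cellDelta A s t h j = sewDelta A a b c ∧ a < b ∧ b < c ∧
      (j : ℝ) * h ≤ a ∧ (c : ℝ) ≤ max (s : ℝ) ((j + 1) * h) ∧ (c : ℝ) - a ≤ h := by
  have hleft : (j : ℝ) * h ≤ (j + 1 / 2) * h := by gcongr; linarith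
  have hright : ((j : ℝ) + 1 / 2) * h ≤ (j + 1) * h := by gcongr; linarith
  rcases (clip_mono (s := s) (t := t) hleft).eq_or_lt with hab | hab
  · exact Or.inl (by rw [cellDelta, hab, sewDelta_self_left hA])
  rcases (clip_mono (s := s) (t := t) hright).eq_or_lt with hbc | hbc
  · exact Or.inl (by rw [cellDelta, hbc, sewDelta_self_right hA])
  refine Or.inr ⟨_, _, _, rfl, hab, hbc, ?_, max_le_max le_rfl (min_le_right _ _), ?_⟩
  · exact le_clip_of_clip_ne_right hst (hab.trans_le (clip_le_right hst)).ne
  · exact (clip_sub_clip_le (hleft.trans hright)).trans_eq (by ring)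

-- If `t - s ≤ T / 2 ^ n`, then at level `n + k` at most `2 ^ (k + 1)` cells meet `[s, t]`.
lemma gridSum_sub_gridSum_succ_eq_sum (hT : 0 < T) (hst : s ≤ t) {n : ℕ}
    (hl : (t : ℝ) - s ≤ dyadicWidth T n) (k : ℕ) :
    gridSum A s t (n + k) - gridSum A s t (n + k + 1) =
      ∑ i ∈ Finset.range (2 ^ (k + 1)), cellDelta A s t (dyadicWidth T (n + k))
        (⌊(s : ℝ) / dyadicWidth T (n + k)⌋₊ + i) := by
  have hh : 0 < dyadicWidth T (n + k) := dyadicWidth_pos hT _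
  rw [gridSum_sub_gridSum_succ]
  refine sum_range_eq_sum_range_floor s.2.1 hh (fun j => cellDelta_eq_zero_of_le hA hh.le)
    (fun j => cellDelta_eq_zero_of_ge hA hst hh.le) (le_two_pow_mul_dyadicWidth t _) ?_
  have hs := lt_floor_div_add_one_mul (s : ℝ) hh
  have hwidth : 2 ^ k * dyadicWidth T (n + k) = dyadicWidth T n := by
    rw [dyadicWidth_add, two_pow_mul_dyadicWidth]
  have hpow : dyadicWidth T (n + k) ≤ 2 ^ k * dyadicWidth T (n + k) :=
    le_mul_of_one_le_left hh.le (one_le_pow₀ one_le_two)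
  push_cast [pow_succ]
  linarith

-- If `t - s ≤ T / 2 ^ n`, then at most one point of the `n`-th grid is interior to `[s, t]`.
lemma exists_sub_gridSum_eq_sewDelta (hT : 0 < T) (hst : s ≤ t) {n : ℕ}
    (hl : (t : ℝ) - s ≤ dyadicWidth T n) :
    ∃ p, s ≤ p ∧ p ≤ t ∧ A s t - gridSum A s t n = sewDelta A s p t := by
  have hh : 0 < dyadicWidth T n := dyadicWidth_pos hT n
  have hsum := sum_range_eq_sum_range_floor (J := 2) s.2.1 hh
    (fun j => cellGerm_eq_zero_of_le (A := A) (t := t) hA hh.le)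
    (fun j => cellGerm_eq_zero_of_ge hA hst hh.le) (le_two_pow_mul_dyadicWidth t n)
  set h := dyadicWidth T n with hh_def
  have hj₀ := floor_div_mul_le s.2.1 hh
  have hj₁ := lt_floor_div_add_one_mul (s : ℝ) hh
  set j₀ := ⌊(s : ℝ) / h⌋₊
  have hj₂ : (t : ℝ) ≤ (j₀ + 1 + 1) * h := by linarith
  refine ⟨clip s t ((j₀ + 1) * h), left_le_clip, clip_le_right hst, ?_⟩
  rw [gridSum, ← hh_def, hsum (by push_cast; linarith), Finset.sum_range_succ,
    Finset.sum_range_one, sewDelta_eq, cellGerm, cellGerm]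
  push_cast
  rw [add_zero, clip_of_le hj₀, clip_of_ge hst hj₂]
  abel

-- `[a, c]` is the grid cell that contains `s`, restricted to `[z, t]`.
lemma exists_gridSum_sub_sub_eq_sewDelta (hT : 0 < T) (hzs : z ≤ s) (hst : s < t) (n : ℕ) :
    ∃ a c, a ≤ s ∧ s < c ∧ (c : ℝ) - a ≤ dyadicWidth T n ∧
      gridSum A z t n - gridSum A z s n - gridSum A s t n = sewDelta A a s c := by
  have hh : 0 < dyadicWidth T n := dyadicWidth_pos hT n
  set h := dyadicWidth T n with hh_def
  have hj₀ := floor_div_mul_le s.2.1 hh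
  have hj₁ := lt_floor_div_add_one_mul (s : ℝ) hh
  have left (j : ℕ) (hj : (j + 1) * h ≤ s) :
      cellGerm A z t h j - cellGerm A z s h j - cellGerm A s t h j = 0 := by
    have hj' : j * h ≤ s := hj.trans' (by gcongr; linarith)
    rw [cellGerm_eq_zero_of_le hA hh.le hj, cellGerm, cellGerm, clip_congr_right hst.le hj,
      clip_congr_right hst.le hj', sub_self, sub_zero]
  have right (j : ℕ) (hj : (s : ℝ) ≤ j * h) :
      cellGerm A z t h j - cellGerm A z s h j - cellGerm A s t h j = 0 := by
    have hj' : (s : ℝ) ≤ (j + 1) * h := hj.trans (by gcongr; linarith)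
    rw [cellGerm_eq_zero_of_ge hA hzs hh.le hj, cellGerm, cellGerm, clip_congr_left hzs hst.le hj,
      clip_congr_left hzs hst.le hj', sub_zero, sub_self]
  have hsum := sum_range_eq_sum_range_floor (J := 1) s.2.1 hh left right
    (le_two_pow_mul_dyadicWidth s n) (by push_cast; exact hj₁.le)
  set j₀ := ⌊(s : ℝ) / h⌋₊
  refine ⟨clip z t (j₀ * h), clip z t ((j₀ + 1) * h), ?_, ?_, ?_, ?_⟩
  · rw [clip_congr_right hst.le hj₀]
    exact clip_le_right hzs
  · exact Subtype.coe_lt_coe.1 (lt_max_of_lt_right (lt_min hst hj₁))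
  · exact (clip_sub_clip_le (by gcongr; linarith)).trans_eq (by ring)
  · rw [gridSum, gridSum, gridSum, ← hh_def, ← Finset.sum_sub_distrib, ← Finset.sum_sub_distrib,
      hsum, Finset.sum_range_one, add_zero, cellGerm, cellGerm, cellGerm,
      clip_congr_left hzs hst.le hj₁.le, clip_congr_right hst.le hj₀, clip_of_ge hzs hj₁.le,
      clip_of_le hj₀, sewDelta_eq]

end Diagonal

end Grid

/-! ### Sewing along dyadic grids -/

/-- The standing assumptions of the stochastic sewing lemma on its exponents. -/
structure SewingExponents (m M α β₁ β₂ : ℝ) : Prop where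
  two_le_m : 2 ≤ m
  M_nonneg : 0 ≤ M
  α_nonneg : 0 ≤ α
  one_lt_β₁ : 1 < β₁
  half_lt_β₂ : 1 / 2 < β₂
  half_lt_sub : 1 / 2 < β₁ - α

/-- An exponent strictly between `max (1 / 2) (1 - α)` and `β₁ - α`; it measures the growth of the
sums of conditionally small terms in the number of terms. -/
noncomputable def sewingExponent (α β₁ : ℝ) : ℝ := (max (1 / 2) (1 - α) + (β₁ - α)) / 2

/-- The constant in the comparison of `∑ k, dyadicWidth h k ^ γ * (2 ^ (k + 1)) ^ θ` with
`l ^ γ` for `h ≤ 2 * l`, including one further summand `l ^ γ`. -/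
noncomputable def dyadicConst (γ θ : ℝ) : ℝ := 1 + 2 ^ γ * dyadicSum γ θ

/-- The constant `K₁` of the conditional bound. -/
noncomputable def sewingConst₁ (β₁ : ℝ) : ℝ := dyadicConst β₁ 1

/-- The constant `K₂` of the term with exponent `β₁ - α`. -/
noncomputable def sewingConst₂ (α β₁ M : ℝ) : ℝ :=
  windowConst M α (sewingExponent α β₁) * dyadicConst (β₁ - α) (sewingExponent α β₁)

/-- The constant `K₃` of the term with exponent `β₂`. -/
noncomputable def sewingConst₃ (α β₁ β₂ M : ℝ) : ℝ :=
  windowConst M α (sewingExponent α β₁) * dyadicConst β₂ (1 / 2)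

/-- The bound, up to the Burkholder-Davis-Gundy constant, on `2 ^ n` errors of cells of
width `w`. -/
noncomputable def levelBound (Γ₁ Γ₂ M α β₁ β₂ w : ℝ) (n : ℕ) : ℝ :=
  windowConst M α (sewingExponent α β₁) * (Γ₁ * (w ^ (β₁ - α) * (2 ^ n) ^ sewingExponent α β₁) +
    Γ₂ * (w ^ β₂ * (2 ^ n) ^ (1 / 2 : ℝ)))

section Constants

variable {γ θ m M α β₁ β₂ Γ₁ Γ₂ w : ℝ}

lemma dyadicConst_nonneg (h : θ < γ) : 0 ≤ dyadicConst γ θ := by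
  have := dyadicSum_nonneg h
  rw [dyadicConst]
  positivity

lemma rpow_add_dyadicSum_le {h l : ℝ} (hh : 0 ≤ h) (hl : 0 ≤ l) (hhl : h ≤ 2 * l) (hγ : 0 ≤ γ)
    (hθγ : θ < γ) : l ^ γ + h ^ γ * dyadicSum γ θ ≤ dyadicConst γ θ * l ^ γ :=
  have := dyadicSum_nonneg hθγ
  calc l ^ γ + h ^ γ * dyadicSum γ θ ≤ l ^ γ + (2 * l) ^ γ * dyadicSum γ θ := by gcongr
    _ = dyadicConst γ θ * l ^ γ := by rw [Real.mul_rpow two_pos.le hl, dyadicConst]; ring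

lemma levelBound_nonneg (hΓ₁ : 0 ≤ Γ₁) (hΓ₂ : 0 ≤ Γ₂) (hw : 0 ≤ w) (n : ℕ) :
    0 ≤ levelBound Γ₁ Γ₂ M α β₁ β₂ w n := by
  have := windowConst_nonneg M α (sewingExponent α β₁)
  unfold levelBound
  positivity

namespace SewingExponents

variable (hE : SewingExponents m M α β₁ β₂)
include hE

lemma one_le_ofReal_m : 1 ≤ ENNReal.ofReal m := ENNReal.one_le_ofReal.2 (by linarith [hE.two_le_m])

lemma sub_pos : 0 < β₁ - α := one_half_pos.trans hE.half_lt_sub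

lemma β₂_pos : 0 < β₂ := one_half_pos.trans hE.half_lt_β₂

lemma max_lt_sub : max (1 / 2) (1 - α) < β₁ - α :=
  max_lt hE.half_lt_sub (sub_lt_sub_right hE.one_lt_β₁ α)

lemma half_le_sewingExponent : 1 / 2 ≤ sewingExponent α β₁ := by
  rw [sewingExponent]
  linarith [hE.max_lt_sub, le_max_left (1 / 2) (1 - α)]

lemma one_sub_lt_sewingExponent : 1 - α < sewingExponent α β₁ := by
  rw [sewingExponent]
  linarith [hE.max_lt_sub, le_max_right (1 / 2) (1 - α)]

lemma sewingExponent_lt_sub : sewingExponent α β₁ < β₁ - α := by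
  rw [sewingExponent]
  linarith [hE.max_lt_sub]

lemma sewingConst₁_nonneg : 0 ≤ sewingConst₁ β₁ := dyadicConst_nonneg hE.one_lt_β₁

lemma sewingConst₂_nonneg : 0 ≤ sewingConst₂ α β₁ M :=
  mul_nonneg (windowConst_nonneg _ _ _) (dyadicConst_nonneg hE.sewingExponent_lt_sub)

lemma sewingConst₃_nonneg : 0 ≤ sewingConst₃ α β₁ β₂ M :=
  mul_nonneg (windowConst_nonneg _ _ _) (dyadicConst_nonneg hE.half_lt_β₂)

lemma hasSum_levelBound {h : ℝ} (hh : 0 ≤ h) :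
    HasSum (fun k => levelBound Γ₁ Γ₂ M α β₁ β₂ (dyadicWidth h k) (k + 1))
      (windowConst M α (sewingExponent α β₁) *
        (Γ₁ * (h ^ (β₁ - α) * dyadicSum (β₁ - α) (sewingExponent α β₁)) +
          Γ₂ * (h ^ β₂ * dyadicSum β₂ (1 / 2)))) :=
  (((hasSum_dyadic hh hE.sewingExponent_lt_sub).mul_left Γ₁).add
    ((hasSum_dyadic hh hE.half_lt_β₂).mul_left Γ₂)).mul_left _

lemma levelBound_zero_add_le {h l : ℝ} (hΓ₁ : 0 ≤ Γ₁) (hΓ₂ : 0 ≤ Γ₂) (hh : 0 ≤ h) (hl : 0 ≤ l)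
    (hhl : h ≤ 2 * l) :
    levelBound Γ₁ Γ₂ M α β₁ β₂ l 0 + windowConst M α (sewingExponent α β₁) *
        (Γ₁ * (h ^ (β₁ - α) * dyadicSum (β₁ - α) (sewingExponent α β₁)) +
          Γ₂ * (h ^ β₂ * dyadicSum β₂ (1 / 2))) ≤
      sewingConst₂ α β₁ M * Γ₁ * l ^ (β₁ - α) + sewingConst₃ α β₁ β₂ M * Γ₂ * l ^ β₂ := by
  have h₁ := rpow_add_dyadicSum_le hh hl hhl hE.sub_pos.le hE.sewingExponent_lt_sub
  have h₂ := rpow_add_dyadicSum_le hh hl hhl hE.β₂_pos.le hE.half_lt_β₂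
  set θ := sewingExponent α β₁ with hθ
  have hW := windowConst_nonneg M α θ
  calc levelBound Γ₁ Γ₂ M α β₁ β₂ l 0 + windowConst M α θ *
        (Γ₁ * (h ^ (β₁ - α) * dyadicSum (β₁ - α) θ) + Γ₂ * (h ^ β₂ * dyadicSum β₂ (1 / 2)))
      = windowConst M α θ * (Γ₁ * (l ^ (β₁ - α) + h ^ (β₁ - α) * dyadicSum (β₁ - α) θ) +
          Γ₂ * (l ^ β₂ + h ^ β₂ * dyadicSum β₂ (1 / 2))) := by
        rw [levelBound, ← hθ, pow_zero, Real.one_rpow, Real.one_rpow]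
        ring
    _ ≤ windowConst M α θ * (Γ₁ * (dyadicConst (β₁ - α) θ * l ^ (β₁ - α)) +
          Γ₂ * (dyadicConst β₂ (1 / 2) * l ^ β₂)) := by gcongr
    _ = sewingConst₂ α β₁ M * Γ₁ * l ^ (β₁ - α) + sewingConst₃ α β₁ β₂ M * Γ₂ * l ^ β₂ := by
        rw [sewingConst₂, sewingConst₃, ← hθ]
        ring

lemma eLpNorm_sum_window_le {Ω : Type u} {mΩ : MeasurableSpace Ω} {P : Measure Ω}
    [IsProbabilityMeasure P] {d : ℕ} {T κ : ℝ} (hκ : IsBDGConstant.{u} m d κ)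
    {𝓕 : Filtration (Set.Icc (0 : ℝ) T) mΩ} (hT : 0 ≤ T) {a : ℝ} (ha : 0 ≤ a) (hw : 0 < w)
    (hΓ₁ : 0 ≤ Γ₁) (hΓ₂ : 0 ≤ Γ₂) {R : ℕ → Ω → EuclideanSpace ℝ (Fin d)}
    (hR : IsWindowLocalized P 𝓕 m M α (Γ₂ * w ^ β₂) (Γ₁ * w ^ β₁) a w R) (n : ℕ) :
    eLpNorm (∑ j ∈ Finset.range (2 ^ n), R j) (ENNReal.ofReal m) P ≤
      ENNReal.ofReal κ * ENNReal.ofReal (levelBound Γ₁ Γ₂ M α β₁ β₂ w n) := by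
  rw [Finset.sum_fn]
  refine (hκ.eLpNorm_sum_window_le hE.two_le_m hT hE.α_nonneg hE.half_le_sewingExponent
    hE.one_sub_lt_sewingExponent ha hw (by positivity) (by positivity) hR n).trans_eq ?_
  rw [levelBound, sub_eq_add_neg β₁ α, Real.rpow_add hw]
  ring_nf

end SewingExponents

end Constants

lemma eLpNorm_add_sum_le {Ω E : Type*} {mΩ : MeasurableSpace Ω} {P : Measure Ω}
    [NormedAddCommGroup E] {p : ℝ≥0∞} (hp : 1 ≤ p) {g : Ω → E} {f : ℕ → Ω → E}
    (hg : AEStronglyMeasurable g P) (hf : ∀ k, AEStronglyMeasurable (f k) P) {c : ℝ≥0∞} {b S : ℝ}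
    {B : ℕ → ℝ} (hb : 0 ≤ b) (hB : ∀ k, 0 ≤ B k) (hBS : HasSum B S)
    (hgb : eLpNorm g p P ≤ c * ENNReal.ofReal b)
    (hfB : ∀ k, eLpNorm (f k) p P ≤ c * ENNReal.ofReal (B k)) (N : ℕ) :
    eLpNorm (g + ∑ k ∈ Finset.range N, f k) p P ≤ c * ENNReal.ofReal (b + S) :=
  calc eLpNorm (g + ∑ k ∈ Finset.range N, f k) p P
      ≤ eLpNorm g p P + eLpNorm (∑ k ∈ Finset.range N, f k) p P :=
        eLpNorm_add_le hg (Finset.aestronglyMeasurable_sum _ fun k _ => hf k) hp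
    _ ≤ eLpNorm g p P + ∑ k ∈ Finset.range N, eLpNorm (f k) p P := by
        gcongr
        exact eLpNorm_sum_le (fun k _ => hf k) hp
    _ ≤ c * ENNReal.ofReal b + ∑ k ∈ Finset.range N, c * ENNReal.ofReal (B k) := by
        gcongr with k
        exact hfB k
    _ = c * ENNReal.ofReal (b + ∑ k ∈ Finset.range N, B k) := by
        rw [← Finset.mul_sum, ← ENNReal.ofReal_sum_of_nonneg fun k _ => hB k, ← mul_add,
          ENNReal.ofReal_add hb (Finset.sum_nonneg fun k _ => hB k)]
    _ ≤ c * ENNReal.ofReal (b + S) := by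
        gcongr
        exact sum_le_hasSum _ (fun k _ => hB k) hBS

/-- The hypotheses of the stochastic sewing lemma, for a germ that vanishes on the diagonal. -/
structure IsSewingGerm {Ω E : Type*} {mΩ : MeasurableSpace Ω} [NormedAddCommGroup E]
    [NormedSpace ℝ E] (P : Measure Ω) {T : ℝ} (𝓕 : Filtration (Set.Icc (0 : ℝ) T) mΩ)
    (A : Set.Icc (0 : ℝ) T → Set.Icc (0 : ℝ) T → Ω → E) (m Γ₁ Γ₂ M α β₁ β₂ : ℝ) : Prop
    extends SewingExponents m M α β₁ β₂ where
  Γ₁_nonneg : 0 ≤ Γ₁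
  Γ₂_nonneg : 0 ≤ Γ₂
  diag : ∀ s, A s s = 0
  adapted : ∀ s t, s ≤ t → StronglyMeasurable[𝓕 t] (A s t)
  memLp : ∀ s t, s ≤ t → MemLp (A s t) (ENNReal.ofReal m) P
  eLpNorm_condExp_le : ∀ t₀ t₁ t₂ t₃ : Set.Icc (0 : ℝ) T, t₀ < t₁ → t₁ < t₂ → t₂ < t₃ →
    M * ((t₃ : ℝ) - t₁) ≤ (t₁ : ℝ) - t₀ →
    eLpNorm (P[sewDelta A t₁ t₂ t₃ | 𝓕 t₀]) (ENNReal.ofReal m) P ≤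
      ENNReal.ofReal (Γ₁ * ((t₁ : ℝ) - t₀) ^ (-α) * ((t₃ : ℝ) - t₁) ^ β₁)
  eLpNorm_le : ∀ t₀ t₁ t₂ : Set.Icc (0 : ℝ) T, t₀ < t₁ → t₁ < t₂ →
    eLpNorm (sewDelta A t₀ t₁ t₂) (ENNReal.ofReal m) P ≤
      ENNReal.ofReal (Γ₂ * ((t₂ : ℝ) - t₀) ^ β₂)

lemma sub_gridSum_add_eq {Ω E : Type*} [AddCommGroup E] {T : ℝ}
    (A : Set.Icc (0 : ℝ) T → Set.Icc (0 : ℝ) T → Ω → E) (s t : Set.Icc (0 : ℝ) T) (n N : ℕ) :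
    A s t - gridSum A s t (n + N) = (A s t - gridSum A s t n) +
      ∑ k ∈ Finset.range N, (gridSum A s t (n + k) - gridSum A s t (n + k + 1)) := by
  have telescope := Finset.sum_range_sub' (fun k => gridSum A s t (n + k)) N
  simp only [← add_assoc, add_zero] at telescope
  rw [telescope, sub_add_sub_cancel]

namespace IsSewingGerm

section NormedSpace

variable {Ω E : Type*} {mΩ : MeasurableSpace Ω} [NormedAddCommGroup E] [NormedSpace ℝ E]
  {P : Measure Ω} {m T Γ₁ Γ₂ M α β₁ β₂ : ℝ} {𝓕 : Filtration (Set.Icc (0 : ℝ) T) mΩ}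
  {A : Set.Icc (0 : ℝ) T → Set.Icc (0 : ℝ) T → Ω → E} {s t t₀ a b c : Set.Icc (0 : ℝ) T} {h : ℝ}

lemma adapted_sewDelta (hA : IsSewingGerm P 𝓕 A m Γ₁ Γ₂ M α β₁ β₂) (hab : a ≤ b) (hbc : b ≤ c) :
    StronglyMeasurable[𝓕 c] (sewDelta A a b c) :=
  ((hA.adapted a c (hab.trans hbc)).sub ((hA.adapted a b hab).mono (𝓕.mono hbc))).sub
    (hA.adapted b c hbc)

lemma memLp_sewDelta (hA : IsSewingGerm P 𝓕 A m Γ₁ Γ₂ M α β₁ β₂) (hab : a ≤ b) (hbc : b ≤ c) :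
    MemLp (sewDelta A a b c) (ENNReal.ofReal m) P :=
  ((hA.memLp a c (hab.trans hbc)).sub (hA.memLp a b hab)).sub (hA.memLp b c hbc)

lemma memLp_cellDelta (hA : IsSewingGerm P 𝓕 A m Γ₁ Γ₂ M α β₁ β₂) (hh : 0 ≤ h) (j : ℕ) :
    MemLp (cellDelta A s t h j) (ENNReal.ofReal m) P :=
  hA.memLp_sewDelta (clip_mono (by gcongr; linarith)) (clip_mono (by gcongr; linarith))

lemma adapted_gridSum (hA : IsSewingGerm P 𝓕 A m Γ₁ Γ₂ M α β₁ β₂) (hT : 0 ≤ T) (hst : s ≤ t)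
    (n : ℕ) : StronglyMeasurable[𝓕 t] (gridSum A s t n) := by
  have hh := dyadicWidth_nonneg hT n
  refine Finset.stronglyMeasurable_sum _ fun j _ => ?_
  exact (hA.adapted _ _ (clip_mono (by gcongr; linarith))).mono (𝓕.mono (clip_le_right hst))

lemma memLp_gridSum (hA : IsSewingGerm P 𝓕 A m Γ₁ Γ₂ M α β₁ β₂) (hT : 0 ≤ T) (n : ℕ) :
    MemLp (gridSum A s t n) (ENNReal.ofReal m) P :=
  have hh := dyadicWidth_nonneg hT n
  memLp_finsetSum' _ fun j _ => hA.memLp _ _ (clip_mono (by gcongr; linarith))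

lemma memLp_sub_gridSum (hA : IsSewingGerm P 𝓕 A m Γ₁ Γ₂ M α β₁ β₂) (hT : 0 ≤ T) (hst : s ≤ t)
    (n : ℕ) : MemLp (A s t - gridSum A s t n) (ENNReal.ofReal m) P :=
  (hA.memLp s t hst).sub (hA.memLp_gridSum hT n)

lemma memLp_gridSum_sub (hA : IsSewingGerm P 𝓕 A m Γ₁ Γ₂ M α β₁ β₂) (hT : 0 ≤ T) (n n' : ℕ) :
    MemLp (gridSum A s t n - gridSum A s t n') (ENNReal.ofReal m) P :=
  (hA.memLp_gridSum hT n).sub (hA.memLp_gridSum hT n')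

lemma isLocalized (hA : IsSewingGerm P 𝓕 A m Γ₁ Γ₂ M α β₁ β₂) (hab : a < b) (hbc : b < c) :
    IsLocalized P 𝓕 m (M * ((c : ℝ) - a)) α (Γ₂ * ((c : ℝ) - a) ^ β₂)
      (Γ₁ * ((c : ℝ) - a) ^ β₁) a c (sewDelta A a b c) where
  adapted := hA.adapted_sewDelta hab.le hbc.le
  eLpNorm_le := hA.eLpNorm_le a b c hab hbc
  eLpNorm_condExp_le t₀ ht₀ hr := by
    rw [mul_right_comm]
    exact hA.eLpNorm_condExp_le t₀ a b c ht₀ hab hbc hr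

lemma isLocalized_of_sub_le (hA : IsSewingGerm P 𝓕 A m Γ₁ Γ₂ M α β₁ β₂) (hab : a < b)
    (hbc : b < c) (hh : (c : ℝ) - a ≤ h) :
    IsLocalized P 𝓕 m (M * (2 * h)) α (Γ₂ * h ^ β₂) (Γ₁ * h ^ β₁) a c (sewDelta A a b c) := by
  have hac : 0 ≤ (c : ℝ) - a := sub_nonneg.2 (Subtype.coe_le_coe.2 (hab.trans hbc).le)
  have := hA.M_nonneg
  have := hA.Γ₁_nonneg
  have := hA.Γ₂_nonneg
  have := hA.β₂_pos
  have := hA.one_lt_β₁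
  refine (hA.isLocalized hab hbc).mono ?_ ?_ ?_ <;> gcongr
  linarith

lemma isWindowLocalized_cellDelta (hA : IsSewingGerm P 𝓕 A m Γ₁ Γ₂ M α β₁ β₂) (hst : s ≤ t)
    (hh : 0 < h) : IsWindowLocalized P 𝓕 m M α (Γ₂ * h ^ β₂) (Γ₁ * h ^ β₁) (⌊(s : ℝ) / h⌋₊ * h) h
      fun i => cellDelta A s t h (⌊(s : ℝ) / h⌋₊ + i) := by
  intro i
  refine (cellDelta_eq_zero_or hA.diag hst hh.le _).imp id ?_
  rintro ⟨a, b, c, heq, hab, hbc, ha, hc, hca⟩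
  have hs := lt_floor_div_add_one_mul (s : ℝ) hh
  have hi : 0 ≤ (i : ℝ) * h := by positivity
  push_cast at ha hc
  refine ⟨a, c, by linarith, hc.trans (max_le ?_ ?_), ?_⟩
  · linarith
  · linarith
  · simpa only [heq] using hA.isLocalized_of_sub_le hab hbc hca

lemma eLpNorm_condExp_sewDelta_le (hA : IsSewingGerm P 𝓕 A m Γ₁ Γ₂ M α β₁ β₂) (ht₀ : t₀ < s)
    (hr : M * ((t : ℝ) - s) ≤ (s : ℝ) - t₀) (hsa : s ≤ a) (hab : a ≤ b) (hbc : b ≤ c)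
    (hct : c ≤ t) (hh : (c : ℝ) - a ≤ h) :
    eLpNorm (P[sewDelta A a b c | 𝓕 t₀]) (ENNReal.ofReal m) P ≤
      ENNReal.ofReal (Γ₁ * ((s : ℝ) - t₀) ^ (-α) * h ^ β₁) := by
  rcases hab.eq_or_lt with rfl | hab
  · simp [sewDelta_self_left hA.diag]
  rcases hbc.eq_or_lt with rfl | hbc
  · simp [sewDelta_self_right hA.diag]
  have hsa' : (s : ℝ) ≤ a := hsa
  have hct' : (c : ℝ) ≤ t := hct
  have hac : 0 ≤ (c : ℝ) - a := sub_nonneg.2 (Subtype.coe_le_coe.2 (hab.trans hbc).le)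
  have hs : 0 < (s : ℝ) - t₀ := sub_pos.2 ht₀
  have := hA.M_nonneg
  have := hA.Γ₁_nonneg
  have := hA.one_lt_β₁
  have hdist : M * ((c : ℝ) - a) ≤ (a : ℝ) - t₀ :=
    calc M * ((c : ℝ) - a) ≤ M * ((t : ℝ) - s) := by gcongr
      _ ≤ (s : ℝ) - t₀ := hr
      _ ≤ (a : ℝ) - t₀ := by gcongr
  have hdecay : ((a : ℝ) - t₀) ^ (-α) ≤ ((s : ℝ) - t₀) ^ (-α) :=
    Real.rpow_le_rpow_of_nonpos hs (by gcongr) (neg_nonpos.2 hA.α_nonneg)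
  refine (hA.eLpNorm_condExp_le t₀ a b c (ht₀.trans_le hsa) hab hbc hdist).trans ?_
  gcongr

variable [IsFiniteMeasure P]

lemma eLpNorm_condExp_gridSum_sub_succ_le [CompleteSpace E]
    (hA : IsSewingGerm P 𝓕 A m Γ₁ Γ₂ M α β₁ β₂) (hT : 0 < T) (hst : s ≤ t) {n : ℕ}
    (hl : (t : ℝ) - s ≤ dyadicWidth T n) (ht₀ : t₀ < s)
    (hr : M * ((t : ℝ) - s) ≤ (s : ℝ) - t₀) (k : ℕ) :
    eLpNorm (P[gridSum A s t (n + k) - gridSum A s t (n + k + 1) | 𝓕 t₀]) (ENNReal.ofReal m) P ≤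
      ENNReal.ofReal (Γ₁ * ((s : ℝ) - t₀) ^ (-α)) *
        ENNReal.ofReal (dyadicWidth (dyadicWidth T n) k ^ β₁ * (2 ^ (k + 1)) ^ (1 : ℝ)) := by
  have hh : 0 < dyadicWidth T (n + k) := dyadicWidth_pos hT _
  have hc : 0 ≤ Γ₁ * ((s : ℝ) - t₀) ^ (-α) :=
    mul_nonneg hA.Γ₁_nonneg (Real.rpow_nonneg (sub_nonneg.2 ht₀.le) _)
  rw [gridSum_sub_gridSum_succ_eq_sum hA.diag hT hst hl, ← dyadicWidth_add]
  set h := dyadicWidth T (n + k)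
  set j₀ := ⌊(s : ℝ) / h⌋₊
  have hcell (j : ℕ) : eLpNorm (P[cellDelta A s t h j | 𝓕 t₀]) (ENNReal.ofReal m) P ≤
      ENNReal.ofReal (Γ₁ * ((s : ℝ) - t₀) ^ (-α) * h ^ β₁) :=
    hA.eLpNorm_condExp_sewDelta_le ht₀ hr left_le_clip (clip_mono (by gcongr; linarith))
      (clip_mono (by gcongr; linarith)) (clip_le_right hst)
      ((clip_sub_clip_le (by gcongr; linarith)).trans_eq (by ring))
  calc eLpNorm (P[∑ i ∈ Finset.range (2 ^ (k + 1)), cellDelta A s t h (j₀ + i) | 𝓕 t₀])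
        (ENNReal.ofReal m) P
      = eLpNorm (∑ i ∈ Finset.range (2 ^ (k + 1)), P[cellDelta A s t h (j₀ + i) | 𝓕 t₀])
          (ENNReal.ofReal m) P := eLpNorm_congr_ae (condExp_finsetSum
            (fun _ _ => (hA.memLp_cellDelta hh.le _).integrable hA.one_le_ofReal_m) _)
    _ ≤ ∑ i ∈ Finset.range (2 ^ (k + 1)), eLpNorm (P[cellDelta A s t h (j₀ + i) | 𝓕 t₀])
          (ENNReal.ofReal m) P :=
        eLpNorm_sum_le (fun _ _ => integrable_condExp.aestronglyMeasurable) hA.one_le_ofReal_m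
    _ ≤ ∑ _ ∈ Finset.range (2 ^ (k + 1)),
          ENNReal.ofReal (Γ₁ * ((s : ℝ) - t₀) ^ (-α) * h ^ β₁) :=
        Finset.sum_le_sum fun _ _ => hcell _
    _ = ENNReal.ofReal (Γ₁ * ((s : ℝ) - t₀) ^ (-α)) *
          ENNReal.ofReal (h ^ β₁ * (2 ^ (k + 1)) ^ (1 : ℝ)) := by
        rw [Finset.sum_const, Finset.card_range, nsmul_eq_mul, ← ENNReal.ofReal_natCast,
          ← ENNReal.ofReal_mul (by positivity), ← ENNReal.ofReal_mul hc, Real.rpow_one]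
        push_cast
        ring_nf

lemma eLpNorm_condExp_sub_gridSum_le [CompleteSpace E]
    (hA : IsSewingGerm P 𝓕 A m Γ₁ Γ₂ M α β₁ β₂) (hT : 0 < T) (hst : s < t) {n : ℕ}
    (hl : (t : ℝ) - s ≤ dyadicWidth T n) (hl' : dyadicWidth T n ≤ 2 * ((t : ℝ) - s))
    (ht₀ : t₀ < s) (hr : M * ((t : ℝ) - s) ≤ (s : ℝ) - t₀) (N : ℕ) :
    eLpNorm (P[A s t - gridSum A s t (n + N) | 𝓕 t₀]) (ENNReal.ofReal m) P ≤
      ENNReal.ofReal (sewingConst₁ β₁ * Γ₁ * ((s : ℝ) - t₀) ^ (-α) * ((t : ℝ) - s) ^ β₁) := by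
  have hp := hA.one_le_ofReal_m
  have hlen : 0 ≤ (t : ℝ) - s := sub_nonneg.2 (Subtype.coe_le_coe.2 hst.le)
  have hh := dyadicWidth_nonneg hT.le n
  have hc : 0 ≤ Γ₁ * ((s : ℝ) - t₀) ^ (-α) :=
    mul_nonneg hA.Γ₁_nonneg (Real.rpow_nonneg (sub_nonneg.2 ht₀.le) _)
  have hcoarse : eLpNorm (P[A s t - gridSum A s t n | 𝓕 t₀]) (ENNReal.ofReal m) P ≤
      ENNReal.ofReal (Γ₁ * ((s : ℝ) - t₀) ^ (-α)) * ENNReal.ofReal (((t : ℝ) - s) ^ β₁) := by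
    obtain ⟨p, hsp, hpt, heq⟩ := exists_sub_gridSum_eq_sewDelta hA.diag hT hst.le hl
    rw [heq, ← ENNReal.ofReal_mul hc]
    exact hA.eLpNorm_condExp_sewDelta_le ht₀ hr le_rfl hsp hpt le_rfl le_rfl
  have hcond : P[A s t - gridSum A s t (n + N) | 𝓕 t₀] =ᵐ[P]
      P[A s t - gridSum A s t n | 𝓕 t₀] + ∑ k ∈ Finset.range N,
        P[gridSum A s t (n + k) - gridSum A s t (n + k + 1) | 𝓕 t₀] := by
    have hdiff (k : ℕ) := (hA.memLp_gridSum_sub (s := s) (t := t) hT.le (n + k)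
      (n + k + 1)).integrable hp
    rw [sub_gridSum_add_eq]
    exact (condExp_add ((hA.memLp_sub_gridSum hT.le hst.le n).integrable hp)
      (integrable_finsetSum' _ fun k _ => hdiff k) _).trans
        (EventuallyEq.rfl.add (condExp_finsetSum (fun k _ => hdiff k) _))
  rw [eLpNorm_congr_ae hcond]
  refine (eLpNorm_add_sum_le hp integrable_condExp.aestronglyMeasurable
    (fun k => integrable_condExp.aestronglyMeasurable) (Real.rpow_nonneg hlen _)
    (fun k => by have := dyadicWidth_nonneg hh k; positivity) (hasSum_dyadic hh hA.one_lt_β₁)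
    hcoarse (hA.eLpNorm_condExp_gridSum_sub_succ_le hT hst.le hl ht₀ hr) N).trans ?_
  rw [← ENNReal.ofReal_mul hc, mul_assoc _ Γ₁, mul_comm _ (Γ₁ * _), mul_assoc _ (sewingConst₁ _)]
  gcongr
  exact rpow_add_dyadicSum_le hh hlen hl' (zero_le_one.trans hA.one_lt_β₁.le) hA.one_lt_β₁

end NormedSpace

section EuclideanSpace

variable {Ω : Type u} {mΩ : MeasurableSpace Ω} {P : Measure Ω} [IsProbabilityMeasure P] {d : ℕ}
  {m κ T Γ₁ Γ₂ M α β₁ β₂ : ℝ} {𝓕 : Filtration (Set.Icc (0 : ℝ) T) mΩ}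
  {A : Set.Icc (0 : ℝ) T → Set.Icc (0 : ℝ) T → Ω → EuclideanSpace ℝ (Fin d)}
  {s t : Set.Icc (0 : ℝ) T}

lemma eLpNorm_gridSum_sub_succ_le (hA : IsSewingGerm P 𝓕 A m Γ₁ Γ₂ M α β₁ β₂)
    (hκ : IsBDGConstant.{u} m d κ) (hT : 0 < T) (hst : s ≤ t) {n : ℕ}
    (hl : (t : ℝ) - s ≤ dyadicWidth T n) (k : ℕ) :
    eLpNorm (gridSum A s t (n + k) - gridSum A s t (n + k + 1)) (ENNReal.ofReal m) P ≤
      ENNReal.ofReal κ * ENNReal.ofReal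
        (levelBound Γ₁ Γ₂ M α β₁ β₂ (dyadicWidth (dyadicWidth T n) k) (k + 1)) := by
  have hh : 0 < dyadicWidth T (n + k) := dyadicWidth_pos hT _
  rw [gridSum_sub_gridSum_succ_eq_sum hA.diag hT hst hl, ← dyadicWidth_add]
  exact hA.eLpNorm_sum_window_le hκ hT.le (by positivity) hh hA.Γ₁_nonneg hA.Γ₂_nonneg
    (hA.isWindowLocalized_cellDelta hst hh) (k + 1)

lemma eLpNorm_sewDelta_le (hA : IsSewingGerm P 𝓕 A m Γ₁ Γ₂ M α β₁ β₂)
    (hκ : IsBDGConstant.{u} m d κ) {p : Set.Icc (0 : ℝ) T} (hsp : s ≤ p) (hpt : p ≤ t) :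
    eLpNorm (sewDelta A s p t) (ENNReal.ofReal m) P ≤
      ENNReal.ofReal κ * ENNReal.ofReal (levelBound Γ₁ Γ₂ M α β₁ β₂ ((t : ℝ) - s) 0) := by
  rcases hsp.eq_or_lt with rfl | hsp
  · simp [sewDelta_self_left hA.diag]
  rcases hpt.eq_or_lt with rfl | hpt
  · simp [sewDelta_self_right hA.diag]
  have hlen : 0 < (t : ℝ) - s := sub_pos.2 (hsp.trans hpt)
  have hR : IsWindowLocalized P 𝓕 m M α (Γ₂ * ((t : ℝ) - s) ^ β₂) (Γ₁ * ((t : ℝ) - s) ^ β₁) s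
      ((t : ℝ) - s) fun j => if j = 0 then sewDelta A s p t else 0 := by
    intro j
    rcases eq_or_ne j 0 with rfl | hj
    · refine Or.inr ⟨s, t, by simp, by push_cast; linarith, ?_⟩
      simpa only [if_true] using hA.isLocalized_of_sub_le hsp hpt le_rfl
    · exact Or.inl (if_neg hj)
  simpa using hA.eLpNorm_sum_window_le hκ (s.2.1.trans s.2.2) s.2.1 hlen hA.Γ₁_nonneg
    hA.Γ₂_nonneg hR 0

lemma eLpNorm_sub_gridSum_le (hA : IsSewingGerm P 𝓕 A m Γ₁ Γ₂ M α β₁ β₂)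
    (hκ : IsBDGConstant.{u} m d κ) (hT : 0 < T) (hst : s < t) {n : ℕ}
    (hl : (t : ℝ) - s ≤ dyadicWidth T n) (hl' : dyadicWidth T n ≤ 2 * ((t : ℝ) - s)) (N : ℕ) :
    eLpNorm (A s t - gridSum A s t (n + N)) (ENNReal.ofReal m) P ≤
      ENNReal.ofReal κ * ENNReal.ofReal (sewingConst₂ α β₁ M * Γ₁ * ((t : ℝ) - s) ^ (β₁ - α) +
        sewingConst₃ α β₁ β₂ M * Γ₂ * ((t : ℝ) - s) ^ β₂) := by
  have hlen : 0 ≤ (t : ℝ) - s := sub_nonneg.2 (Subtype.coe_le_coe.2 hst.le)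
  have hh := dyadicWidth_nonneg hT.le n
  have hcoarse : eLpNorm (A s t - gridSum A s t n) (ENNReal.ofReal m) P ≤
      ENNReal.ofReal κ * ENNReal.ofReal (levelBound Γ₁ Γ₂ M α β₁ β₂ ((t : ℝ) - s) 0) := by
    obtain ⟨p, hsp, hpt, heq⟩ := exists_sub_gridSum_eq_sewDelta hA.diag hT hst.le hl
    rw [heq]
    exact hA.eLpNorm_sewDelta_le hκ hsp hpt
  rw [sub_gridSum_add_eq]
  refine (eLpNorm_add_sum_le hA.one_le_ofReal_m (hA.memLp_sub_gridSum hT.le hst.le n).1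
    (fun k => (hA.memLp_gridSum_sub hT.le _ _).1)
    (levelBound_nonneg hA.Γ₁_nonneg hA.Γ₂_nonneg hlen 0)
    (fun k => levelBound_nonneg hA.Γ₁_nonneg hA.Γ₂_nonneg (dyadicWidth_nonneg hh k) _)
    (hA.hasSum_levelBound hh) hcoarse (hA.eLpNorm_gridSum_sub_succ_le hκ hT hst.le hl) N).trans ?_
  refine mul_le_mul' le_rfl (ENNReal.ofReal_le_ofReal ?_)
  exact hA.levelBound_zero_add_le hA.Γ₁_nonneg hA.Γ₂_nonneg hh hlen hl'

end EuclideanSpace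

end IsSewingGerm

section LpLimits

variable {Ω E : Type*} {m₀ mΩ : MeasurableSpace Ω} {P : Measure Ω} [NormedAddCommGroup E]
  {p : ℝ≥0∞}

lemma exists_tendsto_eLpNorm_of_tsum_ne_top [CompleteSpace E] (hm₀ : m₀ ≤ mΩ) (hp : 1 ≤ p)
    {f : ℕ → Ω → E} (hf : ∀ n, StronglyMeasurable[m₀] (f n)) (hfp : ∀ n, MemLp (f n) p P)
    {B : ℕ → ℝ≥0∞} (hB : ∑' n, B n ≠ ∞) (hfB : ∀ n, eLpNorm (f n - f (n + 1)) p P ≤ B n) :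
    ∃ g, StronglyMeasurable[m₀] g ∧ MemLp g p P ∧
      Tendsto (fun n => eLpNorm (f n - g) p P) atTop (𝓝 0) := by
  have : Fact (1 ≤ p) := ⟨hp⟩
  have hf_trim (n : ℕ) : MemLp (f n) p (P.trim hm₀) :=
    ⟨(hf n).aestronglyMeasurable, by rw [eLpNorm_trim hm₀ (hf n)]; exact (hfp n).2⟩
  have hcauchy : CauchySeq fun n => (hf_trim n).toLp (f n) := by
    refine cauchySeq_of_edist_le_of_tsum_ne_top B (fun n => ?_) hB
    rw [Lp.edist_toLp_toLp, eLpNorm_trim hm₀ ((hf n).sub (hf (n + 1)))]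
    exact hfB n
  obtain ⟨G, hG⟩ := cauchySeq_tendsto_of_complete hcauchy
  have hG_meas : StronglyMeasurable[m₀] G := Lp.stronglyMeasurable G
  refine ⟨G, hG_meas, memLp_of_memLp_trim hm₀ (Lp.memLp G), ?_⟩
  refine (tendsto_iff_edist_tendsto_0.1 hG).congr fun n => ?_
  rw [Lp.edist_def, eLpNorm_congr_ae ((hf_trim n).coeFn_toLp.sub EventuallyEq.rfl),
    eLpNorm_trim hm₀ ((hf n).sub hG_meas)]

lemma eLpNorm_le_of_tendsto_eLpNorm_sub (hp : 1 ≤ p) {f : ℕ → Ω → E} {g : Ω → E}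
    (hf : ∀ n, AEStronglyMeasurable (f n) P) (hg : AEStronglyMeasurable g P)
    (hlim : Tendsto (fun n => eLpNorm (g - f n) p P) atTop (𝓝 0)) {C : ℝ≥0∞}
    (hC : ∀ n, eLpNorm (f n) p P ≤ C) : eLpNorm g p P ≤ C := by
  have hlim' : Tendsto (fun n => eLpNorm (g - f n) p P + C) atTop (𝓝 C) := by
    simpa only [zero_add] using hlim.add_const C
  refine ge_of_tendsto' hlim' fun n => ?_
  calc eLpNorm g p P = eLpNorm (g - f n + f n) p P := by rw [sub_add_cancel]
    _ ≤ eLpNorm (g - f n) p P + eLpNorm (f n) p P := eLpNorm_add_le (hg.sub (hf n)) (hf n) hp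
    _ ≤ eLpNorm (g - f n) p P + C := by gcongr; exact hC n

lemma eLpNorm_condExp_le_of_tendsto_eLpNorm_sub [NormedSpace ℝ E] [CompleteSpace E] (hp : 1 ≤ p)
    {f : ℕ → Ω → E} {g : Ω → E} (hf : ∀ n, Integrable (f n) P) (hg : Integrable g P)
    (hlim : Tendsto (fun n => eLpNorm (g - f n) p P) atTop (𝓝 0)) {C : ℝ≥0∞}
    (hC : ∀ n, eLpNorm (P[f n | m₀]) p P ≤ C) : eLpNorm (P[g | m₀]) p P ≤ C := by
  refine eLpNorm_le_of_tendsto_eLpNorm_sub hp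
    (fun n => integrable_condExp.aestronglyMeasurable) integrable_condExp.aestronglyMeasurable
    (tendsto_of_tendsto_of_tendsto_of_le_of_le tendsto_const_nhds hlim (fun _ => zero_le)
      fun n => ?_) hC
  calc eLpNorm (P[g | m₀] - P[f n | m₀]) p P = eLpNorm (P[g - f n | m₀]) p P :=
        (eLpNorm_congr_ae (condExp_sub hg (hf n) _)).symm
    _ ≤ eLpNorm (g - f n) p P := eLpNorm_condExp_le_eLpNorm _ hp

end LpLimits

lemma tendsto_dyadicWidth (T : ℝ) : Tendsto (dyadicWidth T) atTop (𝓝 0) := by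
  have := (tendsto_inv_atTop_zero.comp
    (tendsto_pow_atTop_atTop_of_one_lt (one_lt_two (α := ℝ)))).const_mul T
  rwa [mul_zero] at this

lemma exists_dyadicWidth_mem_Icc {T : ℝ} {s t : Set.Icc (0 : ℝ) T} (hst : s < t) :
    ∃ n, (t : ℝ) - s ≤ dyadicWidth T n ∧ dyadicWidth T n ≤ 2 * ((t : ℝ) - s) := by
  obtain ⟨n, hlt, hle⟩ := exists_dyadicWidth_lt_le (sub_pos.2 (Subtype.coe_lt_coe.2 hst))
    (show (t : ℝ) - s ≤ T by linarith [s.2.1, t.2.2])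
  refine ⟨n, hle, ?_⟩
  linarith [dyadicWidth_succ T n]

namespace IsSewingGerm

section NormedSpace

variable {Ω E : Type*} {mΩ : MeasurableSpace Ω} [NormedAddCommGroup E] [NormedSpace ℝ E]
  {P : Measure Ω} {m T Γ₁ Γ₂ M α β₁ β₂ : ℝ} {𝓕 : Filtration (Set.Icc (0 : ℝ) T) mΩ}
  {A : Set.Icc (0 : ℝ) T → Set.Icc (0 : ℝ) T → Ω → E} {𝒜 : Set.Icc (0 : ℝ) T → Ω → E}
  {s t z : Set.Icc (0 : ℝ) T}

lemma tendsto_gridSum_sub_sub (hA : IsSewingGerm P 𝓕 A m Γ₁ Γ₂ M α β₁ β₂) (hT : 0 < T)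
    (hzs : z ≤ s) (hst : s < t) :
    Tendsto (fun n => eLpNorm (gridSum A z t n - gridSum A z s n - gridSum A s t n)
      (ENNReal.ofReal m) P) atTop (𝓝 0) := by
  have hlim : Tendsto (fun n => ENNReal.ofReal (Γ₂ * dyadicWidth T n ^ β₂)) atTop (𝓝 0) := by
    have := ((tendsto_dyadicWidth T).rpow_const (p := β₂) (Or.inr hA.β₂_pos.le)).const_mul Γ₂
    rw [Real.zero_rpow hA.β₂_pos.ne', mul_zero] at this
    simpa only [ENNReal.ofReal_zero] using ENNReal.tendsto_ofReal this
  refine tendsto_of_tendsto_of_tendsto_of_le_of_le tendsto_const_nhds hlim (fun _ => zero_le)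
    fun n => ?_
  obtain ⟨a, c, has, hsc, hca, heq⟩ := exists_gridSum_sub_sub_eq_sewDelta hA.diag hT hzs hst n
  simp only [heq]
  rcases has.eq_or_lt with rfl | has
  · simp [sewDelta_self_left hA.diag]
  have hac : 0 ≤ (c : ℝ) - a := sub_nonneg.2 (Subtype.coe_le_coe.2 (has.trans hsc).le)
  have := hA.Γ₂_nonneg
  have := hA.β₂_pos
  refine (hA.eLpNorm_le a s c has hsc).trans ?_
  gcongr

lemma tendsto_gridSum_sub_increment (hA : IsSewingGerm P 𝓕 A m Γ₁ Γ₂ M α β₁ β₂) (hT : 0 < T)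
    (h𝒜 : ∀ t, MemLp (𝒜 t) (ENNReal.ofReal m) P)
    (hlim : ∀ t, Tendsto (fun n => eLpNorm (gridSum A z t n - 𝒜 t) (ENNReal.ofReal m) P)
      atTop (𝓝 0)) (hzs : z ≤ s) (hst : s < t) :
    Tendsto (fun n => eLpNorm (gridSum A s t n - (𝒜 t - 𝒜 s)) (ENNReal.ofReal m) P)
      atTop (𝓝 0) := by
  have hsum := ((hlim t).add (hlim s)).add (hA.tendsto_gridSum_sub_sub hT hzs hst)
  simp only [add_zero] at hsum
  refine tendsto_of_tendsto_of_tendsto_of_le_of_le tendsto_const_nhds hsum (fun _ => zero_le)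
    fun n => ?_
  have hgrid (a b : Set.Icc (0 : ℝ) T) := (hA.memLp_gridSum (s := a) (t := b) hT.le n).1
  have herr (u : Set.Icc (0 : ℝ) T) := (hgrid z u).sub (h𝒜 u).1
  have hp := hA.one_le_ofReal_m
  have hsplit : gridSum A s t n - (𝒜 t - 𝒜 s) = (gridSum A z t n - 𝒜 t) -
      (gridSum A z s n - 𝒜 s) - (gridSum A z t n - gridSum A z s n - gridSum A s t n) := by
    abel
  dsimp only
  rw [hsplit]
  refine (eLpNorm_sub_le ((herr t).sub (herr s))
    (((hgrid z t).sub (hgrid z s)).sub (hgrid s t)) hp).trans ?_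
  gcongr
  exact eLpNorm_sub_le (herr t) (herr s) hp

end NormedSpace

section EuclideanSpace

variable {Ω : Type u} {mΩ : MeasurableSpace Ω} {P : Measure Ω} [IsProbabilityMeasure P] {d : ℕ}
  {m κ T Γ₁ Γ₂ M α β₁ β₂ : ℝ} {𝓕 : Filtration (Set.Icc (0 : ℝ) T) mΩ}
  {A : Set.Icc (0 : ℝ) T → Set.Icc (0 : ℝ) T → Ω → EuclideanSpace ℝ (Fin d)}
  {𝒜 : Set.Icc (0 : ℝ) T → Ω → EuclideanSpace ℝ (Fin d)} {s t : Set.Icc (0 : ℝ) T}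

lemma exists_tendsto_gridSum (hA : IsSewingGerm P 𝓕 A m Γ₁ Γ₂ M α β₁ β₂)
    (hκ : IsBDGConstant.{u} m d κ) (hT : 0 < T) (hst : s ≤ t) :
    ∃ g, StronglyMeasurable[𝓕 t] g ∧ MemLp g (ENNReal.ofReal m) P ∧
      Tendsto (fun n => eLpNorm (gridSum A s t n - g) (ENNReal.ofReal m) P) atTop (𝓝 0) := by
  have hsum := hA.hasSum_levelBound (Γ₁ := Γ₁) (Γ₂ := Γ₂) (dyadicWidth_nonneg hT.le 0)
  have hlen : (t : ℝ) - s ≤ dyadicWidth T 0 := by simp [dyadicWidth]; linarith [s.2.1, t.2.2]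
  refine exists_tendsto_eLpNorm_of_tsum_ne_top (𝓕.le t) hA.one_le_ofReal_m
    (hA.adapted_gridSum hT.le hst) (hA.memLp_gridSum hT.le) (B := fun k => ENNReal.ofReal κ *
      ENNReal.ofReal (levelBound Γ₁ Γ₂ M α β₁ β₂ (dyadicWidth (dyadicWidth T 0) k) (k + 1)))
    ?_ fun k => ?_
  · rw [ENNReal.tsum_mul_left]
    exact ENNReal.mul_ne_top ENNReal.ofReal_ne_top hsum.summable.tsum_ofReal_ne_top
  · simpa only [zero_add] using hA.eLpNorm_gridSum_sub_succ_le hκ hT hst hlen k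

lemma sewingBounds_of_tendsto (hA : IsSewingGerm P 𝓕 A m Γ₁ Γ₂ M α β₁ β₂)
    (hκ : IsBDGConstant.{u} m d κ) (hκ₀ : 0 ≤ κ) (hT : 0 < T)
    (h𝒜 : ∀ t, MemLp (𝒜 t) (ENNReal.ofReal m) P)
    (hlim : ∀ s t, s < t → Tendsto (fun n => eLpNorm (gridSum A s t n - (𝒜 t - 𝒜 s))
      (ENNReal.ofReal m) P) atTop (𝓝 0)) :
    SewingBounds P 𝓕 A m M α β₁ β₂ 𝒜 (sewingConst₁ β₁ * Γ₁) (sewingConst₂ α β₁ M * (κ * Γ₁))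
      (sewingConst₃ α β₁ β₂ M * (κ * Γ₂)) := by
  have hp := hA.one_le_ofReal_m
  have hincr (s t : Set.Icc (0 : ℝ) T) (hst : s < t) :
      MemLp (A s t - (𝒜 t - 𝒜 s)) (ENNReal.ofReal m) P :=
    (hA.memLp s t hst.le).sub ((h𝒜 t).sub (h𝒜 s))
  have hshift (s t : Set.Icc (0 : ℝ) T) (hst : s < t) (n : ℕ) : Tendsto (fun N => eLpNorm
      (A s t - (𝒜 t - 𝒜 s) - (A s t - gridSum A s t (n + N))) (ENNReal.ofReal m) P)
        atTop (𝓝 0) := by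
    refine ((hlim s t hst).comp (tendsto_add_atTop_nat n)).congr fun N => ?_
    rw [sub_sub_sub_cancel_left, Function.comp_apply, add_comm N n]
  constructor
  · intro t₀ s t ht₀ hst hr
    obtain ⟨n, hl, hl'⟩ := exists_dyadicWidth_mem_Icc hst
    change eLpNorm (P[𝒜 t - 𝒜 s - A s t | 𝓕 t₀]) _ P ≤ _
    rw [← neg_sub, eLpNorm_congr_ae (condExp_neg _ _), eLpNorm_neg]
    exact eLpNorm_condExp_le_of_tendsto_eLpNorm_sub hp
      (fun N => (hA.memLp_sub_gridSum hT.le hst.le _).integrable hp)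
      ((hincr s t hst).integrable hp) (hshift s t hst n)
      (hA.eLpNorm_condExp_sub_gridSum_le hT hst hl hl' ht₀ hr)
  · intro s t hst
    obtain ⟨n, hl, hl'⟩ := exists_dyadicWidth_mem_Icc hst
    change eLpNorm (𝒜 t - 𝒜 s - A s t) _ P ≤ _
    rw [eLpNorm_sub_comm]
    refine (eLpNorm_le_of_tendsto_eLpNorm_sub hp
      (fun N => (hA.memLp_sub_gridSum hT.le hst.le _).1) (hincr s t hst).1 (hshift s t hst n)
      (hA.eLpNorm_sub_gridSum_le hκ hT hst hl hl')).trans_eq ?_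
    rw [← ENNReal.ofReal_mul hκ₀]
    ring_nf

lemma exists_sewingBounds_of_pos (hA : IsSewingGerm P 𝓕 A m Γ₁ Γ₂ M α β₁ β₂)
    (hκ : IsBDGConstant.{u} m d κ) (hκ₀ : 0 ≤ κ) (hT : 0 < T) :
    ∃ 𝒜 : Set.Icc (0 : ℝ) T → Ω → EuclideanSpace ℝ (Fin d),
      (∀ t : Set.Icc (0 : ℝ) T, (t : ℝ) = 0 → 𝒜 t =ᵐ[P] 0) ∧
      (∀ t, StronglyMeasurable[𝓕 t] (𝒜 t)) ∧ (∀ t, MemLp (𝒜 t) (ENNReal.ofReal m) P) ∧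
      SewingBounds P 𝓕 A m M α β₁ β₂ 𝒜 (sewingConst₁ β₁ * Γ₁) (sewingConst₂ α β₁ M * (κ * Γ₁))
        (sewingConst₃ α β₁ β₂ M * (κ * Γ₂)) := by
  let z : Set.Icc (0 : ℝ) T := ⟨0, le_rfl, hT.le⟩
  have hz (t : Set.Icc (0 : ℝ) T) : z ≤ t := t.2.1
  choose 𝒜 h𝒜_meas h𝒜 hlim using fun t => hA.exists_tendsto_gridSum hκ hT (hz t)
  refine ⟨𝒜, fun t ht => ?_, h𝒜_meas, h𝒜, hA.sewingBounds_of_tendsto hκ hκ₀ hT h𝒜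
    fun s t hst => hA.tendsto_gridSum_sub_increment hT h𝒜 hlim (hz s) hst⟩
  obtain rfl : t = z := Subtype.ext ht
  have hgrid (n : ℕ) : gridSum A z z n = 0 := Finset.sum_eq_zero fun j _ => by
    have hclip (x : ℝ) : clip z z x = z := le_antisymm (clip_le_right le_rfl) left_le_clip
    rw [cellGerm, hclip, hclip, hA.diag]
  have hzero := hlim z
  simp only [hgrid, zero_sub, eLpNorm_neg] at hzero
  exact (eLpNorm_eq_zero_iff (h𝒜 z).1 (zero_lt_one.trans_le hA.one_le_ofReal_m).ne').1
    (tendsto_nhds_unique tendsto_const_nhds hzero)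

lemma exists_isSewing (hA : IsSewingGerm P 𝓕 A m Γ₁ Γ₂ M α β₁ β₂)
    (hκ : IsBDGConstant.{u} m d κ) (hκ₀ : 0 ≤ κ) (hT : 0 ≤ T) :
    ∃ 𝒜, IsSewing P 𝓕 A m M α β₁ β₂ 𝒜 ∧
      SewingBounds P 𝓕 A m M α β₁ β₂ 𝒜 (sewingConst₁ β₁ * Γ₁) (sewingConst₂ α β₁ M * (κ * Γ₁))
        (sewingConst₃ α β₁ β₂ M * (κ * Γ₂)) := by
  suffices ∃ 𝒜 : Set.Icc (0 : ℝ) T → Ω → EuclideanSpace ℝ (Fin d),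
      (∀ t : Set.Icc (0 : ℝ) T, (t : ℝ) = 0 → 𝒜 t =ᵐ[P] 0) ∧
      (∀ t, StronglyMeasurable[𝓕 t] (𝒜 t)) ∧ (∀ t, MemLp (𝒜 t) (ENNReal.ofReal m) P) ∧
      SewingBounds P 𝓕 A m M α β₁ β₂ 𝒜 (sewingConst₁ β₁ * Γ₁) (sewingConst₂ α β₁ M * (κ * Γ₁))
        (sewingConst₃ α β₁ β₂ M * (κ * Γ₂)) by
    obtain ⟨𝒜, hinit, hmeas, hmem, hbounds⟩ := this
    exact ⟨𝒜, ⟨hinit, hmeas, hmem, _, _, _, mul_nonneg hA.sewingConst₁_nonneg hA.Γ₁_nonneg,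
      mul_nonneg hA.sewingConst₂_nonneg (mul_nonneg hκ₀ hA.Γ₁_nonneg),
      mul_nonneg hA.sewingConst₃_nonneg (mul_nonneg hκ₀ hA.Γ₂_nonneg), hbounds⟩, hbounds⟩
  rcases hT.eq_or_lt with rfl | hT
  · have hirrefl (s t : Set.Icc (0 : ℝ) 0) : ¬ s < t := (Subsingleton.elim s t).not_lt
    exact ⟨0, fun _ _ => EventuallyEq.rfl, fun _ => stronglyMeasurable_zero, fun _ => MemLp.zero,
      fun _ s t _ hst => absurd hst (hirrefl s t), fun s t hst => absurd hst (hirrefl s t)⟩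
  · exact hA.exists_sewingBounds_of_pos hκ hκ₀ hT

end EuclideanSpace

end IsSewingGerm

/-! ### Convergence of Riemann sums and uniqueness -/

/-- A two-parameter family of the size of the errors `𝒜 t - 𝒜 s - A s t` in `SewingBounds`. -/
def IsLocalizedGerm {Ω E : Type*} {mΩ : MeasurableSpace Ω} [NormedAddCommGroup E] [NormedSpace ℝ E]
    {T : ℝ} (P : Measure Ω) (𝓕 : Filtration (Set.Icc (0 : ℝ) T) mΩ) (m M α β₁ β₂ C₁ C₂ C₃ : ℝ)
    (R : Set.Icc (0 : ℝ) T → Set.Icc (0 : ℝ) T → Ω → E) : Prop :=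
  ∀ s t : Set.Icc (0 : ℝ) T, s < t → IsLocalized P 𝓕 m (M * ((t : ℝ) - s)) α
    (C₂ * ((t : ℝ) - s) ^ (β₁ - α) + C₃ * ((t : ℝ) - s) ^ β₂) (C₁ * ((t : ℝ) - s) ^ β₁) s t (R s t)

/-- The bound, up to the Burkholder-Davis-Gundy constant, on the sum of the values of a localized
germ on consecutive intervals with lengths between `dyadicWidth T (l + 1)` and `dyadicWidth T l`.
There are at most `2 ^ (l + 1)` such intervals. -/
noncomputable def classBound (M α β₁ β₂ C₁ C₂ C₃ T : ℝ) (l : ℕ) : ℝ :=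
  windowConst M α (sewingExponent α β₁) *
    (C₂ * (dyadicWidth T l ^ (β₁ - α) * ((2 : ℝ) ^ (l + 1)) ^ (1 / 2 : ℝ)) +
      C₃ * (dyadicWidth T l ^ β₂ * ((2 : ℝ) ^ (l + 1)) ^ (1 / 2 : ℝ)) +
      C₁ * 2 ^ α * (dyadicWidth T l ^ (β₁ - α) * ((2 : ℝ) ^ (l + 1)) ^ sewingExponent α β₁))

lemma SewingExponents.summable_classBound {m M α β₁ β₂ C₁ C₂ C₃ T : ℝ}
    (hE : SewingExponents m M α β₁ β₂) (hT : 0 ≤ T) :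
    Summable (classBound M α β₁ β₂ C₁ C₂ C₃ T) :=
  ((((hasSum_dyadic hT hE.half_lt_sub).summable.mul_left C₂).add
    ((hasSum_dyadic hT hE.half_lt_β₂).summable.mul_left C₃)).add
    ((hasSum_dyadic hT hE.sewingExponent_lt_sub).summable.mul_left (C₁ * 2 ^ α))).mul_left _

section Windows

variable {Ω E : Type*} {mΩ : MeasurableSpace Ω} {P : Measure Ω} [NormedAddCommGroup E]
  [NormedSpace ℝ E] {T : ℝ} {𝓕 : Filtration (Set.Icc (0 : ℝ) T) mΩ} {m M α β₁ β₂ C₁ C₂ C₃ w : ℝ}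

lemma IsLocalizedGerm.isLocalized_of_sub_le {R : Set.Icc (0 : ℝ) T → Set.Icc (0 : ℝ) T → Ω → E}
    (hR : IsLocalizedGerm P 𝓕 m M α β₁ β₂ C₁ C₂ C₃ R) (hE : SewingExponents m M α β₁ β₂)
    (hC₁ : 0 ≤ C₁) (hC₂ : 0 ≤ C₂) (hC₃ : 0 ≤ C₃) {s t : Set.Icc (0 : ℝ) T} (hst : s < t) {h : ℝ}
    (hh : (t : ℝ) - s ≤ h) :
    IsLocalized P 𝓕 m (M * h) α (C₂ * h ^ (β₁ - α) + C₃ * h ^ β₂) (C₁ * h ^ β₁) s t (R s t) := by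
  have hlen : 0 ≤ (t : ℝ) - s := sub_nonneg.2 hst.le
  have hM := hE.M_nonneg
  have hβ₁ := zero_le_one.trans hE.one_lt_β₁.le
  have hβ₂ := hE.β₂_pos.le
  have hβα := hE.sub_pos.le
  exact (hR s t hst).mono (by gcongr) (by gcongr) (by gcongr)

lemma injOn_floor_div {I : Finset ℕ} {x : ℕ → ℝ} (hx : ∀ i, 0 ≤ x i) (hw : 0 < w)
    (hsep : ∀ i ∈ I, ∀ j ∈ I, i < j → x i + w ≤ x j) :
    Set.InjOn (fun i => ⌊x i / w⌋₊) I := by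
  have floor_ne {i j : ℕ} (hi : i ∈ I) (hj : j ∈ I) (hij : i < j) : ⌊x i / w⌋₊ ≠ ⌊x j / w⌋₊ := by
    intro heq
    have hi' := floor_div_mul_le (hx i) hw
    have hj' := lt_floor_div_add_one_mul (x j) hw
    rw [← heq] at hj'
    linarith [hsep i hi j hj hij]
  intro i hi j hj heq
  rcases lt_trichotomy i j with hij | hij | hij
  exacts [absurd heq (floor_ne hi hj hij), hij, absurd heq.symm (floor_ne hj hi hij)]

lemma isWindowLocalized_sum_filter_floor {b g : ℝ} {I : Finset ℕ} {t : ℕ → Set.Icc (0 : ℝ) T}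
    (hw : 0 < w) (ht : ∀ i ∈ I, ∀ j ∈ I, i < j → t (i + 1) ≤ t j)
    (hlt : ∀ i ∈ I, w < (t (i + 1) : ℝ) - t i) (hle : ∀ i ∈ I, (t (i + 1) : ℝ) - t i ≤ 2 * w)
    {R : ℕ → Ω → E}
    (hR : ∀ i ∈ I, IsLocalized P 𝓕 m (M * (2 * w)) α b g (t i) (t (i + 1)) (R i)) :
    IsWindowLocalized P 𝓕 m M α b g 0 w fun j => ∑ i ∈ I with ⌊(t i : ℝ) / w⌋₊ = j, R i := by
  have hinj : Set.InjOn (fun i => ⌊(t i : ℝ) / w⌋₊) I :=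
    injOn_floor_div (fun i => (t i).2.1) hw fun i hi j hj hij => by
      have : (t (i + 1) : ℝ) ≤ t j := ht i hi j hj hij
      linarith [hlt i hi]
  intro j
  beta_reduce
  rcases (I.filter fun i => ⌊(t i : ℝ) / w⌋₊ = j).eq_empty_or_nonempty with hempty | ⟨i, hi⟩
  · exact Or.inl (by rw [hempty, Finset.sum_empty])
  obtain ⟨hiI, rfl⟩ := Finset.mem_filter.1 hi
  have hsingle : (I.filter fun k => ⌊(t k : ℝ) / w⌋₊ = ⌊(t i : ℝ) / w⌋₊) = {i} :=
    Finset.eq_singleton_iff_unique_mem.2 ⟨hi, fun k hk =>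
      hinj (Finset.mem_filter.1 hk).1 hiI (Finset.mem_filter.1 hk).2⟩
  rw [hsingle, Finset.sum_singleton]
  have hfloor := floor_div_mul_le (t i).2.1 hw
  have hfloor' := lt_floor_div_add_one_mul (t i : ℝ) hw
  exact Or.inr ⟨t i, t (i + 1), by linarith, by linarith [hle i hiI], hR i hiI⟩

end Windows

namespace PartitionUpTo

variable {T : ℝ} {τ : Set.Icc (0 : ℝ) T}

lemma abs_sub_le_mesh (π : PartitionUpTo τ) {i : ℕ} (hi : i < π.n) :
    |(π.pt (i + 1) : ℝ) - π.pt i| ≤ π.mesh :=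
  le_ciSup (f := fun i : Fin π.n => |(π.pt (i + 1) : ℝ) - π.pt i|)
    (Set.finite_range _).bddAbove ⟨i, hi⟩

lemma pt_le_pt (π : PartitionUpTo τ) {i j : ℕ} (hij : i ≤ j) (hj : j ≤ π.n) :
    π.pt i ≤ π.pt j := by
  induction j, hij using Nat.le_induction with
  | base => exact le_rfl
  | succ j _ ih => exact (ih (by lia)).trans (π.pt_lt j (by lia)).le

lemma exists_dyadic_class (π : PartitionUpTo τ) {l₀ : ℕ} (hl₀ : π.mesh ≤ dyadicWidth T l₀) :
    ∃ cls : ℕ → ℕ, ∀ i < π.n, dyadicWidth T (cls i + l₀ + 1) < (π.pt (i + 1) : ℝ) - π.pt i ∧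
      (π.pt (i + 1) : ℝ) - π.pt i ≤ dyadicWidth T (cls i + l₀) := by
  have exists_index i : ∃ l : ℕ, i < π.n →
      dyadicWidth T (l + l₀ + 1) < (π.pt (i + 1) : ℝ) - π.pt i ∧
      (π.pt (i + 1) : ℝ) - π.pt i ≤ dyadicWidth T (l + l₀) := by
    by_cases hi : i < π.n
    · obtain ⟨l, hlt, hle⟩ := exists_dyadicWidth_lt_le (T := dyadicWidth T l₀)
        (sub_pos.2 (Subtype.coe_lt_coe.2 (π.pt_lt i hi)))
        ((le_abs_self _).trans ((π.abs_sub_le_mesh hi).trans hl₀))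
      refine ⟨l, fun _ => ?_⟩
      rw [add_comm l, add_assoc, dyadicWidth_add T l₀, dyadicWidth_add T l₀]
      exact ⟨hlt, hle⟩
    · exact ⟨0, fun h => absurd h hi⟩
  exact ⟨_, fun i => (exists_index i).choose_spec⟩

lemma riemannSum_sub {Ω E : Type*} [AddCommGroup E] {𝒜 : Set.Icc (0 : ℝ) T → Ω → E}
    {A : Set.Icc (0 : ℝ) T → Set.Icc (0 : ℝ) T → Ω → E} (π : PartitionUpTo τ) :
    π.riemannSum (fun s t => 𝒜 t - 𝒜 s - A s t) = 𝒜 τ - 𝒜 (π.pt 0) - π.riemannSum A := by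
  funext ω
  simp only [riemannSum, Pi.sub_apply]
  rw [Finset.sum_sub_distrib, Finset.sum_range_sub (fun i => 𝒜 (π.pt i) ω), π.pt_last]

/-- The partition of `[0, τ]` into `N` intervals of equal length. -/
noncomputable def uniform (hτ : 0 < (τ : ℝ)) {N : ℕ} (hN : 0 < N) : PartitionUpTo τ where
  n := N
  pt i := ⟨(min i N : ℕ) * (τ / N), by have := τ.2.1; positivity, by
    refine le_trans ?_ τ.2.2
    rw [← mul_div_assoc, div_le_iff₀ (by positivity), mul_comm]
    gcongr
    exact min_le_right _ _⟩
  pt_lt i hi := by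
    rw [← Subtype.coe_lt_coe]
    have : (i : ℝ) < N := by exact_mod_cast hi
    have : (i : ℝ) + 1 ≤ N := by exact_mod_cast hi
    push_cast
    gcongr
    simp [*]
  pt_zero := by simp
  pt_last := Subtype.ext <| by
    simp only [min_self]
    field_simp

lemma mesh_uniform (hτ : 0 < (τ : ℝ)) {N : ℕ} (hN : 0 < N) :
    (uniform hτ hN).mesh = τ / N := by
  have : Nonempty (Fin (uniform hτ hN).n) := ⟨⟨0, hN⟩⟩
  have hlen (i : Fin (uniform hτ hN).n) :
      |((uniform hτ hN).pt (i + 1) : ℝ) - (uniform hτ hN).pt i| = τ / N := by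
    change |((min (i + 1) N : ℕ) : ℝ) * (τ / N) - (min i N : ℕ) * (τ / N)| = τ / N
    have hi : (i : ℕ) < N := i.2
    rw [min_eq_left (Nat.succ_le_of_lt hi), min_eq_left hi.le, ← sub_mul, Nat.cast_succ,
      add_sub_cancel_left, one_mul, abs_of_pos (by positivity)]
  simp only [mesh, hlen, ciSup_const]

lemma exists_abs_mesh_lt (τ : Set.Icc (0 : ℝ) T) {ε : ℝ} (hε : 0 < ε) :
    ∃ π : PartitionUpTo τ, |π.mesh| < ε := by
  rcases τ.2.1.eq_or_lt with hτ | hτ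
  · refine ⟨⟨0, fun _ => τ, by simp, hτ.symm, rfl⟩, ?_⟩
    rw [mesh, Real.iSup_of_isEmpty, abs_zero]
    exact hε
  · obtain ⟨N, hN⟩ := exists_nat_gt ((τ : ℝ) / ε)
    have hN₀ : (0 : ℝ) < N := (div_pos hτ hε).trans hN
    refine ⟨uniform hτ (Nat.cast_pos.1 hN₀), ?_⟩
    rw [mesh_uniform, abs_of_pos (by positivity), div_lt_iff₀ hN₀]
    exact (div_lt_iff₀' hε).1 hN

instance neBot_comap_mesh (τ : Set.Icc (0 : ℝ) T) :
    (comap (mesh (τ := τ)) (𝓝 0)).NeBot := by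
  refine comap_neBot fun U hU => ?_
  obtain ⟨ε, hε, hU⟩ := Metric.mem_nhds_iff.1 hU
  obtain ⟨π, hπ⟩ := exists_abs_mesh_lt τ hε
  exact ⟨π, hU (by simpa using hπ)⟩

end PartitionUpTo

lemma SewingBounds.isLocalizedGerm {Ω : Type*} {mΩ : MeasurableSpace Ω} {P : Measure Ω}
    {d : ℕ} {T m M α β₁ β₂ C₁ C₂ C₃ : ℝ} {𝓕 : Filtration (Set.Icc (0 : ℝ) T) mΩ}
    {A : Set.Icc (0 : ℝ) T → Set.Icc (0 : ℝ) T → Ω → EuclideanSpace ℝ (Fin d)}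
    {𝒜 : Set.Icc (0 : ℝ) T → Ω → EuclideanSpace ℝ (Fin d)}
    (h : SewingBounds P 𝓕 A m M α β₁ β₂ 𝒜 C₁ C₂ C₃)
    (hA : ∀ s t, s ≤ t → StronglyMeasurable[𝓕 t] (A s t))
    (h𝒜 : ∀ t, StronglyMeasurable[𝓕 t] (𝒜 t)) :
    IsLocalizedGerm P 𝓕 m M α β₁ β₂ C₁ C₂ C₃ fun s t => 𝒜 t - 𝒜 s - A s t := fun s t hst =>
  { adapted := ((h𝒜 t).sub ((h𝒜 s).mono (𝓕.mono hst.le))).sub (hA s t hst.le)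
    eLpNorm_le := h.2 s t hst
    eLpNorm_condExp_le := fun t₀ ht₀ hr => by
      rw [mul_right_comm]
      exact h.1 t₀ s t ht₀ hst hr }

section RiemannSums

variable {Ω : Type u} {mΩ : MeasurableSpace Ω} {P : Measure Ω} [IsProbabilityMeasure P]
  {d : ℕ} {m κ T M α β₁ β₂ C₁ C₂ C₃ : ℝ} {𝓕 : Filtration (Set.Icc (0 : ℝ) T) mΩ}
  {R A : Set.Icc (0 : ℝ) T → Set.Icc (0 : ℝ) T → Ω → EuclideanSpace ℝ (Fin d)}
  {𝒜 𝒜' : Set.Icc (0 : ℝ) T → Ω → EuclideanSpace ℝ (Fin d)}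

namespace IsLocalizedGerm

lemma eLpNorm_sum_class_le (hR : IsLocalizedGerm P 𝓕 m M α β₁ β₂ C₁ C₂ C₃ R)
    (hE : SewingExponents m M α β₁ β₂) (hκ : IsBDGConstant.{u} m d κ) (hT : 0 < T)
    (hC₁ : 0 ≤ C₁) (hC₂ : 0 ≤ C₂) (hC₃ : 0 ≤ C₃) {l : ℕ} {I : Finset ℕ}
    {t : ℕ → Set.Icc (0 : ℝ) T} (ht : ∀ i ∈ I, ∀ j ∈ I, i < j → t (i + 1) ≤ t j)
    (hlt : ∀ i ∈ I, dyadicWidth T (l + 1) < (t (i + 1) : ℝ) - t i)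
    (hle : ∀ i ∈ I, (t (i + 1) : ℝ) - t i ≤ dyadicWidth T l) :
    eLpNorm (∑ i ∈ I, R (t i) (t (i + 1))) (ENNReal.ofReal m) P ≤
      ENNReal.ofReal κ * ENNReal.ofReal (classBound M α β₁ β₂ C₁ C₂ C₃ T l) := by
  set w := dyadicWidth T (l + 1)
  have hw : 0 < w := dyadicWidth_pos hT _
  have hwl : dyadicWidth T l = 2 * w := by linarith [dyadicWidth_succ T l]
  have hmaps : ∀ i ∈ I, ⌊(t i : ℝ) / w⌋₊ ∈ Finset.range (2 ^ (l + 1)) := fun i hi => by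
    have hgrid : (⌊(t i : ℝ) / w⌋₊ : ℝ) * w < 2 ^ (l + 1) * w := by
      rw [two_pow_mul_dyadicWidth]
      linarith [floor_div_mul_le (t i).2.1 hw, hlt i hi, (t (i + 1)).2.2]
    exact Finset.mem_range.2 (by exact_mod_cast lt_of_mul_lt_mul_right hgrid hw.le)
  have hlocalized := isWindowLocalized_sum_filter_floor hw ht hlt (fun i hi => hwl ▸ hle i hi)
    fun i hi => hR.isLocalized_of_sub_le hE hC₁ hC₂ hC₃
      (Subtype.coe_lt_coe.1 (sub_pos.1 (hw.trans (hlt i hi)))) (hwl ▸ hle i hi)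
  rw [← Finset.sum_fiberwise_of_maps_to hmaps, Finset.sum_fn]
  refine (hκ.eLpNorm_sum_window_le hE.two_le_m hT.le hE.α_nonneg hE.half_le_sewingExponent
    hE.one_sub_lt_sewingExponent le_rfl hw (by positivity) (by positivity) hlocalized
    (l + 1)).trans_eq ?_
  have hwα : w ^ (-α) = 2 ^ α * (2 * w) ^ (-α) := by
    rw [Real.mul_rpow two_pos.le hw.le, ← mul_assoc, ← Real.rpow_add two_pos]
    simp
  rw [classBound, hwl, hwα, sub_eq_add_neg β₁ α, Real.rpow_add (by positivity : 0 < 2 * w)]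
  ring_nf

lemma eLpNorm_riemannSum_le (hR : IsLocalizedGerm P 𝓕 m M α β₁ β₂ C₁ C₂ C₃ R)
    (hE : SewingExponents m M α β₁ β₂) (hκ : IsBDGConstant.{u} m d κ) (hT : 0 < T)
    (hC₁ : 0 ≤ C₁) (hC₂ : 0 ≤ C₂) (hC₃ : 0 ≤ C₃) {τ : Set.Icc (0 : ℝ) T} (π : PartitionUpTo τ)
    {l₀ : ℕ} (hl₀ : π.mesh ≤ dyadicWidth T l₀) :
    eLpNorm (π.riemannSum R) (ENNReal.ofReal m) P ≤ ENNReal.ofReal κ *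
      ∑' l, ENNReal.ofReal (classBound M α β₁ β₂ C₁ C₂ C₃ T (l + l₀)) := by
  obtain ⟨cls, hcls⟩ := π.exists_dyadic_class hl₀
  set N := (Finset.range π.n).sup cls + 1
  have hmaps : ∀ i ∈ Finset.range π.n, cls i ∈ Finset.range N := fun i hi =>
    Finset.mem_range.2 (Nat.lt_succ_of_le (Finset.le_sup hi))
  have hmeas : ∀ i ∈ Finset.range π.n,
      AEStronglyMeasurable (R (π.pt i) (π.pt (i + 1))) P := fun i hi =>
    ((hR _ _ (π.pt_lt i (Finset.mem_range.1 hi))).adapted.mono (𝓕.le _)).aestronglyMeasurable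
  have class_le (l : ℕ) :
      eLpNorm (∑ i ∈ Finset.range π.n with cls i = l, R (π.pt i) (π.pt (i + 1)))
        (ENNReal.ofReal m) P ≤
      ENNReal.ofReal κ * ENNReal.ofReal (classBound M α β₁ β₂ C₁ C₂ C₃ T (l + l₀)) := by
    have hcls' : ∀ i ∈ (Finset.range π.n).filter (cls · = l),
        dyadicWidth T (l + l₀ + 1) < (π.pt (i + 1) : ℝ) - π.pt i ∧
        (π.pt (i + 1) : ℝ) - π.pt i ≤ dyadicWidth T (l + l₀) := fun i hi => by
      obtain ⟨hin, rfl⟩ := Finset.mem_filter.1 hi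
      exact hcls i (Finset.mem_range.1 hin)
    exact hR.eLpNorm_sum_class_le hE hκ hT hC₁ hC₂ hC₃
      (fun i _ j hj hij => π.pt_le_pt hij (Finset.mem_range.1 (Finset.mem_filter.1 hj).1).le)
      (fun i hi => (hcls' i hi).1) (fun i hi => (hcls' i hi).2)
  have hsum : π.riemannSum R = ∑ l ∈ Finset.range N,
      ∑ i ∈ Finset.range π.n with cls i = l, R (π.pt i) (π.pt (i + 1)) := by
    rw [Finset.sum_fiberwise_of_maps_to hmaps, Finset.sum_fn]
    rfl
  rw [hsum, ← ENNReal.tsum_mul_left]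
  exact (eLpNorm_sum_le (fun l _ => Finset.aestronglyMeasurable_sum _ fun i hi =>
    hmeas i (Finset.mem_filter.1 hi).1) hE.one_le_ofReal_m).trans
    ((Finset.sum_le_sum fun l _ => class_le l).trans (ENNReal.sum_le_tsum _))

lemma tendsto_riemannSum (hR : IsLocalizedGerm P 𝓕 m M α β₁ β₂ C₁ C₂ C₃ R)
    (hE : SewingExponents m M α β₁ β₂) (hC₁ : 0 ≤ C₁) (hC₂ : 0 ≤ C₂) (hC₃ : 0 ≤ C₃)
    (τ : Set.Icc (0 : ℝ) T) :
    Tendsto (fun π : PartitionUpTo τ => eLpNorm (π.riemannSum R) (ENNReal.ofReal m) P)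
      (comap PartitionUpTo.mesh (𝓝 0)) (𝓝 0) := by
  rcases (τ.2.1.trans τ.2.2).eq_or_lt with rfl | hT
  · refine tendsto_const_nhds.congr fun π => ?_
    have hn : π.n = 0 := by
      by_contra hn
      exact absurd (π.pt_lt 0 (Nat.pos_of_ne_zero hn)) (Subsingleton.elim _ _).not_lt
    have hzero : π.riemannSum R = 0 := by
      funext ω
      simp [PartitionUpTo.riemannSum, hn]
    rw [hzero, eLpNorm_zero]
  have htail := ENNReal.Tendsto.const_mul (a := ENNReal.ofReal (bdgConst.{u} m d))
    (ENNReal.tendsto_sum_nat_add _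
      (hE.summable_classBound (C₁ := C₁) (C₂ := C₂) (C₃ := C₃) hT.le).tsum_ofReal_ne_top)
    (Or.inr ENNReal.ofReal_ne_top)
  rw [mul_zero] at htail
  rw [ENNReal.tendsto_nhds_zero] at htail ⊢
  intro ε hε
  obtain ⟨l₀, hl₀⟩ := (htail ε hε).exists
  have hfine : ∀ᶠ x : ℝ in 𝓝 0, x ≤ dyadicWidth T l₀ := eventually_le_nhds (dyadicWidth_pos hT l₀)
  filter_upwards [tendsto_comap.eventually hfine] with π hπ
  exact (hR.eLpNorm_riemannSum_le hE (isBDGConstant_bdgConst hE.two_le_m d) hT hC₁ hC₂ hC₃ π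
    hπ).trans hl₀

end IsLocalizedGerm

namespace IsSewing

lemma tendsto_riemannSum (h : IsSewing P 𝓕 A m M α β₁ β₂ 𝒜) (hE : SewingExponents m M α β₁ β₂)
    (hA : ∀ s t, s ≤ t → StronglyMeasurable[𝓕 t] (A s t)) (τ : Set.Icc (0 : ℝ) T) :
    Tendsto (fun π : PartitionUpTo τ =>
        eLpNorm (fun ω => π.riemannSum A ω - 𝒜 τ ω) (ENNReal.ofReal m) P)
      (comap PartitionUpTo.mesh (𝓝 0)) (𝓝 0) := by
  obtain ⟨C₁, C₂, C₃, hC₁, hC₂, hC₃, hb⟩ := h.bounds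
  refine ((hb.isLocalizedGerm hA h.adapted).tendsto_riemannSum hE hC₁ hC₂ hC₃ τ).congr fun π => ?_
  rw [π.riemannSum_sub, ← eLpNorm_neg]
  refine eLpNorm_congr_ae ?_
  filter_upwards [h.initial (π.pt 0) π.pt_zero] with ω hω
  simp [hω]

lemma ae_eq (h : IsSewing P 𝓕 A m M α β₁ β₂ 𝒜) (h' : IsSewing P 𝓕 A m M α β₁ β₂ 𝒜')
    (hE : SewingExponents m M α β₁ β₂) (hA : ∀ s t, s ≤ t → StronglyMeasurable[𝓕 t] (A s t))
    (τ : Set.Icc (0 : ℝ) T) : 𝒜' τ =ᵐ[P] 𝒜 τ := by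
  have hsum := (h.tendsto_riemannSum hE hA τ).add (h'.tendsto_riemannSum hE hA τ)
  rw [add_zero] at hsum
  have hle : eLpNorm (𝒜' τ - 𝒜 τ) (ENNReal.ofReal m) P ≤ 0 := by
    refine ge_of_tendsto hsum (Eventually.of_forall fun π => ?_)
    have hmeas : AEStronglyMeasurable (π.riemannSum A) P :=
      (Finset.stronglyMeasurable_fun_sum _ fun i hi =>
        (hA _ _ (π.pt_lt i (Finset.mem_range.1 hi)).le).mono (𝓕.le _)).aestronglyMeasurable
    rw [← sub_sub_sub_cancel_left (𝒜 τ) (𝒜' τ) (π.riemannSum A)]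
    exact eLpNorm_sub_le (hmeas.sub (h.memLp τ).1) (hmeas.sub (h'.memLp τ).1) hE.one_le_ofReal_m
  have hzero := (eLpNorm_eq_zero_iff ((h'.memLp τ).1.sub (h.memLp τ).1)
    (zero_lt_one.trans_le hE.one_le_ofReal_m).ne').1 (le_antisymm hle zero_le)
  filter_upwards [hzero] with ω hω
  exact sub_eq_zero.1 hω

end IsSewing

end RiemannSums

open Classical in
/-- The germ that agrees with `A` off the diagonal and vanishes on it. Germs that vanish only
almost surely on the diagonal are replaced by it, and `SewingBounds` does not see the difference. -/
noncomputable def offDiagonal {ι Ω E : Type*} [Zero E] (A : ι → ι → Ω → E) (s t : ι) : Ω → E :=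
  if s = t then 0 else A s t

section OffDiagonal

section Order

variable {ι Ω E : Type*}

lemma offDiagonal_self [Zero E] (A : ι → ι → Ω → E) (s : ι) : offDiagonal A s s = 0 :=
  if_pos rfl

variable [Preorder ι] {s u t : ι}

lemma offDiagonal_of_lt [Zero E] (A : ι → ι → Ω → E) (hst : s < t) :
    offDiagonal A s t = A s t :=
  if_neg hst.ne

lemma sewDelta_offDiagonal [AddCommGroup E] (A : ι → ι → Ω → E) (hsu : s < u) (hut : u < t) :
    sewDelta (offDiagonal A) s u t = sewDelta A s u t := by
  rw [sewDelta_eq, sewDelta_eq, offDiagonal_of_lt A hsu, offDiagonal_of_lt A hut,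
    offDiagonal_of_lt A (hsu.trans hut)]

end Order

variable {Ω E : Type*} {mΩ : MeasurableSpace Ω} {P : Measure Ω} {T : ℝ}
  {𝓕 : Filtration (Set.Icc (0 : ℝ) T) mΩ}
  {m Γ₁ Γ₂ M α β₁ β₂ C₁ C₂ C₃ : ℝ}

lemma SewingExponents.isSewingGerm_offDiagonal [NormedAddCommGroup E] [NormedSpace ℝ E]
    {A : Set.Icc (0 : ℝ) T → Set.Icc (0 : ℝ) T → Ω → E} (hE : SewingExponents m M α β₁ β₂)
    (hΓ₁ : 0 ≤ Γ₁) (hΓ₂ : 0 ≤ Γ₂) (hA : ∀ s t, s ≤ t → StronglyMeasurable[𝓕 t] (A s t))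
    (hA_memLp : ∀ s t, s ≤ t → MemLp (A s t) (ENNReal.ofReal m) P)
    (hA_condExp : ∀ t₀ t₁ t₂ t₃ : Set.Icc (0 : ℝ) T, t₀ < t₁ → t₁ < t₂ → t₂ < t₃ →
      M * ((t₃ : ℝ) - t₁) ≤ (t₁ : ℝ) - t₀ →
      eLpNorm (P[sewDelta A t₁ t₂ t₃ | 𝓕 t₀]) (ENNReal.ofReal m) P ≤
        ENNReal.ofReal (Γ₁ * ((t₁ : ℝ) - t₀) ^ (-α) * ((t₃ : ℝ) - t₁) ^ β₁))
    (hA_le : ∀ t₀ t₁ t₂ : Set.Icc (0 : ℝ) T, t₀ < t₁ → t₁ < t₂ →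
      eLpNorm (sewDelta A t₀ t₁ t₂) (ENNReal.ofReal m) P ≤
        ENNReal.ofReal (Γ₂ * ((t₂ : ℝ) - t₀) ^ β₂)) :
    IsSewingGerm P 𝓕 (offDiagonal A) m Γ₁ Γ₂ M α β₁ β₂ where
  toSewingExponents := hE
  Γ₁_nonneg := hΓ₁
  Γ₂_nonneg := hΓ₂
  diag := offDiagonal_self A
  adapted s t hst := by
    rcases hst.eq_or_lt with rfl | hlt
    · exact offDiagonal_self A s ▸ stronglyMeasurable_zero
    · exact offDiagonal_of_lt A hlt ▸ hA s t hst
  memLp s t hst := by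
    rcases hst.eq_or_lt with rfl | hlt
    · exact offDiagonal_self A s ▸ MemLp.zero
    · exact offDiagonal_of_lt A hlt ▸ hA_memLp s t hst
  eLpNorm_condExp_le t₀ t₁ t₂ t₃ h₀₁ h₁₂ h₂₃ hM :=
    sewDelta_offDiagonal A h₁₂ h₂₃ ▸ hA_condExp t₀ t₁ t₂ t₃ h₀₁ h₁₂ h₂₃ hM
  eLpNorm_le t₀ t₁ t₂ h₀₁ h₁₂ := sewDelta_offDiagonal A h₀₁ h₁₂ ▸ hA_le t₀ t₁ t₂ h₀₁ h₁₂

variable {d : ℕ} {A : Set.Icc (0 : ℝ) T → Set.Icc (0 : ℝ) T → Ω → EuclideanSpace ℝ (Fin d)}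
  {𝒜 : Set.Icc (0 : ℝ) T → Ω → EuclideanSpace ℝ (Fin d)}

lemma SewingBounds.of_offDiagonal
    (h : SewingBounds P 𝓕 (offDiagonal A) m M α β₁ β₂ 𝒜 C₁ C₂ C₃) :
    SewingBounds P 𝓕 A m M α β₁ β₂ 𝒜 C₁ C₂ C₃ :=
  ⟨fun t₀ t₁ t₂ h₀₁ h₁₂ hM => offDiagonal_of_lt A h₁₂ ▸ h.1 t₀ t₁ t₂ h₀₁ h₁₂ hM,
    fun t₁ t₂ h₁₂ => offDiagonal_of_lt A h₁₂ ▸ h.2 t₁ t₂ h₁₂⟩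

lemma IsSewing.of_offDiagonal (h : IsSewing P 𝓕 (offDiagonal A) m M α β₁ β₂ 𝒜) :
    IsSewing P 𝓕 A m M α β₁ β₂ 𝒜 where
  initial := h.initial
  adapted := h.adapted
  memLp := h.memLp
  bounds := by
    obtain ⟨C₁, C₂, C₃, hC₁, hC₂, hC₃, hbounds⟩ := h.bounds
    exact ⟨C₁, C₂, C₃, hC₁, hC₂, hC₃, hbounds.of_offDiagonal⟩

end OffDiagonal

theorem theorem1p1 :
    ∃ (K₁ : ℝ → ℝ) (K₂ K₃ : ℝ → ℝ → ℝ → ℝ → ℝ),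
      ∀ (Ω : Type u) (mΩ : MeasurableSpace Ω) (P : Measure Ω) (_ : IsProbabilityMeasure P)
        (d : ℕ) (T : ℝ) (_ : 0 ≤ T) (𝓕 : Filtration (Set.Icc (0 : ℝ) T) mΩ)
        (A : Set.Icc (0 : ℝ) T → Set.Icc (0 : ℝ) T → Ω → EuclideanSpace ℝ (Fin d))
        (m Γ₁ Γ₂ M α β₁ β₂ : ℝ),
        2 ≤ m → 0 ≤ Γ₁ → 0 ≤ Γ₂ → 0 ≤ M → 0 ≤ α → 0 ≤ β₁ → 0 ≤ β₂ →
        (∀ s, A s s =ᵐ[P] 0) →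
        (∀ s t, s ≤ t → StronglyMeasurable[𝓕 t] (A s t)) →
        (∀ s t, s ≤ t → MemLp (A s t) (ENNReal.ofReal m) P) →
        (∀ t₀ t₁ t₂ t₃ : Set.Icc (0 : ℝ) T, t₀ < t₁ → t₁ < t₂ → t₂ < t₃ →
          M * ((t₃ : ℝ) - t₁) ≤ (t₁ : ℝ) - t₀ →
          eLpNorm (P[sewDelta A t₁ t₂ t₃ | 𝓕 t₀]) (ENNReal.ofReal m) P ≤
            ENNReal.ofReal (Γ₁ * ((t₁ : ℝ) - t₀) ^ (-α) * ((t₃ : ℝ) - t₁) ^ β₁)) →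
        (∀ t₀ t₁ t₂ : Set.Icc (0 : ℝ) T, t₀ < t₁ → t₁ < t₂ →
          eLpNorm (sewDelta A t₀ t₁ t₂) (ENNReal.ofReal m) P ≤
            ENNReal.ofReal (Γ₂ * ((t₂ : ℝ) - t₀) ^ β₂)) →
        1 < β₁ → 1 / 2 < β₂ → 1 / 2 < β₁ - α →
        ∃ 𝒜 : Set.Icc (0 : ℝ) T → Ω → EuclideanSpace ℝ (Fin d),
          IsSewing P 𝓕 A m M α β₁ β₂ 𝒜 ∧
          (∀ 𝒜' : Set.Icc (0 : ℝ) T → Ω → EuclideanSpace ℝ (Fin d),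
            IsSewing P 𝓕 A m M α β₁ β₂ 𝒜' → ∀ t, 𝒜' t =ᵐ[P] 𝒜 t) ∧
          (∃ C₁ C₂ C₃ : ℝ, 0 ≤ C₁ ∧ 0 ≤ C₂ ∧ 0 ≤ C₃ ∧
            C₁ ≤ K₁ β₁ * Γ₁ ∧
            C₂ ≤ K₂ α β₁ β₂ M * (bdgConst.{u} m d * Γ₁) ∧
            C₃ ≤ K₃ α β₁ β₂ M * (bdgConst.{u} m d * Γ₂) ∧
            SewingBounds P 𝓕 A m M α β₁ β₂ 𝒜 C₁ C₂ C₃) ∧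
          (∀ τ : Set.Icc (0 : ℝ) T,
            Tendsto
              (fun π : PartitionUpTo τ =>
                eLpNorm (fun ω => π.riemannSum A ω - 𝒜 τ ω) (ENNReal.ofReal m) P)
              (comap PartitionUpTo.mesh (𝓝 0)) (𝓝 0)) := by
  refine ⟨sewingConst₁, fun α β₁ _ M => sewingConst₂ α β₁ M, sewingConst₃, ?_⟩
  intro Ω mΩ P _ d T hT 𝓕 A m Γ₁ Γ₂ M α β₁ β₂ hm hΓ₁ hΓ₂ hM hα _ _ _ hA hA_memLp hA_condExp hA_le
    hβ₁ hβ₂ hβα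
  have hE : SewingExponents m M α β₁ β₂ := ⟨hm, hM, hα, hβ₁, hβ₂, hβα⟩
  have hκ₀ := bdgConst_nonneg.{u} m d
  obtain ⟨𝒜, hsewing, hbounds⟩ :=
    (hE.isSewingGerm_offDiagonal hΓ₁ hΓ₂ hA hA_memLp hA_condExp hA_le).exists_isSewing
      (isBDGConstant_bdgConst hm d) hκ₀ hT
  have h𝒜 : IsSewing P 𝓕 A m M α β₁ β₂ 𝒜 := hsewing.of_offDiagonal
  exact ⟨𝒜, h𝒜, fun 𝒜' h𝒜' => h𝒜.ae_eq h𝒜' hE hA,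
    ⟨_, _, _, mul_nonneg hE.sewingConst₁_nonneg hΓ₁,
      mul_nonneg hE.sewingConst₂_nonneg (mul_nonneg hκ₀ hΓ₁),
      mul_nonneg hE.sewingConst₃_nonneg (mul_nonneg hκ₀ hΓ₂), le_rfl, le_rfl, le_rfl,
      hbounds.of_offDiagonal⟩,
    h𝒜.tendsto_riemannSum hE hA⟩
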